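/- **Setting.** Let $S^4\subset\mathbb R^5$ be the unit sphere, oriented so that a basis $(v_1,\dots,v_4)$ of $T_xS^4$ is positive iff $(x,v_1,\dots,v_4)$ is positive in $\mathbb R^5$, and let $\Lambda^2_-S^4$ be its bundle of anti-self-dual 2-forms, with the connection induced by the Levi-Civita connection and the fibre metric for which $\omega_1=e^{12}-e^{34}$, $\omega_2=e^{13}-e^{42}$, $\omega_3=e^{14}-e^{23}$ are orthonormal for every oriented orthonormal coframe $(e^i)$ (the fibres being oriented by $(\omega_1,\omega_2,\omega_3)$). For $\lambda>0$ let $r$ be the norm in the fibres, $s_\lambda=(\lambda+r^2)^{1/4}$, $\tau$ the tautological 2-form, and consider the Bryant–Salamon $G_2$-structure $$\varphi_\lambda=2s_\lambda\,d\tau+s_\lambda^{-3}\,\mathrm{vol}_{\mathcal V},\qquad g_\lambda=2s_\lambda^2\,g_{\mathcal H}+s_\lambda^{-2}\,g_{\mathcal V}.$$ A coassociative submanifold is an embedded 4-dimensional submanifold which, suitably oriented, is calibrated by $*\varphi_\lambda$. The group $\mathrm{SO}(3)$ acts on the traceless symmetric real $3\times3$ matrices by $X\mapsto gXg^{-1}$;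 under the identification $$\begin{pmatrix}\lambda_1&\mu_1&\mu_2\\ \mu_1&\lambda_2&\mu_3\\ \mu_2&\mu_3&-\lambda_1-\lambda_2\end{pmatrix}\mapsto\Big(\lambda_1+\tfrac{\lambda_2}{2},\,-\mu_2,\,\mu_3,\,\mu_1,\,-\tfrac{\sqrt3}{2}\lambda_2\Big)$$ with $\mathbb R^5$ this is the irreducible action on $S^4$, and it lifts to $\Lambda^2_-S^4$. On $S^4\setminus\{x_5=\pm1\}$ use the oriented orthonormal frame $$e_1=\tfrac{(-x_2,x_1,-x_4,x_3,0)}{\sqrt{1-x_5^2}},\quad e_2=\tfrac{(-x_3,x_4,x_1,-x_2,0)}{\sqrt{1-x_5^2}},\quad e_3=\tfrac{(-x_4,-x_3,x_2,x_1,0)}{\sqrt{1-x_5^2}},\quad e_4=\tfrac{(-x_1x_5,-x_2x_5,-x_3x_5,-x_4x_5,1-x_5^2)}{\sqrt{1-x_5^2}},$$ and write $(x;a_1,a_2,a_3)$ for the point $\sum_i a_i\omega_i$ over $x$, where the $\omega_i$ are formed from the coframe dual to $(e_i)$. **Theorem.** Let $\lambda>0$, let $I\subset\mathbb R$ be an open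 interval, and let $x_1,x_5,a_1,a_2,a_3:I\to\mathbb R$ be smooth functions with $x_1>0$, $|x_5|<\tfrac12$ and $x_1^2+x_5^2=1$ on $I$ (so $\sqrt3/2<x_1\le1$), whose derivatives $\dot x_1,\dot x_5,\dot a_1,\dot a_2,\dot a_3$ never vanish simultaneously, and which satisfy, with $r^2=a_1^2+a_2^2+a_3^2$, $$4\{(2\sqrt3x_1+4x_5+1)\dot x_5+\sqrt3(2x_5-1)\dot x_1\}a_1+8x_1(-x_1+\sqrt3x_5)\dot a_1-(\sqrt3x_1+x_5+1)(1-2x_5)\,a_1\tfrac{d}{dt}\log(\lambda+r^2)=0,$$ $$4\{(2\sqrt3x_1-4x_5-1)\dot x_5+\sqrt3(2x_5-1)\dot x_1\}a_2+8x_1(x_1+\sqrt3x_5)\dot a_2+(-\sqrt3x_1+x_5+1)(1-2x_5)\,a_2\tfrac{d}{dt}\log(\lambda+r^2)=0,$$ $$4\{-(x_5+1)\dot x_5+3x_1\dot x_1\}a_3+2(x_1^2-3x_5^2)\dot a_3+(1+x_5)(1-2x_5)\,a_3\tfrac{d}{dt}\log(\lambda+r^2)=0.$$ Then $$M=\mathrm{SO}(3)\cdot\{(x_1(t),0,0,0,x_5(t);\,a_1(t),a_2(t),a_3(t));\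 t\in I\}$$ is a coassociative submanifold of $(\Lambda^2_-S^4,\varphi_\lambda,g_\lambda)$, invariant under the lifted irreducible $\mathrm{SO}(3)$-action. -/

import Mathlib

open scoped Topology

attribute [local instance] Matrix.normedAddCommGroup Matrix.normedSpace

noncomputable section

namespace BryantSalamon

/-! ## Submanifolds of a normed space -/

/-- `L` is an embedded smooth `k`-dimensional submanifold (without boundary) of `E`: around each of
its points, a relatively open piece of `L` is the image of an open subset of `ℝᵏ` under a smooth
immersion which is a homeomorphism onto its image. -/
def IsEmbeddedSubmanifold {E : Type*} [NormedAddCommGroup E] [NormedSpace ℝ E]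
    (k : ℕ) (L : Set E) : Prop :=
  ∀ p ∈ L, ∃ (U : Set (Fin k → ℝ)) (V : Set E) (f : (Fin k → ℝ) → E),
    IsOpen U ∧ IsOpen V ∧ p ∈ V ∧ ContDiffOn ℝ (⊤ : ℕ∞) f U ∧
    (∀ u ∈ U, Function.Injective (fderiv ℝ f u)) ∧
    Topology.IsEmbedding (fun u : U => f u) ∧ f '' U = L ∩ V

/-- The tangent vectors of `L` at `p`: the velocities at `p` of curves in `L`. -/
def tangentVectors {E : Type*} [NormedAddCommGroup E] [NormedSpace ℝ E]
    (L : Set E) (p : E) : Set E :=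
  {v | ∃ γ : ℝ → E, γ 0 = p ∧ (∀ᶠ t in 𝓝 (0 : ℝ), γ t ∈ L) ∧ HasDerivAt γ v 0}

/-! ## The bundle of anti-self-dual 2-forms over the 4-sphere

A 2-form on `T_x S⁴ = x^⊥ ⊂ ℝ⁵` is extended by zero in the direction `x`, hence given by a skew
matrix `ω` with `ω x = 0`, and its values are `ω(u, v) = uᵀ ω v`. -/

/-- The space `ℝ⁵ × ℝ^{5 × 5}` in which the total space of the bundle lies. -/
abbrev Ambient : Type := (Fin 5 → ℝ) × Matrix (Fin 5) (Fin 5) ℝ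

/-- The value `ω(u, v)` of a 2-form. -/
def evalForm (ω : Matrix (Fin 5) (Fin 5) ℝ) (u v : Fin 5 → ℝ) : ℝ := u ⬝ᵥ ω.mulVec v

/-- The 2-form `u♭ ∧ v♭`. -/
def wedge (u v : Fin 5 → ℝ) : Matrix (Fin 5) (Fin 5) ℝ :=
  Matrix.vecMulVec u v - Matrix.vecMulVec v u

/-- For `x ∈ S⁴`, the volume form of `S⁴` at `x` evaluated on `u₁, u₂, u₃, u₄`; a basis of `T_x S⁴`
is oriented if it is preceded by the outward normal `x` in an oriented basis of `ℝ⁵`. -/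
def volSphere (x u₁ u₂ u₃ u₄ : Fin 5 → ℝ) : ℝ := (Matrix.of ![x, u₁, u₂, u₃, u₄]).det

/-- The Hodge star on 2-forms on `T_x S⁴`,
`(⋆ω)(u, v) = ½ ∑ₗₘ vol(u, v, εₗ, εₘ) ω(εₗ, εₘ)` (`ε` the standard basis of `ℝ⁵`). -/
def hodgeStar (x : Fin 5 → ℝ) (ω : Matrix (Fin 5) (Fin 5) ℝ) : Matrix (Fin 5) (Fin 5) ℝ :=
  Matrix.of fun i j => (1 / 2 : ℝ) * ∑ l, ∑ m,
    volSphere x (Pi.single i 1) (Pi.single j 1) (Pi.single l 1) (Pi.single m 1) * ω l m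

/-- The total space of `Λ²₋ S⁴`. -/
def asdBundle : Set Ambient :=
  {p | p.1 ⬝ᵥ p.1 = 1 ∧ p.2.transpose = -p.2 ∧ p.2.mulVec p.1 = 0 ∧ hodgeStar p.1 p.2 = -p.2}

/-- The fibre metric, normalised so that for an oriented orthonormal coframe `e¹, …, e⁴` the forms
`ω₁ = e¹² - e³⁴`, `ω₂ = e¹³ - e⁴²`, `ω₃ = e¹⁴ - e²³` are orthonormal in `Λ²₋`. -/
def fibreInner (α β : Matrix (Fin 5) (Fin 5) ℝ) : ℝ := (1 / 4 : ℝ) * ∑ i, ∑ j, α i j * β i j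

/-- The vector product of the oriented Euclidean 3-space `Λ²₋ T_x^* S⁴`: `ω₁ × ω₂ = ω₃`,
`ω₂ × ω₃ = ω₁`, `ω₃ × ω₁ = ω₂`. -/
def fibreCross (α β : Matrix (Fin 5) (Fin 5) ℝ) : Matrix (Fin 5) (Fin 5) ℝ :=
  (1 / 2 : ℝ) • (α * β - β * α)

/-- The volume form of the fibres, with value `1` on `(ω₁, ω₂, ω₃)`. -/
def fibreVol (α β γ : Matrix (Fin 5) (Fin 5) ℝ) : ℝ := fibreInner (fibreCross α β) γ

/-- The vertical part of the tangent vector `U` at `p = (x, ω)` with respect to the Levi-Civita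
connection: the covariant derivative of a curve of 2-forms along a curve in `S⁴` is the tangential
part of its derivative, so `U = (u, η)` has vertical part `P η P`, where `P = 1 - x xᵀ`. In a local
frame this is `∑ᵢ bᵢ(U) ωᵢ` with `bᵢ = daᵢ + ∑ⱼ aⱼ γⱼᵢ`. -/
def vert (p U : Ambient) : Matrix (Fin 5) (Fin 5) ℝ :=
  (1 - Matrix.vecMulVec p.1 p.1) * U.2 * (1 - Matrix.vecMulVec p.1 p.1)

/-- `λ + r²`, where `r` is the norm in the fibre. -/
def rho (lam : ℝ) (p : Ambient) : ℝ := lam + fibreInner p.2 p.2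

/-- `s_λ = (λ + r²)^{1/4}`. -/
def sFun (lam : ℝ) (p : Ambient) : ℝ := rho lam p ^ (1 / 4 : ℝ)

/-- The metric `g_λ = 2 s_λ² g_H + s_λ⁻² g_V`. -/
def metric (lam : ℝ) (p U V : Ambient) : ℝ :=
  2 * sFun lam p ^ 2 * (U.1 ⬝ᵥ V.1) + 1 / sFun lam p ^ 2 * fibreInner (vert p U) (vert p V)

/-- The exterior derivative `dτ = ∑ᵢ bᵢ ∧ π^* ωᵢ` of the tautological 2-form
`τ_{(x, ω)}(U, V) = ω(π_* U, π_* V)`. -/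
def dTau (p U V W : Ambient) : ℝ :=
  evalForm (vert p U) V.1 W.1 + evalForm (vert p V) W.1 U.1 + evalForm (vert p W) U.1 V.1

/-- The 3-form `φ_λ = 2 s_λ dτ + s_λ⁻³ vol_V`. -/
def phi (lam : ℝ) (p U V W : Ambient) : ℝ :=
  2 * sFun lam p * dTau p U V W
    + 1 / sFun lam p ^ 3 * fibreVol (vert p U) (vert p V) (vert p W)

/-- The 4-form `∑ bⱼ ∧ bₖ ∧ π^* ωᵢ`, summed over the cyclic permutations `(i, j, k)` of
`(1, 2, 3)`: it is the sum over the six shuffles, as `∑ (bⱼ ∧ bₖ)(U, V) ωᵢ = vert U × vert V`. -/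
def bbOmega (p : Ambient) (U : Fin 4 → Ambient) : ℝ :=
  let F (i j k l : Fin 4) : ℝ :=
    evalForm (fibreCross (vert p (U i)) (vert p (U j))) (U k).1 (U l).1
  F 0 1 2 3 - F 0 2 1 3 + F 0 3 1 2 + F 1 2 0 3 - F 1 3 0 2 + F 2 3 0 1

/-- The Hodge dual `⋆φ_λ = 4 s_λ⁴ π^* vol_{S⁴} - 2 ∑ bⱼ ∧ bₖ ∧ π^* ωᵢ`.
In the orthonormal coframe `(f¹, …, f⁷) = (b₁/s, b₂/s, b₃/s, √2 s e¹, …, √2 s e⁴)` of `g_λ`,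
`φ_λ = f¹²³ + f¹⁴⁵ - f¹⁶⁷ + f²⁴⁶ + f²⁵⁷ + f³⁴⁷ - f³⁵⁶` and
`⋆φ_λ = f⁴⁵⁶⁷ + f²³⁶⁷ - f²³⁴⁵ + f¹³⁵⁷ + f¹³⁴⁶ + f¹²⁵⁶ - f¹²⁴⁷`. -/
def starPhi (lam : ℝ) (p : Ambient) (U : Fin 4 → Ambient) : ℝ :=
  4 * sFun lam p ^ 4 * volSphere p.1 (U 0).1 (U 1).1 (U 2).1 (U 3).1 - 2 * bbOmega p U

/-- `L` is a coassociative submanifold of `(Λ²₋ S⁴, φ_λ, g_λ)`: an embedded 4-dimensional submanifold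
calibrated by `⋆φ_λ`, that is, on each tangent space `⋆φ_λ` is the volume form of `g_λ` for one of
the two orientations (which then orients `L`). -/
def IsCoassociative (lam : ℝ) (L : Set Ambient) : Prop :=
  L ⊆ asdBundle ∧ IsEmbeddedSubmanifold 4 L ∧
  ∀ p ∈ L, ∀ v : Fin 4 → Ambient, (∀ i, v i ∈ tangentVectors L p) →
    (∀ i j, metric lam p (v i) (v j) = if i = j then 1 else 0) →
    |starPhi lam p v| = 1

/-! ## The irreducible action of SO(3) and its lift -/

/-- The identification of the traceless symmetric `3 × 3` matrices with `ℝ⁵`. -/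
def ofSym (X : Matrix (Fin 3) (Fin 3) ℝ) : Fin 5 → ℝ :=
  ![X 0 0 + X 1 1 / 2, -X 0 2, X 1 2, X 0 1, -(√3 / 2) * X 1 1]

/-- The inverse of the identification. -/
def toSym (x : Fin 5 → ℝ) : Matrix (Fin 3) (Fin 3) ℝ :=
  !![x 0 + x 4 / √3, x 3, -x 1;
     x 3, -(2 * x 4 / √3), x 2;
     -x 1, x 2, -x 0 + x 4 / √3]

theorem ofSym_toSym (x : Fin 5 → ℝ) : ofSym (toSym x) = x := by
  ext i
  fin_cases i <;> simp [ofSym, toSym]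
  all_goals field_simp
  all_goals ring

/-- The irreducible representation of `SO(3)` on `ℝ⁵`, as a matrix: `X ↦ g X g⁻¹` on the traceless
symmetric matrices (`g⁻¹ = gᵀ`). -/
def irrRep (g : Matrix.specialOrthogonalGroup (Fin 3) ℝ) : Matrix (Fin 5) (Fin 5) ℝ :=
  Matrix.of fun i j => ofSym (g.1 * toSym (Pi.single j 1) * g.1.transpose) i

/-- The lift of the irreducible action to 2-forms: `(x, ω) ↦ (ρ x, ω(ρ⁻¹ ·, ρ⁻¹ ·))`, `ρ = ρ(g)`
being orthogonal. -/
def irrLift (g : Matrix.specialOrthogonalGroup (Fin 3) ℝ) (p : Ambient) : Ambient :=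
  ((irrRep g).mulVec p.1, irrRep g * p.2 * (irrRep g).transpose)

/-! ## The local frame on `S⁴ \ {x₅ = ±1}` -/

/-- The oriented orthonormal frame `e₁, …, e₄`. -/
def frame (x : Fin 5 → ℝ) : Fin 4 → Fin 5 → ℝ :=
  ![(1 / √(1 - x 4 ^ 2)) • ![-x 1, x 0, -x 3, x 2, 0],
    (1 / √(1 - x 4 ^ 2)) • ![-x 2, x 3, x 0, -x 1, 0],
    (1 / √(1 - x 4 ^ 2)) • ![-x 3, -x 2, x 1, x 0, 0],
    (1 / √(1 - x 4 ^ 2)) • ![-(x 0 * x 4), -(x 1 * x 4), -(x 2 * x 4), -(x 3 * x 4), 1 - x 4 ^ 2]]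

/-- The local trivialisation `ω₁ = e¹² - e³⁴`, `ω₂ = e¹³ - e⁴²`, `ω₃ = e¹⁴ - e²³` of `Λ²₋ S⁴`. -/
def omegaFrame (x : Fin 5 → ℝ) : Fin 3 → Matrix (Fin 5) (Fin 5) ℝ :=
  ![wedge (frame x 0) (frame x 1) - wedge (frame x 2) (frame x 3),
    wedge (frame x 0) (frame x 2) - wedge (frame x 3) (frame x 1),
    wedge (frame x 0) (frame x 3) - wedge (frame x 1) (frame x 2)]

/-- The point `(x, a)` with fibre coordinates `a₁, a₂, a₃`. -/
def ofCoords (x : Fin 5 → ℝ) (a : Fin 3 → ℝ) : Ambient := (x, ∑ i, a i • omegaFrame x i)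

/-- `SO(3) · {c(t) ; t ∈ I}`, the union of the orbits that meet the path `c`. -/
def sweep (I : Set ℝ) (c : ℝ → Ambient) : Set Ambient :=
  {q | ∃ g : Matrix.specialOrthogonalGroup (Fin 3) ℝ, ∃ t ∈ I, q = irrLift g (c t)}

end BryantSalamon

end

/-! Calibration and embeddedness rest on separate arguments.

Calibration. Once `symRep` is known to have determinant 1 (`det_symRep`), the lifted action consists
of rotations of `ℝ⁵`, and these preserve `metric` and `starPhi`. Every tangent space can thus be
moved to the fibre over the first basis vector, where seven coordinates suffice
(`metric_eq_coordGram`, `starPhi_eq_psi`). It is spanned there by three infinitesimal rotations and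
the velocity of the path. Harvey and Lawson's coassociator identity says `⋆φ(v₁,…,v₄)² + |χ|² = |v₁
∧ ⋯ ∧ v₄|²`, where `χ` is the combination of the `vᵢ` whose coefficients are, up to sign, the values
of `φ` on the other three vectors. Here `φ` vanishes on the three infinitesimal rotations for every
path, and the three differential equations say that it vanishes on two of them together with the
velocity. Hence `χ = 0`: this is `det_gramGen`, applied to solutions in `SliceEq.psi_sq` and passed
on to orthonormal frames by `abs_psi_eq_one`.

Embeddedness. The path must not return to, or accumulate at, an orbit that it meets. An orbit
determines `x₅`, through the determinant of the symmetric matrix (`IsRot.slice_eq`), and `r²`; so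
`height = (1 - 2x₅)²(λ + r²)` is a function of the orbit. At a critical point of `height` the
equations force the whole velocity to vanish (`SliceEq.eq_zero`), which regularity excludes. So
`height` is strictly monotone along the path, and `t` depends continuously on the orbit
(`IsSolution.tendsto_of_tendsto_path`). Stabilisers consist of diagonal sign matrices, which change
the signs of the `aᵢ`. Each equation is linear and homogeneous in its `aᵢ` once the logarithmic
derivative is taken as a known coefficient, so each `aᵢ` vanishes everywhere or nowhere, and the
stabiliser is constant along the path (`IsSolution.stabilizer`). The set is therefore `SO(3)/Γ × I`
with `Γ` finite; compactness of `SO(3)` makes the local inverses of the orbit parametrisation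
continuous (`nhdsWithin_orbitSet_le`). Finally, velocities of curves in the set lie in the range of
the derivative of a chart (`IsChart.exists_fderiv_eq`). -/

noncomputable section
namespace BryantSalamon

open Matrix

/-! ## Rotations and the irreducible representation -/

/-- `A` is a rotation matrix. -/
def IsRot {n : ℕ} (A : Matrix (Fin n) (Fin n) ℝ) : Prop := A.transpose * A = 1 ∧ A.det = 1

theorem IsRot.mul_transpose {n : ℕ} {A : Matrix (Fin n) (Fin n) ℝ} (h : IsRot A) :
    A * A.transpose = 1 := mul_eq_one_comm.mp h.1

theorem IsRot.transpose {n : ℕ} {A : Matrix (Fin n) (Fin n) ℝ} (h : IsRot A) :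
    IsRot A.transpose :=
  ⟨by rw [transpose_transpose]; exact h.mul_transpose, by rw [det_transpose]; exact h.2⟩

theorem IsRot.mul {n : ℕ} {A B : Matrix (Fin n) (Fin n) ℝ} (hA : IsRot A) (hB : IsRot B) :
    IsRot (A * B) := by
  refine ⟨?_, by rw [det_mul, hA.2, hB.2, one_mul]⟩
  rw [transpose_mul, Matrix.mul_assoc, ← Matrix.mul_assoc A.transpose, hA.1, Matrix.one_mul, hB.1]

theorem isRot_of_mem (g : Matrix.specialOrthogonalGroup (Fin 3) ℝ) : IsRot g.1 := by
  have h := mem_specialOrthogonalGroup_iff.mp g.2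
  exact ⟨(mem_orthogonalGroup_iff' (Fin 3) ℝ).mp h.1, h.2⟩

/-- The rotation matrix `A` as an element of the special orthogonal group. -/
def IsRot.toGroup {A : Matrix (Fin 3) (Fin 3) ℝ} (h : IsRot A) :
    Matrix.specialOrthogonalGroup (Fin 3) ℝ :=
  ⟨A, mem_specialOrthogonalGroup_iff.mpr ⟨(mem_orthogonalGroup_iff' (Fin 3) ℝ).mpr h.1, h.2⟩⟩

/-- `irrRep` for arbitrary `3 × 3` matrices. -/
def symRep (A : Matrix (Fin 3) (Fin 3) ℝ) : Matrix (Fin 5) (Fin 5) ℝ :=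
  Matrix.of fun i j => ofSym (A * toSym (Pi.single j 1) * A.transpose) i

theorem ofSym_add (X Y : Matrix (Fin 3) (Fin 3) ℝ) : ofSym (X + Y) = ofSym X + ofSym Y := by
  ext i
  fin_cases i <;> simp [ofSym] <;> ring

theorem ofSym_smul (c : ℝ) (X : Matrix (Fin 3) (Fin 3) ℝ) : ofSym (c • X) = c • ofSym X := by
  ext i
  fin_cases i <;> simp [ofSym] <;> ring

/-- `ofSym` as a linear map. -/
def ofSymLin : Matrix (Fin 3) (Fin 3) ℝ →ₗ[ℝ] (Fin 5 → ℝ) where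
  toFun := ofSym
  map_add' := ofSym_add
  map_smul' := ofSym_smul

/-- `toSym` as a linear map. -/
def toSymLin : (Fin 5 → ℝ) →ₗ[ℝ] Matrix (Fin 3) (Fin 3) ℝ where
  toFun := toSym
  map_add' x y := by
    ext i j
    fin_cases i <;> fin_cases j <;> simp [toSym] <;> ring
  map_smul' c x := by
    ext i j
    fin_cases i <;> fin_cases j <;> simp [toSym] <;> ring

theorem toSym_trace (x : Fin 5 → ℝ) : (toSym x).trace = 0 := by
  simp [toSym, Matrix.trace, Fin.sum_univ_succ]
  ring

theorem toSym_transpose (x : Fin 5 → ℝ) : (toSym x).transpose = toSym x := by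
  ext i j
  fin_cases i <;> fin_cases j <;> simp [toSym]

theorem toSym_ofSym {X : Matrix (Fin 3) (Fin 3) ℝ} (h : X.transpose = X) (h0 : X.trace = 0) :
    toSym (ofSym X) = X := by
  have e (i j) : X i j = X j i := congrFun (congrFun h j) i
  have h0' : X 0 0 + X 1 1 + X 2 2 = 0 := by
    rw [← h0, Matrix.trace, Fin.sum_univ_three]; rfl
  have h3 : (√3 : ℝ) ≠ 0 := by positivity
  have e10 := e 1 0
  have e20 := e 2 0
  have e21 := e 2 1
  ext i j
  fin_cases i <;> fin_cases j <;> simp [toSym, ofSym] <;>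
    (try field_simp) <;> linarith

theorem symRep_mulVec (A : Matrix (Fin 3) (Fin 3) ℝ) (x : Fin 5 → ℝ) :
    symRep A *ᵥ x = ofSym (A * toSym x * A.transpose) := by
  let l : (Fin 5 → ℝ) →ₗ[ℝ] (Fin 5 → ℝ) := ofSymLin ∘ₗ
    (LinearMap.mulRight ℝ A.transpose) ∘ₗ (LinearMap.mulLeft ℝ A) ∘ₗ toSymLin
  have h : LinearMap.toMatrix' l = symRep A := by
    ext i j
    rw [LinearMap.toMatrix'_apply]
    simp only [symRep, Matrix.of_apply]
    rfl
  rw [← h, LinearMap.toMatrix'_mulVec]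
  rfl

theorem conj_transpose (A X : Matrix (Fin 3) (Fin 3) ℝ) (h : X.transpose = X) :
    (A * X * A.transpose).transpose = A * X * A.transpose := by
  rw [transpose_mul, transpose_mul, transpose_transpose, h, Matrix.mul_assoc]

theorem IsRot.conj_trace {A : Matrix (Fin 3) (Fin 3) ℝ} (hA : IsRot A)
    (X : Matrix (Fin 3) (Fin 3) ℝ) : (A * X * A.transpose).trace = X.trace := by
  rw [Matrix.trace_mul_comm, ← Matrix.mul_assoc, hA.1, Matrix.one_mul]

theorem IsRot.toSym_symRep {A : Matrix (Fin 3) (Fin 3) ℝ} (hA : IsRot A) (x : Fin 5 → ℝ) :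
    toSym (symRep A *ᵥ x) = A * toSym x * A.transpose := by
  rw [symRep_mulVec]
  exact toSym_ofSym (conj_transpose _ _ (toSym_transpose x)) (by rw [hA.conj_trace, toSym_trace])

theorem ext_mulVec {M N : Matrix (Fin 5) (Fin 5) ℝ} (h : ∀ x, M *ᵥ x = N *ᵥ x) : M = N := by
  ext i j
  have := congrFun (h (Pi.single j 1)) i
  simpa using this

theorem symRep_one : symRep 1 = 1 := by
  refine ext_mulVec fun x => ?_
  rw [symRep_mulVec, transpose_one, Matrix.mul_one, Matrix.one_mul, Matrix.one_mulVec, ofSym_toSym]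

theorem symRep_mul (A : Matrix (Fin 3) (Fin 3) ℝ) {B : Matrix (Fin 3) (Fin 3) ℝ} (hB : IsRot B) :
    symRep (A * B) = symRep A * symRep B := by
  refine ext_mulVec fun x => ?_
  rw [← Matrix.mulVec_mulVec, symRep_mulVec, symRep_mulVec A, hB.toSym_symRep, transpose_mul]
  simp only [Matrix.mul_assoc]

/-- Conjugation by a rotation preserves the trace form, so this makes `symRep` orthogonal. -/
theorem trace_toSym_mul (x y : Fin 5 → ℝ) : (toSym x * toSym y).trace = 2 * (x ⬝ᵥ y) := by
  have h3 : (√3 : ℝ) ≠ 0 := by positivity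
  have h3' : (√3 : ℝ) ^ 2 = 3 := Real.sq_sqrt (by norm_num)
  simp [toSym, Matrix.trace, Fin.sum_univ_succ, dotProduct]
  field_simp
  linear_combination (-(2 * (x 4 * y 4))) * h3'

theorem symRep_transpose_mul {A : Matrix (Fin 3) (Fin 3) ℝ} (hA : IsRot A) :
    (symRep A).transpose * symRep A = 1 := by
  have key (x y : Fin 5 → ℝ) : (symRep A *ᵥ x) ⬝ᵥ (symRep A *ᵥ y) = x ⬝ᵥ y := by
    have h : (A * toSym x * A.transpose) * (A * toSym y * A.transpose)
        = A * (toSym x * toSym y) * A.transpose := by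
      simp only [Matrix.mul_assoc]
      rw [← Matrix.mul_assoc A.transpose A, hA.1, Matrix.one_mul]
    have := trace_toSym_mul (symRep A *ᵥ x) (symRep A *ᵥ y)
    rw [hA.toSym_symRep, hA.toSym_symRep, h, hA.conj_trace, trace_toSym_mul] at this
    linarith
  ext i j
  have := key (Pi.single i 1) (Pi.single j 1)
  rw [Matrix.mul_apply]
  simp only [mulVec_single_one, dotProduct, col_apply, transpose_apply] at this ⊢
  rw [this]
  simp [Matrix.one_apply, Pi.single_apply, eq_comm]

/-! ## The Cayley parametrisation of rotations -/

/-- The rotation given by the quaternion `1 + a i + b j + c k`. -/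
def cay (a b c : ℝ) : Matrix (Fin 3) (Fin 3) ℝ :=
  (1 / (1 + a ^ 2 + b ^ 2 + c ^ 2)) •
    !![1 + a ^ 2 - b ^ 2 - c ^ 2, 2 * (a * b - c), 2 * (a * c + b);
       2 * (a * b + c), 1 - a ^ 2 + b ^ 2 - c ^ 2, 2 * (b * c - a);
       2 * (a * c - b), 2 * (b * c + a), 1 - a ^ 2 - b ^ 2 + c ^ 2]

/-- The skew matrix of the vector `(a, b, c)`. -/
def skew (a b c : ℝ) : Matrix (Fin 3) (Fin 3) ℝ := !![0, -c, b; c, 0, -a; -b, a, 0]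

theorem cay_isRot (a b c : ℝ) : IsRot (cay a b c) := by
  have h : 1 + a ^ 2 + b ^ 2 + c ^ 2 ≠ 0 := by positivity
  constructor
  · ext i j
    fin_cases i <;> fin_cases j <;> simp [cay, Matrix.mul_apply, Fin.sum_univ_succ] <;>
      field_simp <;> ring
  · simp [cay, Matrix.det_fin_three]
    field_simp
    ring

theorem cay_zero : cay 0 0 0 = 1 := by
  ext i j
  fin_cases i <;> fin_cases j <;> simp [cay]

theorem one_add_trace_cay (a b c : ℝ) :
    1 + (cay a b c).trace = 4 / (1 + a ^ 2 + b ^ 2 + c ^ 2) := by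
  have h : 1 + a ^ 2 + b ^ 2 + c ^ 2 ≠ 0 := by positivity
  simp [cay, Matrix.trace, Fin.sum_univ_succ]
  field_simp
  ring

/-- The inverse of the Cayley parametrisation. -/
def cayInv (A : Matrix (Fin 3) (Fin 3) ℝ) : Fin 3 → ℝ :=
  ![(A 2 1 - A 1 2) / (1 + A.trace), (A 0 2 - A 2 0) / (1 + A.trace),
    (A 1 0 - A 0 1) / (1 + A.trace)]

theorem cayInv_cay (a b c : ℝ) : cayInv (cay a b c) = ![a, b, c] := by
  have h : 1 + a ^ 2 + b ^ 2 + c ^ 2 ≠ 0 := by positivity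
  rw [cayInv, one_add_trace_cay]
  ext i
  fin_cases i <;> simp [cay] <;> field_simp <;> ring

/-- This exhibits `cay` as the Cayley transform `(1 + S)(1 - S)⁻¹`, the form in which it can be
inverted. -/
theorem cay_mul_one_sub_skew (a b c : ℝ) : cay a b c * (1 - skew a b c) = 1 + skew a b c := by
  have h : 1 + a ^ 2 + b ^ 2 + c ^ 2 ≠ 0 := by positivity
  ext i j
  fin_cases i <;> fin_cases j <;>
    simp [cay, skew, Matrix.mul_apply, Fin.sum_univ_succ, Matrix.one_apply] <;> field_simp <;> ring

/-- For a unit quaternion with real part `c` the rotation has `1 + tr = 4c²`; the numerator comes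
from the real part of the conjugate of the first quaternion times the second. -/
theorem trace_cay_transpose_mul (a b c x y z : ℝ) :
    1 + ((cay a b c).transpose * cay x y z).trace = 4 * (1 + a * x + b * y + c * z) ^ 2 /
      ((1 + a ^ 2 + b ^ 2 + c ^ 2) * (1 + x ^ 2 + y ^ 2 + z ^ 2)) := by
  have h : 1 + a ^ 2 + b ^ 2 + c ^ 2 ≠ 0 := by positivity
  have h' : 1 + x ^ 2 + y ^ 2 + z ^ 2 ≠ 0 := by positivity
  simp [cay, Matrix.trace, Fin.sum_univ_succ, Matrix.mul_apply]
  field_simp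
  ring

/-- The adjugate of a rotation is its transpose, so the second elementary symmetric function of the
eigenvalues equals the trace, and `det (1 + A) = 1 + tr A + tr A + 1`. -/
theorem IsRot.det_one_add {A : Matrix (Fin 3) (Fin 3) ℝ} (hA : IsRot A) :
    (1 + A).det = 2 * (1 + A.trace) := by
  have had : A.adjugate = A.transpose := by
    have h := A.mul_adjugate
    rw [hA.2, one_smul] at h
    calc A.adjugate = A.transpose * (A * A.adjugate) := by
          rw [← Matrix.mul_assoc, hA.1, Matrix.one_mul]
      _ = A.transpose := by rw [h, Matrix.mul_one]
  have htr : A.adjugate.trace = A.trace := by rw [had, trace_transpose]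
  have hdet := hA.2
  rw [adjugate_fin_three] at htr
  simp [Matrix.trace, Fin.sum_univ_succ] at htr
  rw [Matrix.det_fin_three] at hdet
  simp [Matrix.trace, Fin.sum_univ_succ, Matrix.det_fin_three]
  linarith

/-- Orthogonality makes `S = (A - 1)(1 + A)⁻¹` skew, and the Cayley transform of `S` is `A`. The
hypothesis excludes exactly the rotations by `π`, where `1 + A` is singular. -/
theorem IsRot.eq_cay {A : Matrix (Fin 3) (Fin 3) ℝ} (hA : IsRot A) (h : -1 < A.trace) :
    A = cay (cayInv A 0) (cayInv A 1) (cayInv A 2) := by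
  have hdet : IsUnit (1 + A).det := by
    rw [hA.det_one_add]
    exact (by linarith : (0 : ℝ) < 2 * (1 + A.trace)).ne'.isUnit
  set B := (1 + A)⁻¹ with hB
  have hBA : B * (1 + A) = 1 := nonsing_inv_mul _ hdet
  have hAB : (1 + A) * B = 1 := mul_nonsing_inv _ hdet
  set S := (A - 1) * B with hS
  -- `S` is skew
  have hS1 : S * (1 + A) = A - 1 := by rw [hS, Matrix.mul_assoc, hBA, Matrix.mul_one]
  have hS2 : (1 + A.transpose) * S.transpose = A.transpose - 1 := by
    have := congrArg Matrix.transpose hS1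
    simpa [transpose_mul] using this
  have hsk : S.transpose = -S := by
    have hcan : (1 + A.transpose) * S.transpose * (1 + A) = (1 + A.transpose) * (-S) * (1 + A) := by
      rw [hS2, Matrix.mul_assoc, Matrix.neg_mul, hS1]
      simp only [Matrix.mul_add, Matrix.sub_mul, Matrix.mul_neg, Matrix.add_mul, Matrix.mul_sub,
        hA.1, Matrix.mul_one, Matrix.one_mul]
      abel
    have hT : IsUnit (1 + A.transpose) := by
      rw [isUnit_iff_isUnit_det, ← det_transpose]
      simpa using hdet
    have hU : IsUnit (1 + A) := (isUnit_iff_isUnit_det _).mpr hdet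
    exact hT.mul_left_cancel (hU.mul_right_cancel hcan)
  have hskij (i j) : S j i = -S i j := congrFun (congrFun hsk i) j
  have hSk : S = skew (S 2 1) (S 0 2) (S 1 0) := by
    ext i j
    have h00 := hskij 0 0
    have h11 := hskij 1 1
    have h22 := hskij 2 2
    fin_cases i <;> fin_cases j <;> simp [skew] <;> first | linarith | exact hskij _ _
  have hcomm : A * (1 - S) = 1 + S := by
    have : S * (1 + A) = (1 + A) * S := by
      have h1 : (1 + A) * S = A - 1 := by
        rw [hS, ← Matrix.mul_assoc]
        have : (1 + A) * (A - 1) = (A - 1) * (1 + A) := by noncomm_ring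
        rw [this, Matrix.mul_assoc, hAB, Matrix.mul_one]
      rw [hS1, h1]
    have h2 : (1 + A) * S = A - 1 := by rw [← this, hS1]
    rw [Matrix.add_mul, Matrix.one_mul] at h2
    rw [Matrix.mul_sub, Matrix.mul_one]
    rw [sub_eq_iff_eq_add, add_assoc, h2]
    abel
  have hu : IsUnit (1 - S) := by
    rw [isUnit_iff_isUnit_det, hSk]
    have : (1 - skew (S 2 1) (S 0 2) (S 1 0)).det = 1 + S 2 1 ^ 2 + S 0 2 ^ 2 + S 1 0 ^ 2 := by
      simp [skew, Matrix.det_fin_three]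
      ring
    rw [this]
    exact (by positivity : (0 : ℝ) < 1 + S 2 1 ^ 2 + S 0 2 ^ 2 + S 1 0 ^ 2).ne'.isUnit
  have hA' : A = cay (S 2 1) (S 0 2) (S 1 0) := by
    refine hu.mul_right_cancel ?_
    rw [hcomm]
    have := cay_mul_one_sub_skew (S 2 1) (S 0 2) (S 1 0)
    rw [← hSk] at this
    exact this.symm
  have : cayInv A = ![S 2 1, S 0 2, S 1 0] := by rw [hA', cayInv_cay]
  rw [this]
  exact hA'

/-! ## The determinant of the irreducible representation -/

theorem continuous_ofSym : Continuous ofSym := ofSymLin.continuous_of_finiteDimensional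

theorem continuous_symRep : Continuous symRep := by
  refine continuous_pi fun i => continuous_pi fun j => ?_
  have : Continuous fun A : Matrix (Fin 3) (Fin 3) ℝ =>
      ofSym (A * toSym (Pi.single j 1) * A.transpose) :=
    continuous_ofSym.comp ((continuous_id.matrix_mul continuous_const).matrix_mul
      continuous_id.matrix_transpose)
  exact (continuous_apply i).comp this

theorem det_symRep_sq {A : Matrix (Fin 3) (Fin 3) ℝ} (hA : IsRot A) : (symRep A).det ^ 2 = 1 := by
  have := congrArg Matrix.det (symRep_transpose_mul hA)
  rwa [det_mul, det_transpose, det_one, ← sq] at this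

theorem continuous_cay_smul (a b c : ℝ) : Continuous fun t : ℝ => cay (t * a) (t * b) (t * c) := by
  have h (t : ℝ) : 1 + (t * a) ^ 2 + (t * b) ^ 2 + (t * c) ^ 2 ≠ 0 := by positivity
  refine continuous_pi fun i => continuous_pi fun j => ?_
  fin_cases i <;> fin_cases j <;> simp [cay] <;> fun_prop (disch := exact h _)

/-- The determinant is `±1` and continuous along `t ↦ cay (ta) (tb) (tc)`, which starts at the
identity; a jump to `-1` would pass through `0`. -/
theorem det_symRep_cay (a b c : ℝ) : (symRep (cay a b c)).det = 1 := by
  by_contra hne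
  have hcont : Continuous fun t : ℝ => (symRep (cay (t * a) (t * b) (t * c))).det :=
    (continuous_symRep.comp (continuous_cay_smul a b c)).matrix_det
  have hval (t : ℝ) := det_symRep_sq (cay_isRot (t * a) (t * b) (t * c))
  have h1 := (sq_eq_one_iff.mp (det_symRep_sq (cay_isRot a b c))).resolve_left hne
  have h0 : (symRep (cay (0 * a) (0 * b) (0 * c))).det = 1 := by
    simp only [zero_mul, cay_zero, symRep_one, det_one]
  obtain ⟨t, -, ht⟩ := intermediate_value_Icc' (zero_le_one' ℝ) hcont.continuousOn
    (show (0 : ℝ) ∈ Set.Icc _ _ by simp only [one_mul, h1, h0]; norm_num)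
  have := hval t
  simp only at ht
  rw [ht] at this
  norm_num at this

theorem symRep_diagonal (d : Fin 3 → ℝ) (h : ∀ i, d i ^ 2 = 1) :
    symRep (diagonal d) = diagonal ![1, d 0 * d 2, d 1 * d 2, d 0 * d 1, 1] := by
  have h3 : (√3 : ℝ) ≠ 0 := by positivity
  have h0 := h 0
  have h1 := h 1
  have h2 := h 2
  refine ext_mulVec fun x => ?_
  rw [symRep_mulVec, diagonal_transpose]
  ext i
  rw [mulVec_diagonal]
  fin_cases i <;> simp [ofSym, toSym, Matrix.mul_apply, diagonal] <;>
    field_simp <;> try ring1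
  · linear_combination (√3 * x 0 + x 4) * h0 - x 4 * h1
  · linear_combination x 4 * h1

/-- Rotations by `π` are outside the Cayley chart, but multiplying by one of the four diagonal sign
matrices of determinant 1 brings `A` into it: the four traces of `A * diagonal d` add up to `0`, so
they cannot all be at most `-1`. -/
theorem det_symRep {A : Matrix (Fin 3) (Fin 3) ℝ} (hA : IsRot A) : (symRep A).det = 1 := by
  have key (d : Fin 3 → ℝ) (h : ∀ i, d i ^ 2 = 1) (hd : d 0 * d 1 * d 2 = 1)
      (htr : -1 < (A * diagonal d).trace) : (symRep A).det = 1 := by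
    have hD : IsRot (diagonal d) := by
      refine ⟨?_, by rw [det_diagonal, Fin.prod_univ_three, hd]⟩
      rw [diagonal_transpose, diagonal_mul_diagonal, ← diagonal_one]
      congr 1
      ext i
      rw [← sq, h i]
    have h1 := symRep_mul A hD
    have h2 : (symRep (diagonal d)).det = 1 := by
      rw [symRep_diagonal d h, det_diagonal]
      simp [Fin.prod_univ_succ]
      linear_combination (d 0 * d 1 * d 2 + 1) * hd
    have h3 := congrArg Matrix.det h1
    rw [det_mul, h2, mul_one, (hA.mul hD).eq_cay htr, det_symRep_cay] at h3
    exact h3.symm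
  by_contra hne
  have hk (d : Fin 3 → ℝ) (h : ∀ i, d i ^ 2 = 1) (hd : d 0 * d 1 * d 2 = 1) :
      A 0 0 * d 0 + A 1 1 * d 1 + A 2 2 * d 2 ≤ -1 := by
    by_contra hlt
    refine hne (key d h hd ?_)
    simp only [Matrix.trace, Fin.sum_univ_three, diag_apply, mul_diagonal]
    linarith
  have h1 := hk ![1, 1, 1] (by intro i; fin_cases i <;> simp) (by simp)
  have h2 := hk ![1, -1, -1] (by intro i; fin_cases i <;> simp) (by simp)
  have h3 := hk ![-1, 1, -1] (by intro i; fin_cases i <;> simp) (by simp)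
  have h4 := hk ![-1, -1, 1] (by intro i; fin_cases i <;> simp) (by simp)
  simp at h1 h2 h3 h4
  linarith

theorem IsRot.symRep_isRot {A : Matrix (Fin 3) (Fin 3) ℝ} (hA : IsRot A) : IsRot (symRep A) :=
  ⟨symRep_transpose_mul hA, det_symRep hA⟩

end BryantSalamon
end

noncomputable section
namespace BryantSalamon

open Matrix

/-! ## Equivariance under rotations of `ℝ⁵` -/

/-- The action of `5 × 5` matrices on pairs of a point and a 2-form. -/
def act (R : Matrix (Fin 5) (Fin 5) ℝ) (p : Ambient) : Ambient :=
  (R *ᵥ p.1, R * p.2 * R.transpose)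

theorem irrLift_eq (g : Matrix.specialOrthogonalGroup (Fin 3) ℝ) (p : Ambient) :
    irrLift g p = act (symRep g.1) p := rfl

theorem act_mul (R S : Matrix (Fin 5) (Fin 5) ℝ) (p : Ambient) :
    act (R * S) p = act R (act S p) := by
  simp only [act, mulVec_mulVec, transpose_mul, Matrix.mul_assoc]

theorem act_one (p : Ambient) : act 1 p = p := by
  simp [act]

theorem IsRot.act_transpose_act {R : Matrix (Fin 5) (Fin 5) ℝ} (hR : IsRot R) (p : Ambient) :
    act R.transpose (act R p) = p := by
  rw [← act_mul, hR.1, act_one]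

theorem IsRot.mulVec_transpose_mulVec {R : Matrix (Fin 5) (Fin 5) ℝ} (hR : IsRot R)
    (u : Fin 5 → ℝ) : R *ᵥ (R.transpose *ᵥ u) = u := by
  rw [mulVec_mulVec, hR.mul_transpose, one_mulVec]

theorem IsRot.transpose_mulVec_mulVec {R : Matrix (Fin 5) (Fin 5) ℝ} (hR : IsRot R)
    (u : Fin 5 → ℝ) : R.transpose *ᵥ (R *ᵥ u) = u := by
  rw [mulVec_mulVec, hR.1, one_mulVec]

theorem IsRot.dotProduct_mulVec {R : Matrix (Fin 5) (Fin 5) ℝ} (hR : IsRot R)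
    (u v : Fin 5 → ℝ) : (R *ᵥ u) ⬝ᵥ (R *ᵥ v) = u ⬝ᵥ v := by
  rw [Matrix.dotProduct_mulVec, ← mulVec_transpose, hR.transpose_mulVec_mulVec]

theorem IsRot.conj_mul {R : Matrix (Fin 5) (Fin 5) ℝ} (hR : IsRot R)
    (α β : Matrix (Fin 5) (Fin 5) ℝ) :
    (R * α * R.transpose) * (R * β * R.transpose) = R * (α * β) * R.transpose := by
  simp only [Matrix.mul_assoc]
  rw [← Matrix.mul_assoc R.transpose R, hR.1, Matrix.one_mul]

theorem fibreInner_eq_trace (α β : Matrix (Fin 5) (Fin 5) ℝ) :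
    fibreInner α β = (1 / 4 : ℝ) * (α * β.transpose).trace := by
  simp [fibreInner, Matrix.trace, Matrix.mul_apply]

theorem IsRot.fibreInner_conj {R : Matrix (Fin 5) (Fin 5) ℝ} (hR : IsRot R)
    (α β : Matrix (Fin 5) (Fin 5) ℝ) :
    fibreInner (R * α * R.transpose) (R * β * R.transpose) = fibreInner α β := by
  have h : (R * β * R.transpose).transpose = R * β.transpose * R.transpose := by
    simp only [transpose_mul, transpose_transpose, Matrix.mul_assoc]
  rw [fibreInner_eq_trace, fibreInner_eq_trace, h, hR.conj_mul, Matrix.trace_mul_comm,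
    ← Matrix.mul_assoc, hR.1, Matrix.one_mul]

theorem IsRot.fibreCross_conj {R : Matrix (Fin 5) (Fin 5) ℝ} (hR : IsRot R)
    (α β : Matrix (Fin 5) (Fin 5) ℝ) :
    fibreCross (R * α * R.transpose) (R * β * R.transpose)
      = R * fibreCross α β * R.transpose := by
  simp only [fibreCross, hR.conj_mul, Matrix.mul_smul, Matrix.smul_mul, Matrix.mul_sub,
    Matrix.sub_mul]

theorem IsRot.evalForm_conj {R : Matrix (Fin 5) (Fin 5) ℝ} (hR : IsRot R)
    (α : Matrix (Fin 5) (Fin 5) ℝ) (u v : Fin 5 → ℝ) :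
    evalForm (R * α * R.transpose) (R *ᵥ u) (R *ᵥ v) = evalForm α u v := by
  have : (R * α * R.transpose) *ᵥ (R *ᵥ v) = R *ᵥ (α *ᵥ v) := by
    rw [← mulVec_mulVec, hR.transpose_mulVec_mulVec, mulVec_mulVec]
  rw [evalForm, this, hR.dotProduct_mulVec, evalForm]

/-- The only one of these invariance identities that needs determinant 1 and not just orthogonality.
-/
theorem IsRot.volSphere_mulVec {R : Matrix (Fin 5) (Fin 5) ℝ} (hR : IsRot R)
    (x u₁ u₂ u₃ u₄ : Fin 5 → ℝ) :
    volSphere (R *ᵥ x) (R *ᵥ u₁) (R *ᵥ u₂) (R *ᵥ u₃) (R *ᵥ u₄) = volSphere x u₁ u₂ u₃ u₄ := by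
  have h : (Matrix.of ![R *ᵥ x, R *ᵥ u₁, R *ᵥ u₂, R *ᵥ u₃, R *ᵥ u₄])
      = Matrix.of ![x, u₁, u₂, u₃, u₄] * R.transpose := by
    ext i j
    fin_cases i <;> simp [Matrix.mul_apply, mulVec, dotProduct, mul_comm]
  rw [volSphere, h, det_mul, det_transpose, hR.2, mul_one, volSphere]

theorem IsRot.vert_act {R : Matrix (Fin 5) (Fin 5) ℝ} (hR : IsRot R) (p U : Ambient) :
    vert (act R p) (act R U) = R * vert p U * R.transpose := by
  have h : (1 : Matrix (Fin 5) (Fin 5) ℝ) - vecMulVec (R *ᵥ p.1) (R *ᵥ p.1)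
      = R * (1 - vecMulVec p.1 p.1) * R.transpose := by
    rw [Matrix.mul_sub, Matrix.sub_mul, Matrix.mul_one, hR.mul_transpose, mul_vecMulVec,
      vecMulVec_mul, vecMul_transpose]
  simp only [vert, act, h, hR.conj_mul]

theorem IsRot.sFun_act {R : Matrix (Fin 5) (Fin 5) ℝ} (hR : IsRot R) (lam : ℝ) (p : Ambient) :
    sFun lam (act R p) = sFun lam p := by
  simp only [sFun, rho, act, hR.fibreInner_conj]

theorem IsRot.metric_act {R : Matrix (Fin 5) (Fin 5) ℝ} (hR : IsRot R) (lam : ℝ)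
    (p U V : Ambient) : metric lam (act R p) (act R U) (act R V) = metric lam p U V := by
  simp only [metric, hR.sFun_act, hR.vert_act, hR.fibreInner_conj]
  simp only [act, hR.dotProduct_mulVec]

theorem IsRot.starPhi_act {R : Matrix (Fin 5) (Fin 5) ℝ} (hR : IsRot R) (lam : ℝ)
    (p : Ambient) (U : Fin 4 → Ambient) :
    starPhi lam (act R p) (fun i => act R (U i)) = starPhi lam p U := by
  simp only [starPhi, bbOmega, hR.sFun_act, hR.vert_act, hR.fibreCross_conj]
  simp only [act, hR.evalForm_conj, hR.volSphere_mulVec]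

/-! ## The fibre over the first basis vector -/

/-- The anti-self-dual form `a₁ ω₁ + a₂ ω₂ + a₃ ω₃` at the first basis vector of `ℝ⁵`, whose
tangent space is spanned by the other ones. -/
def asd (a : Fin 3 → ℝ) : Matrix (Fin 5) (Fin 5) ℝ :=
  !![0, 0, 0, 0, 0;
     0, 0, a 0, a 1, a 2;
     0, -a 0, 0, -a 2, a 1;
     0, -a 1, a 2, 0, -a 0;
     0, -a 2, -a 1, a 0, 0]

/-- The point with fibre coordinates `a` over the first basis vector of `ℝ⁵`. -/
def basePt (a : Fin 3 → ℝ) : Ambient := (Pi.single 0 1, asd a)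

theorem fibreInner_asd (a b : Fin 3 → ℝ) :
    fibreInner (asd a) (asd b) = a 0 * b 0 + a 1 * b 1 + a 2 * b 2 := by
  simp [fibreInner, asd, Fin.sum_univ_succ]
  ring

set_option maxHeartbeats 1000000 in
theorem fibreCross_asd (a b : Fin 3 → ℝ) :
    fibreCross (asd a) (asd b) =
      asd ![a 1 * b 2 - a 2 * b 1, a 2 * b 0 - a 0 * b 2, a 0 * b 1 - a 1 * b 0] := by
  ext i j
  fin_cases i <;> fin_cases j <;>
    simp [fibreCross, asd] <;> ring

theorem evalForm_asd (a : Fin 3 → ℝ) (h k : Fin 4 → ℝ) :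
    evalForm (asd a) ![0, h 0, h 1, h 2, h 3] ![0, k 0, k 1, k 2, k 3] =
      a 0 * ((h 0 * k 1 - h 1 * k 0) - (h 2 * k 3 - h 3 * k 2))
      + a 1 * ((h 0 * k 2 - h 2 * k 0) - (h 3 * k 1 - h 1 * k 3))
      + a 2 * ((h 0 * k 3 - h 3 * k 0) - (h 1 * k 2 - h 2 * k 1)) := by
  simp [evalForm, asd, dotProduct, mulVec, Fin.sum_univ_succ]
  ring

/-- Arbitrary `u`, `v` are allowed, since a rotation moves the standard basis to other vectors. -/
theorem asd_hodge (a : Fin 3 → ℝ) (u v : Fin 5 → ℝ) :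
    (1 / 2 : ℝ) * ∑ l, ∑ m, volSphere (Pi.single 0 1) u v (Pi.single l 1) (Pi.single m 1)
      * asd a l m = -evalForm (asd a) u v := by
  simp [evalForm, asd, dotProduct, mulVec, Fin.sum_univ_succ, volSphere, det_succ_row_zero,
    Fin.succAbove, Pi.single_apply]
  ring

theorem basePt_mem (a : Fin 3 → ℝ) {R : Matrix (Fin 5) (Fin 5) ℝ} (hR : IsRot R) :
    act R (basePt a) ∈ asdBundle := by
  refine ⟨?_, ?_, ?_, ?_⟩
  · change (R *ᵥ Pi.single 0 1) ⬝ᵥ (R *ᵥ Pi.single 0 1) = 1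
    rw [hR.dotProduct_mulVec]
    simp
  · have h : (asd a).transpose = -asd a := by
      ext i j
      fin_cases i <;> fin_cases j <;> simp [asd]
    change (R * asd a * R.transpose).transpose = -(R * asd a * R.transpose)
    simp [transpose_mul, h, Matrix.mul_assoc]
  · have h : asd a *ᵥ Pi.single 0 1 = 0 := by
      ext i
      fin_cases i <;> simp [asd]
    change (R * asd a * R.transpose) *ᵥ (R *ᵥ Pi.single 0 1) = 0
    rw [← mulVec_mulVec, hR.transpose_mulVec_mulVec, ← mulVec_mulVec, h, mulVec_zero]
  · ext i j
    change (1 / 2 : ℝ) * ∑ l, ∑ m, volSphere (R *ᵥ Pi.single 0 1) (Pi.single i 1) (Pi.single j 1)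
      (Pi.single l 1) (Pi.single m 1) * (R * asd a * R.transpose) l m
        = -((R * asd a * R.transpose) i j)
    set u := R.transpose *ᵥ Pi.single i 1 with hu
    set v := R.transpose *ᵥ Pi.single j 1 with hv
    have hvol (l m : Fin 5) : volSphere (R *ᵥ Pi.single 0 1) (Pi.single i 1) (Pi.single j 1)
        (Pi.single l 1) (Pi.single m 1) = volSphere (Pi.single 0 1) u v
          (R.transpose *ᵥ Pi.single l 1) (R.transpose *ᵥ Pi.single m 1) := by
      have := hR.volSphere_mulVec (Pi.single 0 1) u v (R.transpose *ᵥ Pi.single l 1)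
        (R.transpose *ᵥ Pi.single m 1)
      simp only [hu, hv, hR.mulVec_transpose_mulVec] at this
      exact this
    -- With `u` and `v` inserted the volume form is a bilinear form `B` in the last two slots. The
    -- Hodge star contracts it fully with the 2-form, and this contraction is invariant under
    -- conjugating both by `R`.
    set B : Matrix (Fin 5) (Fin 5) ℝ := Matrix.of fun l m =>
      volSphere (Pi.single 0 1) u v (Pi.single l 1) (Pi.single m 1) with hB
    have hBv (y z : Fin 5 → ℝ) : volSphere (Pi.single 0 1) u v y z = y ⬝ᵥ B *ᵥ z := by
      simp [hB, dotProduct, mulVec, Fin.sum_univ_succ, volSphere, det_succ_row_zero,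
        Fin.succAbove, Pi.single_apply]
      ring
    have hsum (X Y : Matrix (Fin 5) (Fin 5) ℝ) :
        ∑ l, ∑ m, X l m * Y l m = (X * Y.transpose).trace := by
      simp [Matrix.trace, Matrix.mul_apply]
    have h1 : ∑ l, ∑ m, volSphere (R *ᵥ Pi.single 0 1) (Pi.single i 1) (Pi.single j 1)
        (Pi.single l 1) (Pi.single m 1) * (R * asd a * R.transpose) l m
        = ∑ l, ∑ m, B l m * asd a l m := by
      have : ∀ l m, volSphere (R *ᵥ Pi.single 0 1) (Pi.single i 1) (Pi.single j 1)
        (Pi.single l 1) (Pi.single m 1) = (R * B * R.transpose) l m := by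
        intro l m
        rw [hvol, hBv]
        change evalForm B _ _ = _
        rw [← hR.evalForm_conj, hR.mulVec_transpose_mulVec, hR.mulVec_transpose_mulVec]
        simp [evalForm]
      simp only [this]
      rw [hsum, hsum, transpose_mul, transpose_mul, transpose_transpose, ← Matrix.mul_assoc R,
        hR.conj_mul, Matrix.trace_mul_comm, ← Matrix.mul_assoc, hR.1, Matrix.one_mul]
    rw [h1]
    have h2 := asd_hodge a u v
    have h3 : evalForm (asd a) u v = (R * asd a * R.transpose) i j := by
      rw [← hR.evalForm_conj, hu, hv, hR.mulVec_transpose_mulVec, hR.mulVec_transpose_mulVec]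
      simp [evalForm]
    rw [h3] at h2
    exact h2

/-! ## Metric and 4-form in coordinates -/

/-- `U` is a tangent vector at `basePt a` with horizontal coordinates `V 0, …, V 3` and vertical
coordinates `V 4, V 5, V 6`. -/
def HasCoords (a : Fin 3 → ℝ) (U : Ambient) (V : Fin 7 → ℝ) : Prop :=
  U.1 = ![0, V 0, V 1, V 2, V 3] ∧ vert (basePt a) U = asd ![V 4, V 5, V 6]

/-- The metric in coordinates. -/
def coordGram (s : ℝ) : Matrix (Fin 7) (Fin 7) ℝ :=
  diagonal ![2 * s ^ 2, 2 * s ^ 2, 2 * s ^ 2, 2 * s ^ 2, 1 / s ^ 2, 1 / s ^ 2, 1 / s ^ 2]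

/-- The 4-form in coordinates. -/
def psi (s : ℝ) (V : Matrix (Fin 4) (Fin 7) ℝ) : ℝ :=
  4 * s ^ 4 * (V.submatrix id ![0, 1, 2, 3]).det
    - 2 * ((V.submatrix id ![5, 6, 0, 1]).det - (V.submatrix id ![5, 6, 2, 3]).det
      + (V.submatrix id ![6, 4, 0, 2]).det - (V.submatrix id ![6, 4, 3, 1]).det
      + (V.submatrix id ![4, 5, 0, 3]).det - (V.submatrix id ![4, 5, 1, 2]).det)

theorem metric_eq_coordGram {a : Fin 3 → ℝ} {U U' : Ambient} {V V' : Fin 7 → ℝ}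
    (hU : HasCoords a U V) (hU' : HasCoords a U' V') (lam : ℝ) :
    metric lam (basePt a) U U' = V ⬝ᵥ coordGram (sFun lam (basePt a)) *ᵥ V' := by
  rw [metric, hU.1, hU'.1, hU.2, hU'.2, fibreInner_asd]
  simp [coordGram, dotProduct, Fin.sum_univ_succ, mulVec_diagonal]
  ring

theorem starPhi_eq_psi {a : Fin 3 → ℝ} {U : Fin 4 → Ambient} {V : Matrix (Fin 4) (Fin 7) ℝ}
    (hU : ∀ i, HasCoords a (U i) (V i)) (lam : ℝ) :
    starPhi lam (basePt a) U = psi (sFun lam (basePt a)) V := by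
  have hvol : volSphere (basePt a).1 (U 0).1 (U 1).1 (U 2).1 (U 3).1
      = (V.submatrix id ![0, 1, 2, 3]).det := by
    rw [(hU 0).1, (hU 1).1, (hU 2).1, (hU 3).1, volSphere, det_succ_row_zero,
      Fin.sum_univ_succ]
    simp [basePt]
    congr 1
    ext i j
    fin_cases i <;> fin_cases j <;> rfl
  have hF (i j k l : Fin 4) := evalForm_asd ![V i 5 * V j 6 - V i 6 * V j 5,
    V i 6 * V j 4 - V i 4 * V j 6, V i 4 * V j 5 - V i 5 * V j 4]
    ![V k 0, V k 1, V k 2, V k 3] ![V l 0, V l 1, V l 2, V l 3]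
  simp only [Matrix.cons_val] at hF
  have hc (i j : Fin 4) := fibreCross_asd ![V i 4, V i 5, V i 6] ![V j 4, V j 5, V j 6]
  simp only [Matrix.cons_val] at hc
  rw [starPhi, hvol, psi]
  congr 2
  simp only [bbOmega, (hU _).1, (hU _).2, hc, hF]
  simp [det_succ_row_zero, Fin.sum_univ_succ, Fin.succAbove]
  ring

theorem psi_mul (s : ℝ) (C : Matrix (Fin 4) (Fin 4) ℝ) (N : Matrix (Fin 4) (Fin 7) ℝ) :
    psi s (C * N) = C.det * psi s N := by
  have h (c : Fin 4 → Fin 7) :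
      ((C * N).submatrix id c).det = C.det * (N.submatrix id c).det := by
    rw [← det_mul]
    rfl
  simp only [psi, h]
  ring

/-- A change of family by `C` multiplies `psi` by `det C` and the Gram determinant by its square, so
the equality has to be checked for one spanning family only. -/
theorem abs_psi_eq_one {s : ℝ} {C : Matrix (Fin 4) (Fin 4) ℝ} {N : Matrix (Fin 4) (Fin 7) ℝ}
    (hN : psi s N ^ 2 = (N * coordGram s * N.transpose).det)
    (h : (C * N) * coordGram s * (C * N).transpose = 1) : |psi s (C * N)| = 1 := by
  have h1 : C * (N * coordGram s * N.transpose) * C.transpose = 1 := by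
    rw [← h, transpose_mul]
    simp only [Matrix.mul_assoc]
  have h2 := congrArg Matrix.det h1
  rw [det_mul, det_mul, det_transpose, det_one, ← hN] at h2
  have h3 : psi s (C * N) ^ 2 = 1 := by
    rw [psi_mul]
    linarith [mul_pow C.det (psi s N) 2]
  rw [← Real.sqrt_sq_eq_abs, h3, Real.sqrt_one]

end BryantSalamon
end

noncomputable section
namespace BryantSalamon

open Matrix

/-! ## The calibration condition in coordinates -/

/-- The coordinates of three infinitesimal rotations and of the velocity of a path, as rows. -/
def genCoords (P q₁ q₃ m₁ m₂ m₃ θ : ℝ) (a d : Fin 3 → ℝ) : Matrix (Fin 4) (Fin 7) ℝ :=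
  !![0, q₁, 0, 0, -(m₂ * a 2), 0, m₂ * a 0;
     P, 0, 0, 0, -(m₃ * a 1), m₃ * a 0, 0;
     0, 0, q₃, 0, 0, -(m₁ * a 2), m₁ * a 1;
     0, 0, 0, θ, d 0, d 1, d 2]

theorem psi_genCoords (s P q₁ q₃ m₁ m₂ m₃ θ : ℝ) (a d : Fin 3 → ℝ) :
    psi s (genCoords P q₁ q₃ m₁ m₂ m₃ θ a d) =
      -(4 * s ^ 4 * (P * q₁ * q₃ * θ)) - 2 * (P * q₁ * m₁ * (a 1 * d 1 + a 2 * d 2)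
        + P * q₃ * m₂ * (a 0 * d 0 + a 2 * d 2) - q₁ * q₃ * m₃ * (a 0 * d 0 + a 1 * d 1)
        + θ * (q₁ * m₁ * m₃ * a 1 ^ 2 + q₃ * m₂ * m₃ * a 0 ^ 2 - P * m₁ * m₂ * a 2 ^ 2)) := by
  simp [psi, genCoords, det_succ_row_zero, Fin.sum_univ_succ, Fin.succAbove]
  ring

/-- The Gram matrix of `genCoords`, multiplied by `s ^ 2`. -/
def gramGen (ρ P q₁ q₃ m₁ m₂ m₃ θ : ℝ) (a d : Fin 3 → ℝ) : Matrix (Fin 4) (Fin 4) ℝ :=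
  !![2 * ρ * q₁ ^ 2 + m₂ ^ 2 * (a 2 ^ 2 + a 0 ^ 2), m₂ * m₃ * (a 1 * a 2),
      m₁ * m₂ * (a 0 * a 1), m₂ * (a 0 * d 2 - a 2 * d 0);
     m₂ * m₃ * (a 1 * a 2), 2 * ρ * P ^ 2 + m₃ ^ 2 * (a 0 ^ 2 + a 1 ^ 2),
      -(m₁ * m₃ * (a 0 * a 2)), m₃ * (a 0 * d 1 - a 1 * d 0);
     m₁ * m₂ * (a 0 * a 1), -(m₁ * m₃ * (a 0 * a 2)),
      2 * ρ * q₃ ^ 2 + m₁ ^ 2 * (a 1 ^ 2 + a 2 ^ 2), m₁ * (a 1 * d 2 - a 2 * d 1);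
     m₂ * (a 0 * d 2 - a 2 * d 0), m₃ * (a 0 * d 1 - a 1 * d 0), m₁ * (a 1 * d 2 - a 2 * d 1),
      2 * ρ * θ ^ 2 + (d 0 ^ 2 + d 1 ^ 2 + d 2 ^ 2)]

theorem gram_genCoords {s : ℝ} (hs : s ≠ 0) (P q₁ q₃ m₁ m₂ m₃ θ : ℝ) (a d : Fin 3 → ℝ) :
    genCoords P q₁ q₃ m₁ m₂ m₃ θ a d * coordGram s * (genCoords P q₁ q₃ m₁ m₂ m₃ θ a d).transpose
      = (1 / s ^ 2) • gramGen (s ^ 4) P q₁ q₃ m₁ m₂ m₃ θ a d := by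
  ext i j
  rw [Matrix.mul_apply, coordGram]
  simp only [Matrix.mul_diagonal]
  fin_cases i <;> fin_cases j <;>
    simp [genCoords, gramGen, Fin.sum_univ_succ] <;> field_simp <;> ring1

theorem det_fin_four_sym (a b c d e f g h i j : ℝ) :
    !![a, b, c, d; b, e, f, g; c, f, h, i; d, g, i, j].det =
      a * (e * (h * j - i * i) - f * (f * j - i * g) + g * (f * i - h * g))
      - b * (b * (h * j - i * i) - f * (c * j - i * d) + g * (c * i - h * d))
      + c * (b * (f * j - i * g) - e * (c * j - i * d) + g * (c * g - f * d))
      - d * (b * (f * i - h * g) - e * (c * i - h * d) + f * (c * g - f * d)) := by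
  simp [det_succ_row_zero, Fin.sum_univ_succ, Fin.succAbove]
  ring

-- The coassociator identity for the rows `X₁, X₂, X₃, X₄` of `genCoords`. Up to sign and a factor
-- `s³`, the left sides of `h₁`, `h₂`, `h₃` are `φ(X₁, X₂, X₄)`, `φ(X₂, X₃, X₄)`, `φ(X₁, X₃, X₄)`;
-- the fourth value `φ(X₁, X₂, X₃)` is identically zero.
set_option maxHeartbeats 2000000 in
theorem det_gramGen (ρ P q₁ q₃ m₁ m₂ m₃ θ : ℝ) (a d : Fin 3 → ℝ)
    (h₁ : 2 * ρ * (P * q₁ * d 0 + a 0 * (m₃ * q₁ - m₂ * P) * θ)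
      + m₂ * m₃ * a 0 * (a 0 * d 0 + a 1 * d 1 + a 2 * d 2) = 0)
    (h₂ : 2 * ρ * (P * q₃ * d 1 + a 1 * (m₃ * q₃ - m₁ * P) * θ)
      + m₁ * m₃ * a 1 * (a 0 * d 0 + a 1 * d 1 + a 2 * d 2) = 0)
    (h₃ : 2 * ρ * (-(q₁ * q₃ * d 2) + a 2 * (m₂ * q₃ + m₁ * q₁) * θ)
      + m₁ * m₂ * a 2 * (a 0 * d 0 + a 1 * d 1 + a 2 * d 2) = 0) :
    (gramGen ρ P q₁ q₃ m₁ m₂ m₃ θ a d).det =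
      (-(4 * ρ * (P * q₁ * q₃ * θ)) - 2 * (P * q₁ * m₁ * (a 1 * d 1 + a 2 * d 2)
        + P * q₃ * m₂ * (a 0 * d 0 + a 2 * d 2) - q₁ * q₃ * m₃ * (a 0 * d 0 + a 1 * d 1)
        + θ * (q₁ * m₁ * m₃ * a 1 ^ 2 + q₃ * m₂ * m₃ * a 0 ^ 2 - P * m₁ * m₂ * a 2 ^ 2))) ^ 2
        * ρ ^ 2 := by
  rw [gramGen, det_fin_four_sym, ← sub_eq_zero]
  -- This is `s²` times the squared length of `E₂ X₁ - E₃ X₂ - E₁ X₃`, the coassociator. With the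
  -- left sides of the hypotheses for the `Eᵢ` it equals the difference of the two sides of the goal
  -- as a polynomial.
  have key : ∀ E₁ E₂ E₃ : ℝ, E₁ = 0 → E₂ = 0 → E₃ = 0 →
      E₂ ^ 2 * (2 * ρ * q₁ ^ 2 + m₂ ^ 2 * (a 2 ^ 2 + a 0 ^ 2))
      + E₃ ^ 2 * (2 * ρ * P ^ 2 + m₃ ^ 2 * (a 0 ^ 2 + a 1 ^ 2))
      + E₁ ^ 2 * (2 * ρ * q₃ ^ 2 + m₁ ^ 2 * (a 1 ^ 2 + a 2 ^ 2))
      - 2 * (E₂ * E₃) * (m₂ * m₃ * (a 1 * a 2)) - 2 * (E₂ * E₁) * (m₁ * m₂ * (a 0 * a 1))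
      + 2 * (E₃ * E₁) * (-(m₁ * m₃ * (a 0 * a 2))) = 0 := by
    rintro _ _ _ rfl rfl rfl
    ring
  rw [← key _ _ _ h₁ h₂ h₃]
  ring

theorem psi_genCoords_sq {s : ℝ} (hs : s ≠ 0) (P q₁ q₃ m₁ m₂ m₃ θ : ℝ) (a d : Fin 3 → ℝ)
    (h₁ : 2 * s ^ 4 * (P * q₁ * d 0 + a 0 * (m₃ * q₁ - m₂ * P) * θ)
      + m₂ * m₃ * a 0 * (a 0 * d 0 + a 1 * d 1 + a 2 * d 2) = 0)
    (h₂ : 2 * s ^ 4 * (P * q₃ * d 1 + a 1 * (m₃ * q₃ - m₁ * P) * θ)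
      + m₁ * m₃ * a 1 * (a 0 * d 0 + a 1 * d 1 + a 2 * d 2) = 0)
    (h₃ : 2 * s ^ 4 * (-(q₁ * q₃ * d 2) + a 2 * (m₂ * q₃ + m₁ * q₁) * θ)
      + m₁ * m₂ * a 2 * (a 0 * d 0 + a 1 * d 1 + a 2 * d 2) = 0) :
    psi s (genCoords P q₁ q₃ m₁ m₂ m₃ θ a d) ^ 2 =
      (genCoords P q₁ q₃ m₁ m₂ m₃ θ a d * coordGram s
        * (genCoords P q₁ q₃ m₁ m₂ m₃ θ a d).transpose).det := by
  rw [gram_genCoords hs, det_smul, det_gramGen _ _ _ _ _ _ _ _ _ _ h₁ h₂ h₃, psi_genCoords,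
    Fintype.card_fin]
  field_simp

end BryantSalamon
end

noncomputable section
namespace BryantSalamon

open Matrix

/-! ## The path in the slice -/

/-- The rotation taking the standard basis to `x, e₁, …, e₄` for `x = (x₁, 0, 0, 0, x₅)`. -/
def frameMat (x₁ x₅ : ℝ) : Matrix (Fin 5) (Fin 5) ℝ :=
  !![x₁, 0, 0, 0, -x₅; 0, 1, 0, 0, 0; 0, 0, 1, 0, 0; 0, 0, 0, 1, 0; x₅, 0, 0, 0, x₁]

theorem frameMat_isRot {x₁ x₅ : ℝ} (h : x₁ ^ 2 + x₅ ^ 2 = 1) : IsRot (frameMat x₁ x₅) := by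
  constructor
  · ext i j
    rw [Matrix.mul_apply, Fin.sum_univ_five]
    fin_cases i <;> fin_cases j <;> simp [frameMat] <;> linarith
  · simp [frameMat, det_succ_row_zero, Fin.sum_univ_succ, Fin.succAbove]
    linarith

theorem wedge_apply (u v : Fin 5 → ℝ) (i j : Fin 5) :
    wedge u v i j = u i * v j - v i * u j := rfl

theorem ofCoords_eq {x₁ x₅ : ℝ} (hx : 0 < x₁) (h : x₁ ^ 2 + x₅ ^ 2 = 1) (a : Fin 3 → ℝ) :
    ofCoords ![x₁, 0, 0, 0, x₅] a = act (frameMat x₁ x₅) (basePt a) := by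
  have hs : √(1 - x₅ ^ 2) = x₁ := by
    rw [show 1 - x₅ ^ 2 = x₁ ^ 2 by linarith, Real.sqrt_sq hx.le]
  have hx' : x₁ ≠ 0 := hx.ne'
  have e0 : frame ![x₁, 0, 0, 0, x₅] 0 = ![0, 1, 0, 0, 0] := by
    ext i
    fin_cases i <;> simp [frame, hs, hx']
  have e1 : frame ![x₁, 0, 0, 0, x₅] 1 = ![0, 0, 1, 0, 0] := by
    ext i
    fin_cases i <;> simp [frame, hs, hx']
  have e2 : frame ![x₁, 0, 0, 0, x₅] 2 = ![0, 0, 0, 1, 0] := by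
    ext i
    fin_cases i <;> simp [frame, hs, hx']
  have e3 : frame ![x₁, 0, 0, 0, x₅] 3 = ![-x₅, 0, 0, 0, x₁] := by
    ext i
    fin_cases i <;> simp [frame, hs, hx']
    field_simp
    linarith
  refine Prod.ext ?_ ?_
  · ext i
    fin_cases i <;> simp [ofCoords, act, basePt, frameMat]
  · change ∑ i, a i • omegaFrame ![x₁, 0, 0, 0, x₅] i
      = frameMat x₁ x₅ * asd a * (frameMat x₁ x₅).transpose
    rw [Fin.sum_univ_three]
    simp only [omegaFrame, Matrix.cons_val]
    rw [e0, e1, e2, e3]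
    ext i j
    rw [Matrix.mul_apply, Fin.sum_univ_five]
    simp only [Matrix.add_apply, Matrix.smul_apply, Matrix.sub_apply, wedge_apply]
    fin_cases i <;> fin_cases j <;> simp [frameMat, asd] <;> ring

/-- The derivative of `symRep` at the identity. -/
def symRepDeriv (W : Matrix (Fin 3) (Fin 3) ℝ) : Matrix (Fin 5) (Fin 5) ℝ :=
  Matrix.of fun i j => ofSym (W * toSym (Pi.single j 1) + toSym (Pi.single j 1) * W.transpose) i

theorem symRepDeriv_skew (w₁ w₂ w₃ : ℝ) : symRepDeriv (skew w₁ w₂ w₃) =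
    !![0, -(2 * w₂), -w₁, -w₃, 0;
       2 * w₂, 0, w₃, -w₁, 0;
       w₁, -w₃, 0, -w₂, -(√3 * w₁);
       w₃, w₁, w₂, 0, √3 * w₃;
       0, 0, √3 * w₁, -(√3 * w₃), 0] := by
  have h3 : (√3 : ℝ) ≠ 0 := by positivity
  have h3' : (√3 : ℝ) ^ 2 = 3 := Real.sq_sqrt (by norm_num)
  have ht : (skew w₁ w₂ w₃).transpose = skew (-w₁) (-w₂) (-w₃) := by
    ext i j
    fin_cases i <;> fin_cases j <;> simp [skew]
  ext i j
  rw [symRepDeriv, Matrix.of_apply, ht]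
  fin_cases j <;> fin_cases i <;>
    simp [skew, toSym, ofSym, Matrix.mul_apply, Fin.sum_univ_succ,
      Pi.single_apply] <;> (try field_simp) <;> (try rw [h3']) <;>
    (try ring1)

/-- The infinitesimal rotation of `ℝ⁵` in the frame `x, e₁, …, e₄` when `W = skew w₁ w₂ w₃` acts
and `x` moves with angular velocity `θ`. -/
def genMat (x₁ x₅ w₁ w₂ w₃ θ : ℝ) : Matrix (Fin 5) (Fin 5) ℝ :=
  !![0, -(2 * x₁ * w₂), -((x₁ - √3 * x₅) * w₁), -((x₁ + √3 * x₅) * w₃), -θ;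
     2 * x₁ * w₂, 0, w₃, -w₁, -(2 * x₅ * w₂);
     (x₁ - √3 * x₅) * w₁, -w₃, 0, -w₂, -((x₅ + √3 * x₁) * w₁);
     (x₁ + √3 * x₅) * w₃, w₁, w₂, 0, (√3 * x₁ - x₅) * w₃;
     θ, 2 * x₅ * w₂, (x₅ + √3 * x₁) * w₁, -((√3 * x₁ - x₅) * w₃), 0]

/-- For the moving frame `F = symRep A * frameMat` this is the structure equation `F' = F Z`, with
`symRep A` cancelled on the left. -/
theorem genMat_eq {x₁ x₅ : ℝ} (h : x₁ ^ 2 + x₅ ^ 2 = 1) {y₁ y₅ : ℝ} (hy : x₁ * y₁ + x₅ * y₅ = 0)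
    (w₁ w₂ w₃ : ℝ) :
    symRepDeriv (skew w₁ w₂ w₃) * frameMat x₁ x₅
      + !![y₁, 0, 0, 0, -y₅; 0, 0, 0, 0, 0; 0, 0, 0, 0, 0; 0, 0, 0, 0, 0; y₅, 0, 0, 0, y₁]
      = frameMat x₁ x₅ * genMat x₁ x₅ w₁ w₂ w₃ (x₁ * y₅ - x₅ * y₁) := by
  rw [symRepDeriv_skew]
  ext i j
  rw [Matrix.add_apply, Matrix.mul_apply, Matrix.mul_apply, Fin.sum_univ_five, Fin.sum_univ_five]
  fin_cases i <;> fin_cases j <;> simp [frameMat, genMat]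
  · linear_combination -y₁ * h + x₁ * hy
  · linear_combination 2 * w₂ * h
  · linear_combination w₁ * h
  · linear_combination w₃ * h
  · linear_combination y₅ * h - x₅ * hy
  · ring
  · ring
  · ring
  · ring
  · ring
  · ring
  · linear_combination -y₅ * h + x₅ * hy
  · ring
  · linear_combination -(√3 * w₁) * h
  · linear_combination (√3 * w₃) * h
  · linear_combination -y₁ * h + x₁ * hy

/-- The velocity at `basePt a` of a path with infinitesimal rotation `Z` and fibre velocity `d`. -/
def genVec (Z : Matrix (Fin 5) (Fin 5) ℝ) (a d : Fin 3 → ℝ) : Ambient :=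
  (Z *ᵥ Pi.single 0 1, Z * asd a + asd a * Z.transpose + asd d)

/-- The matrix `genCoords` along the path. -/
def tangentCoords (x₁ x₅ θ : ℝ) (a d : Fin 3 → ℝ) : Matrix (Fin 4) (Fin 7) ℝ :=
  genCoords (2 * x₁) (x₁ - √3 * x₅) (x₁ + √3 * x₅) (1 + x₅ - √3 * x₁) (1 + x₅ + √3 * x₁)
    (1 - 2 * x₅) θ a d

/-- The vertical part is the commutator of `asd a` with the tangential block of `genMat`, plus the
fibre velocity. Only the anti-self-dual part of the block matters; its coefficients are the last
three constants before `θ` in `tangentCoords`. -/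
theorem hasCoords_genVec (x₁ x₅ w₁ w₂ w₃ θ τ : ℝ) (a d : Fin 3 → ℝ) :
    HasCoords a (genVec (genMat x₁ x₅ w₁ w₂ w₃ (τ * θ)) a (τ • d))
      (![w₁, w₂, w₃, τ] ᵥ* tangentCoords x₁ x₅ θ a d) := by
  have hV : ![w₁, w₂, w₃, τ] ᵥ* tangentCoords x₁ x₅ θ a d =
      ![2 * x₁ * w₂, (x₁ - √3 * x₅) * w₁, (x₁ + √3 * x₅) * w₃, τ * θ,
        -(w₁ * ((1 + x₅ + √3 * x₁) * a 2)) - w₂ * ((1 - 2 * x₅) * a 1) + τ * d 0,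
        w₂ * ((1 - 2 * x₅) * a 0) - w₃ * ((1 + x₅ - √3 * x₁) * a 2) + τ * d 1,
        w₁ * ((1 + x₅ + √3 * x₁) * a 0) + w₃ * ((1 + x₅ - √3 * x₁) * a 1) + τ * d 2] := by
    ext i
    fin_cases i <;> simp [tangentCoords, genCoords, vecMul, dotProduct, Fin.sum_univ_succ] <;> ring
  have hP : (1 : Matrix (Fin 5) (Fin 5) ℝ)
      - vecMulVec (Pi.single (0 : Fin 5) (1 : ℝ)) (Pi.single (0 : Fin 5) (1 : ℝ))
      = diagonal ![0, 1, 1, 1, 1] := by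
    ext i j
    fin_cases i <;> fin_cases j <;> simp [vecMulVec]
  rw [hV]
  constructor
  · ext i
    fin_cases i <;> simp [genVec, genMat]
  · rw [vert]
    simp only [basePt, hP]
    ext i j
    rw [mul_diagonal, diagonal_mul, genVec]
    simp only [Matrix.add_apply, Matrix.mul_apply, Fin.sum_univ_five]
    fin_cases i <;> fin_cases j <;> simp [genMat, asd] <;> ring

end BryantSalamon
end

noncomputable section
namespace BryantSalamon

open Matrix Filter

/-! ## Derivatives of paths of matrices -/

theorem hasDerivAt_matrix {m n : ℕ} {A : ℝ → Matrix (Fin m) (Fin n) ℝ}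
    {A' : Matrix (Fin m) (Fin n) ℝ} {t : ℝ} :
    HasDerivAt A A' t ↔ ∀ i j, HasDerivAt (fun x => A x i j) (A' i j) t := by
  constructor
  · intro h i j
    exact hasDerivAt_pi.1 (hasDerivAt_pi.1 h i) j
  · intro h
    exact hasDerivAt_pi.2 fun i => hasDerivAt_pi.2 fun j => h i j

theorem hasDerivAt_matrix_mul {l m n : ℕ} {A : ℝ → Matrix (Fin l) (Fin m) ℝ}
    {B : ℝ → Matrix (Fin m) (Fin n) ℝ} {A' : Matrix (Fin l) (Fin m) ℝ}
    {B' : Matrix (Fin m) (Fin n) ℝ} {t : ℝ} (hA : HasDerivAt A A' t) (hB : HasDerivAt B B' t) :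
    HasDerivAt (fun x => A x * B x) (A' * B t + A t * B') t := by
  rw [hasDerivAt_matrix] at *
  intro i j
  simp only [Matrix.add_apply, Matrix.mul_apply, ← Finset.sum_add_distrib]
  exact HasDerivAt.fun_sum fun k _ => (hA i k).mul (hB k j)

theorem hasDerivAt_matrix_transpose {m n : ℕ} {A : ℝ → Matrix (Fin m) (Fin n) ℝ}
    {A' : Matrix (Fin m) (Fin n) ℝ} {t : ℝ} (hA : HasDerivAt A A' t) :
    HasDerivAt (fun x => (A x).transpose) A'.transpose t := by
  rw [hasDerivAt_matrix] at *
  exact fun i j => hA j i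

theorem exists_skew_of_hasDerivAt {A : ℝ → Matrix (Fin 3) (Fin 3) ℝ}
    {A' : Matrix (Fin 3) (Fin 3) ℝ} {t : ℝ} (hA : HasDerivAt A A' t) (hrot : ∀ x, IsRot (A x)) :
    ∃ w₁ w₂ w₃ : ℝ, A' = A t * skew w₁ w₂ w₃ := by
  set W := (A t).transpose * A' with hW
  have hAW : A' = A t * W := by
    rw [hW, ← Matrix.mul_assoc, (hrot t).mul_transpose, Matrix.one_mul]
  have h1 := hasDerivAt_matrix_mul (hasDerivAt_matrix_transpose hA) hA
  have h2 : (fun x => (A x).transpose * A x) = fun _ => 1 := funext fun x => (hrot x).1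
  rw [h2] at h1
  have h3 := h1.unique (hasDerivAt_const t 1)
  have h4 : A'.transpose * A t = W.transpose := by
    rw [hW, transpose_mul, transpose_transpose]
  rw [h4, ← hW] at h3
  have e (i j : Fin 3) : W j i + W i j = 0 := congrFun (congrFun h3 i) j
  refine ⟨W 2 1, W 0 2, W 1 0, ?_⟩
  rw [hAW]
  congr 1
  ext i j
  have e00 := e 0 0
  have e11 := e 1 1
  have e22 := e 2 2
  have e01 := e 0 1
  have e02 := e 0 2
  have e12 := e 1 2
  fin_cases i <;> fin_cases j <;> simp [skew] <;> linarith

theorem hasDerivAt_symRep {A : ℝ → Matrix (Fin 3) (Fin 3) ℝ} {W : Matrix (Fin 3) (Fin 3) ℝ}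
    {t : ℝ} (hA : HasDerivAt A (A t * W) t) (hW : W.transpose = -W) :
    HasDerivAt (fun x => symRep (A x)) (symRep (A t) * symRepDeriv W) t := by
  rw [hasDerivAt_matrix]
  intro i j
  set T := toSym (Pi.single j 1) with hT
  have h1 : HasDerivAt (fun x => A x * T * (A x).transpose)
      (A t * (W * T + T * W.transpose) * (A t).transpose) t := by
    have := hasDerivAt_matrix_mul (hasDerivAt_matrix_mul hA (hasDerivAt_const t T))
      (hasDerivAt_matrix_transpose hA)
    convert this using 1
    simp only [transpose_mul, Matrix.mul_zero, add_zero, Matrix.mul_add, Matrix.add_mul,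
      Matrix.mul_assoc]
  have h2 := (LinearMap.toContinuousLinearMap ofSymLin).hasFDerivAt.comp_hasDerivAt t h1
  have h3 := hasDerivAt_pi.1 h2 i
  have hsym : (W * T + T * W.transpose).transpose = W * T + T * W.transpose := by
    rw [transpose_add, transpose_mul, transpose_mul, transpose_transpose, hT, toSym_transpose,
      add_comm]
  have htr : (W * T + T * W.transpose).trace = 0 := by
    rw [hW, trace_add, Matrix.mul_neg, trace_neg, Matrix.trace_mul_comm]
    ring
  have h4 : (symRep (A t) * symRepDeriv W) i j =
      ofSym (A t * (W * T + T * W.transpose) * (A t).transpose) i := by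
    have : (symRep (A t) * symRepDeriv W) i j
        = (symRep (A t) *ᵥ ofSym (W * T + T * W.transpose)) i := rfl
    rw [this, symRep_mulVec, toSym_ofSym hsym htr]
  rw [h4]
  exact h3

theorem hasDerivAt_frameMat {u v : ℝ → ℝ} {u' v' t : ℝ} (hu : HasDerivAt u u' t)
    (hv : HasDerivAt v v' t) :
    HasDerivAt (fun x => frameMat (u x) (v x))
      !![u', 0, 0, 0, -v'; 0, 0, 0, 0, 0; 0, 0, 0, 0, 0; 0, 0, 0, 0, 0; v', 0, 0, 0, u'] t := by
  rw [hasDerivAt_matrix]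
  intro i j
  fin_cases i <;> fin_cases j <;> simp [frameMat] <;>
    first | exact hu | exact hv | exact hv.neg | exact hasDerivAt_const _ _

theorem hasDerivAt_asd {a : ℝ → Fin 3 → ℝ} {a' : Fin 3 → ℝ} {t : ℝ} (ha : HasDerivAt a a' t) :
    HasDerivAt (fun x => asd (a x)) (asd a') t := by
  have h := hasDerivAt_pi.1 ha
  rw [hasDerivAt_matrix]
  intro i j
  fin_cases i <;> fin_cases j <;> simp [asd] <;>
    first | exact h _ | exact (h _).neg | exact hasDerivAt_const _ _

theorem hasDerivAt_act_basePt {R : ℝ → Matrix (Fin 5) (Fin 5) ℝ} {Z : Matrix (Fin 5) (Fin 5) ℝ}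
    {a : ℝ → Fin 3 → ℝ} {d : Fin 3 → ℝ} {t : ℝ} (hR : HasDerivAt R (R t * Z) t)
    (ha : HasDerivAt a d t) :
    HasDerivAt (fun x => act (R x) (basePt (a x))) (act (R t) (genVec Z (a t) d)) t := by
  refine HasDerivAt.prodMk ?_ ?_
  · refine hasDerivAt_pi.2 fun i => ?_
    have := hasDerivAt_matrix.1 hR i 0
    simp only [basePt, genVec, mulVec_single_one]
    exact this
  · have h := hasDerivAt_matrix_mul (hasDerivAt_matrix_mul hR (hasDerivAt_asd ha))
      (hasDerivAt_matrix_transpose hR)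
    change HasDerivAt (fun x => R x * asd (a x) * (R x).transpose) (R t * (Z * asd (a t)
      + asd (a t) * Z.transpose + asd d) * (R t).transpose) t
    convert h using 1
    simp only [transpose_mul, Matrix.mul_add, Matrix.add_mul, Matrix.mul_assoc]
    abel

/-- The velocity of a path in the union of the orbits. -/
theorem hasDerivAt_orbit {A : ℝ → Matrix (Fin 3) (Fin 3) ℝ} {w₁ w₂ w₃ : ℝ} {t : ℝ}
    (hA : HasDerivAt A (A t * skew w₁ w₂ w₃) t)
    {u v : ℝ → ℝ} {u' v' : ℝ} (hu : HasDerivAt u u' t) (hv : HasDerivAt v v' t)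
    (huv : u t ^ 2 + v t ^ 2 = 1) (huv' : u t * u' + v t * v' = 0)
    {a : ℝ → Fin 3 → ℝ} {d : Fin 3 → ℝ} (ha : HasDerivAt a d t) :
    HasDerivAt (fun x => act (symRep (A x) * frameMat (u x) (v x)) (basePt (a x)))
      (act (symRep (A t) * frameMat (u t) (v t))
        (genVec (genMat (u t) (v t) w₁ w₂ w₃ (u t * v' - v t * u')) (a t) d)) t := by
  refine hasDerivAt_act_basePt ?_ ha
  have hsk : (skew w₁ w₂ w₃).transpose = -skew w₁ w₂ w₃ := by
    ext i j
    fin_cases i <;> fin_cases j <;> simp [skew]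
  have h := hasDerivAt_matrix_mul (hasDerivAt_symRep hA hsk) (hasDerivAt_frameMat hu hv)
  convert h using 1
  rw [Matrix.mul_assoc, ← genMat_eq huv huv', Matrix.mul_add, Matrix.mul_assoc]

end BryantSalamon
end

noncomputable section
namespace BryantSalamon

open Filter Set

/-! ## Charts of submanifolds -/

section Charts

variable {E : Type*} [NormedAddCommGroup E] [NormedSpace ℝ E]

/-- `f` is a regular parametrisation of an open piece of `L` by the open set `U`. -/
structure IsChart {k : ℕ} (L : Set E) (U : Set (Fin k → ℝ)) (f : (Fin k → ℝ) → E) : Prop where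
  isOpen : IsOpen U
  contDiffOn : ContDiffOn ℝ (⊤ : ℕ∞) f U
  injective_fderiv : ∀ u ∈ U, Function.Injective (fderiv ℝ f u)
  injOn : InjOn f U
  mapsTo : MapsTo f U L
  nhdsWithin_le : ∀ u ∈ U, 𝓝[L] (f u) ≤ map f (𝓝 u)

theorem IsChart.image_mem {k : ℕ} {L : Set E} {U : Set (Fin k → ℝ)} {f : (Fin k → ℝ) → E}
    (h : IsChart L U f) {u : Fin k → ℝ} (hu : u ∈ U) {W : Set (Fin k → ℝ)} (hW : W ∈ 𝓝 u) :
    f '' (W ∩ U) ∈ 𝓝[L] (f u) := by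
  refine h.nhdsWithin_le u hu (mem_map.mpr ?_)
  filter_upwards [inter_mem hW (h.isOpen.mem_nhds hu)] with x hx using mem_image_of_mem f hx

/-- The inclusion of neighbourhood filters in `IsChart` says that `f` is open as a map to `L`; this
gives both the embedding property and a relatively open image. -/
theorem isEmbeddedSubmanifold_of_charts {k : ℕ} {L : Set E}
    (h : ∀ p ∈ L, ∃ (U : Set (Fin k → ℝ)) (f : (Fin k → ℝ) → E), IsChart L U f ∧ p ∈ f '' U) :
    IsEmbeddedSubmanifold k L := by
  intro p hp
  obtain ⟨U, f, hf, hpU⟩ := h p hp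
  have hV (u : U) : ∃ V, IsOpen V ∧ f u ∈ V ∧ V ∩ L ⊆ f '' U := by
    have := hf.image_mem u.2 (univ_mem)
    rw [univ_inter] at this
    obtain ⟨V, hVo, hfV, hVL⟩ := mem_nhdsWithin.mp this
    exact ⟨V, hVo, hfV, hVL⟩
  choose V hVo hfV hVL using hV
  refine ⟨U, ⋃ u, V u, f, hf.isOpen, isOpen_iUnion hVo, ?_, hf.contDiffOn, hf.injective_fderiv,
    ⟨?_, ?_⟩, ?_⟩
  · obtain ⟨u, hu, rfl⟩ := hpU
    exact mem_iUnion.mpr ⟨⟨u, hu⟩, hfV ⟨u, hu⟩⟩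
  · rw [Topology.isInducing_iff_nhds]
    intro u
    refine le_antisymm ?_ ?_
    · exact (hf.contDiffOn.continuousOn.domRestrict.tendsto u).le_comap
    · intro W hW
      obtain ⟨W', hW', hWW⟩ := mem_nhds_subtype _ _ _ |>.mp hW
      obtain ⟨O, hO, hfO, hOL⟩ := mem_nhdsWithin.mp (hf.image_mem u.2 hW')
      refine mem_comap.mpr ⟨O, hO.mem_nhds hfO, fun x hx => hWW ?_⟩
      obtain ⟨y, hy, hyx⟩ := hOL ⟨hx, hf.mapsTo x.2⟩
      rw [mem_preimage, ← hf.injOn hy.2 x.2 hyx]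
      exact hy.1
  · exact fun x y hxy => Subtype.ext (hf.injOn x.2 y.2 hxy)
  · ext q
    constructor
    · rintro ⟨u, hu, rfl⟩
      exact ⟨hf.mapsTo hu, mem_iUnion.mpr ⟨⟨u, hu⟩, hfV ⟨u, hu⟩⟩⟩
    · rintro ⟨hq, hqV⟩
      obtain ⟨u, hu⟩ := mem_iUnion.mp hqV
      exact hVL u ⟨hu, hq⟩

/-- The curve is differentiable at `0` only, so it is lifted to `β` through an arbitrary inverse of
`f`. Then `β t - u = O(t)`, the vectors `Df (β t - u) / t` tend to `v`, and the range of `Df` is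
closed. -/
theorem IsChart.exists_fderiv_eq {k : ℕ} {L : Set E} {U : Set (Fin k → ℝ)}
    {f : (Fin k → ℝ) → E} (h : IsChart L U f) {u : Fin k → ℝ} (hu : u ∈ U) {v : E}
    (hv : v ∈ tangentVectors L (f u)) : ∃ w, fderiv ℝ f u w = v := by
  obtain ⟨γ, hγ0, hγL, hγ⟩ := hv
  have hlim : Tendsto γ (𝓝 0) (𝓝[L] (f u)) := by
    rw [← hγ0]
    exact tendsto_nhdsWithin_iff.mpr ⟨hγ.continuousAt, hγL⟩
  set β : ℝ → Fin k → ℝ := fun t => Function.invFunOn f U (γ t) with hβ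
  have hβU : ∀ᶠ t in 𝓝 0, f (β t) = γ t := by
    filter_upwards [hlim (h.image_mem hu univ_mem)] with t ht
    obtain ⟨x, hx, hxt⟩ := ht
    exact Function.invFunOn_eq ⟨x, hx.2, hxt⟩
  have hβlim : Tendsto β (𝓝 0) (𝓝 u) := by
    intro W hW
    have hev : ∀ᶠ t in 𝓝 0, γ t ∈ f '' (W ∩ U) := hlim (h.image_mem hu hW)
    rw [mem_map]
    filter_upwards [hev] with t ht
    obtain ⟨x, hx, hxt⟩ := ht
    have h1 : f (β t) = γ t := Function.invFunOn_eq ⟨x, hx.2, hxt⟩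
    have h2 : β t ∈ U := Function.invFunOn_mem ⟨x, hx.2, hxt⟩
    rw [mem_preimage, h.injOn h2 hx.2 (h1.trans hxt.symm)]
    exact hx.1
  have hdiff : HasFDerivAt f (fderiv ℝ f u) u :=
    (((h.contDiffOn u hu).contDiffAt (h.isOpen.mem_nhds hu)).differentiableAt
      (by simp)).hasFDerivAt
  -- An injective linear map on a finite-dimensional space is bounded below; this survives the error
  -- term of the derivative and gives `x - u = O(f x - f u)`.
  obtain ⟨C, -, hC⟩ := (fderiv ℝ f u).toLinearMap.exists_antilipschitzWith
    (LinearMap.ker_eq_bot.mpr (h.injective_fderiv u hu))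
  have hrev : (fun x => x - u) =O[𝓝 u] fun x => f x - f u := by
    have h1 : (fun x => x - u) =O[𝓝 u] fun x => fderiv ℝ f u (x - u) :=
      Asymptotics.IsBigO.of_bound C (Eventually.of_forall fun x => by
        have := hC.le_mul_dist (x - u) 0
        rw [map_zero, dist_zero_right, dist_zero_right] at this
        exact this)
    refine h1.trans ((hdiff.isLittleO.trans_isBigO h1).right_isBigO_add.congr_right fun x => ?_)
    abel
  have hO1 : (fun t => β t - u) =O[𝓝 0] fun t => f (β t) - f u := hrev.comp_tendsto hβlim
  have hO2 : (fun t => γ t - γ 0) =O[𝓝 0] fun t : ℝ => t - 0 := hγ.isBigO_sub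
  have hO3 : (fun t => β t - u) =O[𝓝 0] fun t : ℝ => t - 0 := by
    refine hO1.trans (hO2.congr' ?_ EventuallyEq.rfl)
    filter_upwards [hβU] with t ht
    rw [ht, hγ0]
  have ho1 : (fun t => f (β t) - f u - fderiv ℝ f u (β t - u)) =o[𝓝 0] fun t : ℝ => t - 0 :=
    (hdiff.isLittleO.comp_tendsto hβlim).trans_isBigO hO3
  have ho2 : (fun t => γ t - γ 0 - (t - 0) • v) =o[𝓝 0] fun t : ℝ => t - 0 :=
    hasDerivAt_iff_isLittleO.mp hγ
  have ho3 : (fun t => fderiv ℝ f u (β t - u) - t • v) =o[𝓝 0] fun t : ℝ => t := by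
    have := ho2.sub ho1
    simp only [sub_zero] at this
    refine this.congr' ?_ EventuallyEq.rfl
    filter_upwards [hβU] with t ht
    rw [ht, hγ0]
    abel
  have hlim2 : Tendsto (fun t : ℝ => fderiv ℝ f u (t⁻¹ • (β t - u))) (𝓝[≠] 0) (𝓝 v) := by
    rw [tendsto_iff_norm_sub_tendsto_zero]
    have h1 := (ho3.mono (nhdsWithin_le_nhds (s := {0}ᶜ))).norm_left.tendsto_div_nhds_zero
    have h2 := h1.norm
    rw [norm_zero] at h2
    refine h2.congr' ?_
    filter_upwards [self_mem_nhdsWithin] with t ht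
    have ht' : t ≠ 0 := ht
    rw [map_smul, norm_div, norm_norm, div_eq_inv_mul, ← norm_inv, ← norm_smul, smul_sub,
      smul_smul, inv_mul_cancel₀ ht', one_smul]
  have hcl : IsClosed ((LinearMap.range (fderiv ℝ f u).toLinearMap : Submodule ℝ E) : Set E) :=
    Submodule.closed_of_finiteDimensional _
  have := hcl.mem_of_tendsto hlim2 (Eventually.of_forall fun t => ⟨t⁻¹ • (β t - u), rfl⟩)
  exact this

end Charts

end BryantSalamon
end

noncomputable section
namespace BryantSalamon

/-! ## The differential equations -/

/-- The numbers `x₁ ± √3 x₅` and `2 x₁` are the differences of the eigenvalues of the symmetric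
matrix; `|x₅| < 1/2` describes the open chamber where they are distinct. -/
theorem sub_sqrt_three_mul_pos {x₁ x₅ : ℝ} (h0 : 0 < x₁) (h5 : |x₅| < 1 / 2)
    (h : x₁ ^ 2 + x₅ ^ 2 = 1) : 0 < x₁ - √3 * x₅ := by
  have h3 : (√3 : ℝ) ^ 2 = 3 := Real.sq_sqrt (by norm_num)
  have h3' : 0 < √3 := by positivity
  obtain ⟨h5a, h5b⟩ := abs_lt.mp h5
  by_contra hc
  have : x₁ ^ 2 ≤ (√3 * x₅) ^ 2 := pow_le_pow_left₀ h0.le (by linarith) 2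
  rw [mul_pow, h3] at this
  nlinarith

theorem add_sqrt_three_mul_pos {x₁ x₅ : ℝ} (h0 : 0 < x₁) (h5 : |x₅| < 1 / 2)
    (h : x₁ ^ 2 + x₅ ^ 2 = 1) : 0 < x₁ + √3 * x₅ := by
  have := sub_sqrt_three_mul_pos h0 (x₅ := -x₅) (by rwa [abs_neg]) (by rw [neg_sq]; exact h)
  linarith

/-- The three equations at one point, in terms of the angular velocity `θ` and the logarithmic
derivative `L` of `λ + r²`. -/
structure SliceEq (x₁ x₅ θ L : ℝ) (a d : Fin 3 → ℝ) : Prop where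
  eq₁ : 2 * x₁ * (x₁ - √3 * x₅) * d 0 =
    a 0 * ((2 * x₁ * (1 + x₅ + √3 * x₁) - (1 - 2 * x₅) * (x₁ - √3 * x₅)) * θ
      - (1 + x₅ + √3 * x₁) * (1 - 2 * x₅) * L / 4)
  eq₂ : 2 * x₁ * (x₁ + √3 * x₅) * d 1 =
    a 1 * ((2 * x₁ * (1 + x₅ - √3 * x₁) - (1 - 2 * x₅) * (x₁ + √3 * x₅)) * θ
      - (1 + x₅ - √3 * x₁) * (1 - 2 * x₅) * L / 4)
  eq₃ : (1 - 2 * x₅) * (1 + 2 * x₅) * d 2 =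
    a 2 * (2 * x₁ * (1 + 4 * x₅) * θ - (1 + x₅) * (1 - 2 * x₅) * L / 2)

/-- A velocity tangent to the unit circle is `(y₁, y₅) = θ (-x₅, x₁)`, which leaves a single
unknown; on the circle `x₁² - 3 x₅² = (1 - 2x₅)(1 + 2x₅)`. -/
theorem SliceEq.of_ode {x₁ x₅ y₁ y₅ L : ℝ} {a d : Fin 3 → ℝ}
    (h : x₁ ^ 2 + x₅ ^ 2 = 1) (hy : x₁ * y₁ + x₅ * y₅ = 0)
    (h₁ : 4 * ((2 * √3 * x₁ + 4 * x₅ + 1) * y₅ + √3 * (2 * x₅ - 1) * y₁) * a 0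
        + 8 * x₁ * (-x₁ + √3 * x₅) * d 0
        - (√3 * x₁ + x₅ + 1) * (1 - 2 * x₅) * a 0 * L = 0)
    (h₂ : 4 * ((2 * √3 * x₁ - 4 * x₅ - 1) * y₅ + √3 * (2 * x₅ - 1) * y₁) * a 1
        + 8 * x₁ * (x₁ + √3 * x₅) * d 1
        + (-√3 * x₁ + x₅ + 1) * (1 - 2 * x₅) * a 1 * L = 0)
    (h₃ : 4 * (-(x₅ + 1) * y₅ + 3 * x₁ * y₁) * a 2 + 2 * (x₁ ^ 2 - 3 * x₅ ^ 2) * d 2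
        + (1 + x₅) * (1 - 2 * x₅) * a 2 * L = 0) :
    SliceEq x₁ x₅ (x₁ * y₅ - x₅ * y₁) L a d := by
  set θ := x₁ * y₅ - x₅ * y₁ with hθ
  have hy5 : y₅ = x₁ * θ := by linear_combination -y₅ * h + x₅ * hy
  have hy1 : y₁ = -(x₅ * θ) := by linear_combination -y₁ * h + x₁ * hy
  clear_value θ
  rw [hy5, hy1] at h₁ h₂ h₃
  constructor
  · linear_combination (-1 / 4) * h₁
  · linear_combination (1 / 4) * h₂
  · linear_combination (1 / 2) * h₃ - d 2 * h

theorem SliceEq.psi_sq {s x₁ x₅ θ L : ℝ} {a d : Fin 3 → ℝ} (hS : SliceEq x₁ x₅ θ L a d)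
    (h : x₁ ^ 2 + x₅ ^ 2 = 1) (hs : s ≠ 0)
    (hL : L * s ^ 4 = 2 * (a 0 * d 0 + a 1 * d 1 + a 2 * d 2)) :
    psi s (tangentCoords x₁ x₅ θ a d) ^ 2 =
      (tangentCoords x₁ x₅ θ a d * coordGram s * (tangentCoords x₁ x₅ θ a d).transpose).det := by
  have h3 : (√3 : ℝ) ^ 2 = 3 := Real.sq_sqrt (by norm_num)
  have hw : a 0 * d 0 + a 1 * d 1 + a 2 * d 2 = L * s ^ 4 / 2 := by linarith
  refine psi_genCoords_sq hs _ _ _ _ _ _ _ _ _ ?_ ?_ ?_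
  · rw [hw]
    linear_combination (2 * s ^ 4) * hS.eq₁
  · rw [hw]
    linear_combination (2 * s ^ 4) * hS.eq₂
  · rw [hw]
    -- On the circle `m₁ m₂ = -2(1 + x₅)(1 - 2x₅)` and `m₂ q₃ + m₁ q₁ = 2x₁(1 + 4x₅)`.
    linear_combination (-(2 * s ^ 4)) * hS.eq₃ + (2 * s ^ 4 * x₅ ^ 2 * d 2
      + 4 * s ^ 4 * a 2 * θ * x₁ * x₅ - x₁ ^ 2 * a 2 * L * s ^ 4 / 2) * h3
      - (3 / 2 * s ^ 4 * a 2 * L + 2 * s ^ 4 * d 2) * h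

/-- At a critical point of `height`, with `θ = (1 - 2x₅) σ`, the first equation makes `2x₁(x₁ - √3
x₅) a₁ ȧ₁` equal to `σ a₁²` times the left side. The inequality thus bounds `a₁ ȧ₁ / σ` by `2x₁
a₁²`. -/
theorem slice_coeff₁_le {x₁ x₅ : ℝ} (h0 : 0 < x₁) (h5 : |x₅| < 1 / 2)
    (h : x₁ ^ 2 + x₅ ^ 2 = 1) :
    (1 - 2 * x₅) * (x₁ * (1 + x₅ + √3 * x₁) - (1 - 2 * x₅) * (x₁ - √3 * x₅))
      ≤ 2 * x₁ * (2 * x₁ * (x₁ - √3 * x₅)) := by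
  have h3 : (√3 : ℝ) ^ 2 = 3 := Real.sq_sqrt (by norm_num)
  have h3' : 0 < √3 := by positivity
  have h3a : √3 < 1.7321 := by
    rw [Real.sqrt_lt' (by norm_num)]; norm_num
  obtain ⟨h5a, h5b⟩ := abs_lt.mp h5
  have hq₁ := sub_sqrt_three_mul_pos h0 h5 h
  have hq₃ := add_sqrt_three_mul_pos h0 h5 h
  have hx1 : x₁ ≤ 1 := by nlinarith
  have hx1' : 0.86 < x₁ := by nlinarith
  have hm : 0 < 1 - 2 * x₅ := by linarith
  have hqq : (x₁ - √3 * x₅) * (x₁ + √3 * x₅) = (1 - 2 * x₅) * (1 + 2 * x₅) := by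
    linear_combination h - x₅ ^ 2 * h3
  -- For `x₅ ≤ 0` the bound `1 + x₅ + √3 x₁ ≤ 4(x₁ - √3 x₅)` suffices. For `x₅ ≥ 0` the factor `x₁ -
  -- √3 x₅` degenerates at `1/2`, so the inequality is multiplied by `x₁ + √3 x₅` and a factor `1 -
  -- 2x₅` is split off.
  rcases le_total x₅ 0 with hneg | hpos
  · have hq : 0 ≤ 4 * (x₁ - √3 * x₅) - (1 + x₅ + √3 * x₁) := by
      have h1 := mul_nonneg (sub_pos.mpr h3a).le h0.le
      have h2 := mul_nonneg h3'.le (neg_nonneg.mpr hneg)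
      linarith
    have h1 := mul_nonneg (mul_nonneg h0.le hm.le) hq
    have h2 := mul_nonneg hq₁.le (sq_nonneg (2 * x₁ - (1 - 2 * x₅)))
    linarith
  · have hG : 0 ≤ (1 + 2 * x₅) * (4 * x₁ ^ 2 + (1 - 2 * x₅) ^ 2)
        - x₁ * (1 + x₅ + √3 * x₁) * (x₁ + √3 * x₅) := by
      have h1 : (1 + 2 * x₅) * (4 * x₁ ^ 2 + (1 - 2 * x₅) ^ 2)
        - x₁ * (1 + x₅ + √3 * x₁) * (x₁ + √3 * x₅)
        = 4 + 2 * x₅ - 7 * x₅ ^ 2 + 4 * x₅ ^ 3 - √3 * x₁ * (1 + x₅) := by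
        linear_combination (4 * (1 + 2 * x₅) - (1 + x₅) - √3 * x₁ - 3 * x₅) * h
          - x₁ ^ 2 * x₅ * h3
      rw [h1]
      have hs : √3 * x₁ ≤ 1.7321 := by
        have := mul_le_mul_of_nonneg_left hx1 h3'.le
        linarith
      have h2 := mul_le_mul_of_nonneg_right hs (by linarith : 0 ≤ 1 + x₅)
      have h4 := mul_nonneg hpos (sub_pos.mpr h5b).le
      have h6 : 0 ≤ x₅ ^ 3 := by positivity
      linarith
    by_contra hc
    have hc' := mul_pos (sub_pos.mpr (not_le.mp hc)) hq₃
    have hG' := mul_nonneg hm.le hG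
    have : (1 - 2 * x₅) * ((1 + 2 * x₅) * (4 * x₁ ^ 2 + (1 - 2 * x₅) ^ 2)
        - x₁ * (1 + x₅ + √3 * x₁) * (x₁ + √3 * x₅)) =
        -(((1 - 2 * x₅) * (x₁ * (1 + x₅ + √3 * x₁) - (1 - 2 * x₅) * (x₁ - √3 * x₅))
          - 2 * x₁ * (2 * x₁ * (x₁ - √3 * x₅))) * (x₁ + √3 * x₅)) := by
      linear_combination -(4 * x₁ ^ 2 + (1 - 2 * x₅) ^ 2) * hqq
    linarith

/-- The analogous bound for the second equation; here `1 + x₅ ≤ √3 x₁`, so the left side is not even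
positive. -/
theorem slice_coeff₂_le {x₁ x₅ : ℝ} (h0 : 0 < x₁) (h5 : |x₅| < 1 / 2)
    (h : x₁ ^ 2 + x₅ ^ 2 = 1) :
    (1 - 2 * x₅) * (x₁ * (1 + x₅ - √3 * x₁) - (1 - 2 * x₅) * (x₁ + √3 * x₅))
      ≤ 2 * x₁ * (2 * x₁ * (x₁ + √3 * x₅)) := by
  have h3 : (√3 : ℝ) ^ 2 = 3 := Real.sq_sqrt (by norm_num)
  obtain ⟨h5a, h5b⟩ := abs_lt.mp h5
  have hq₃ := add_sqrt_three_mul_pos h0 h5 h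
  have hm : 0 < 1 - 2 * x₅ := by linarith
  have hμ : 1 + x₅ - √3 * x₁ ≤ 0 := by
    by_contra hc
    have : (√3 * x₁) ^ 2 < (1 + x₅) ^ 2 :=
      pow_lt_pow_left₀ (by linarith) (by positivity) (by norm_num)
    rw [mul_pow, h3] at this
    nlinarith
  have h1 := mul_nonpos_of_nonneg_of_nonpos h0.le hμ
  have h2 := mul_nonneg hm.le hq₃.le
  have h4 := mul_nonpos_of_nonneg_of_nonpos hm.le (by linarith :
    x₁ * (1 + x₅ - √3 * x₁) - (1 - 2 * x₅) * (x₁ + √3 * x₅) ≤ 0)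
  exact h4.trans (by positivity)

/-- The function `(1 - 2 x₅)² (λ + r²)` has no critical points on solutions. -/
theorem SliceEq.eq_zero {x₁ x₅ θ L lam : ℝ} {a d : Fin 3 → ℝ} (hS : SliceEq x₁ x₅ θ L a d)
    (h0 : 0 < x₁) (h5 : |x₅| < 1 / 2) (h : x₁ ^ 2 + x₅ ^ 2 = 1) (hlam : 0 < lam)
    (hL : L * (lam + (a 0 ^ 2 + a 1 ^ 2 + a 2 ^ 2)) = 2 * (a 0 * d 0 + a 1 * d 1 + a 2 * d 2))
    (hcrit : (1 - 2 * x₅) * L = 4 * (x₁ * θ)) : θ = 0 ∧ d = 0 := by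
  obtain ⟨h5a, h5b⟩ := abs_lt.mp h5
  have hq₁ := sub_sqrt_three_mul_pos h0 h5 h
  have hq₃ := add_sqrt_three_mul_pos h0 h5 h
  have hm : 0 < 1 - 2 * x₅ := by linarith
  have hp : 0 < 1 + 2 * x₅ := by linarith
  obtain ⟨e₁, e₂, e₃⟩ := hS
  -- write everything as a multiple of `σ`
  obtain ⟨σ, hσ⟩ : ∃ σ, θ = (1 - 2 * x₅) * σ := ⟨θ / (1 - 2 * x₅), by field_simp⟩
  have hLσ : L = 4 * x₁ * σ := by
    have : (1 - 2 * x₅) * (L - 4 * x₁ * σ) = 0 := by rw [mul_sub, hcrit, hσ]; ring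
    rcases mul_eq_zero.mp this with h' | h' <;> linarith
  have k₁ := slice_coeff₁_le h0 h5 h
  have k₂ := slice_coeff₂_le h0 h5 h
  have f₁ : 2 * x₁ * (x₁ - √3 * x₅) * (a 0 * d 0) =
      σ * (a 0 ^ 2 * ((1 - 2 * x₅) * (x₁ * (1 + x₅ + √3 * x₁)
        - (1 - 2 * x₅) * (x₁ - √3 * x₅)))) := by
    rw [hσ, hLσ] at e₁
    linear_combination a 0 * e₁
  have f₂ : 2 * x₁ * (x₁ + √3 * x₅) * (a 1 * d 1) =
      σ * (a 1 ^ 2 * ((1 - 2 * x₅) * (x₁ * (1 + x₅ - √3 * x₁)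
        - (1 - 2 * x₅) * (x₁ + √3 * x₅)))) := by
    rw [hσ, hLσ] at e₂
    linear_combination a 1 * e₂
  have f₃ : (1 + 2 * x₅) * (a 2 * d 2) = σ * (a 2 ^ 2 * (6 * x₁ * x₅)) := by
    rw [hσ, hLσ] at e₃
    have : (1 - 2 * x₅) * ((1 + 2 * x₅) * (a 2 * d 2) - σ * (a 2 ^ 2 * (6 * x₁ * x₅))) = 0 := by
      linear_combination a 2 * e₃
    rcases mul_eq_zero.mp this with h' | h' <;> linarith
  -- If `σ ≠ 0`, the three bounds give `∑ aᵢ ȧᵢ / σ ≤ 2x₁ r²`, while `L = 4x₁σ` makes this sum equal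
  -- to `2x₁(λ + r²)`, contradicting `λ > 0`.
  have hσ0 : σ = 0 := by
    by_contra hne
    have g₁ : a 0 * d 0 / σ ≤ 2 * x₁ * a 0 ^ 2 := by
      have hpos : 0 < 2 * x₁ * (x₁ - √3 * x₅) := by positivity
      refine le_of_mul_le_mul_left ?_ hpos
      rw [mul_div_assoc', f₁, mul_div_cancel_left₀ _ hne]
      linarith [mul_le_mul_of_nonneg_left k₁ (sq_nonneg (a 0))]
    have g₂ : a 1 * d 1 / σ ≤ 2 * x₁ * a 1 ^ 2 := by
      have hpos : 0 < 2 * x₁ * (x₁ + √3 * x₅) := by positivity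
      refine le_of_mul_le_mul_left ?_ hpos
      rw [mul_div_assoc', f₂, mul_div_cancel_left₀ _ hne]
      linarith [mul_le_mul_of_nonneg_left k₂ (sq_nonneg (a 1))]
    have g₃ : a 2 * d 2 / σ ≤ 2 * x₁ * a 2 ^ 2 := by
      refine le_of_mul_le_mul_left ?_ hp
      rw [mul_div_assoc', f₃, mul_div_cancel_left₀ _ hne]
      linarith [mul_nonneg (sq_nonneg (a 2)) (mul_nonneg h0.le (by linarith : 0 ≤ 1 - x₅))]
    have g : a 0 * d 0 / σ + a 1 * d 1 / σ + a 2 * d 2 / σ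
        = 2 * x₁ * (lam + (a 0 ^ 2 + a 1 ^ 2 + a 2 ^ 2)) := by
      rw [hLσ] at hL
      field_simp
      linarith
    have := mul_pos h0 hlam
    linarith
  have hθ : θ = 0 := by rw [hσ, hσ0, mul_zero]
  have hL0 : L = 0 := by rw [hLσ, hσ0, mul_zero]
  rw [hθ, hL0] at e₁ e₂ e₃
  simp only [mul_zero, zero_div, sub_zero] at e₁ e₂ e₃
  refine ⟨hθ, ?_⟩
  ext i
  fin_cases i
  · exact (mul_eq_zero.mp e₁).resolve_left (by positivity)
  · exact (mul_eq_zero.mp e₂).resolve_left (by positivity)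
  · exact (mul_eq_zero.mp e₃).resolve_left (by positivity)

/-- A solution of a homogeneous linear differential equation on an open interval vanishes
identically if it vanishes somewhere. -/
theorem eq_zero_of_linear_ode {I : Set ℝ} (hI : IsOpen I) (hIc : I.OrdConnected) {f k : ℝ → ℝ}
    (hk : ContinuousOn k I) (hf : ∀ t ∈ I, HasDerivAt f (k t * f t) t) {t₀ : ℝ} (h₀ : t₀ ∈ I)
    (hz : f t₀ = 0) : ∀ t ∈ I, f t = 0 := by
  have hK (t) (ht : t ∈ I) : HasDerivAt (fun x => ∫ u in t₀..x, k u) (k t) t := by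
    refine intervalIntegral.integral_hasDerivAt_right ?_ ?_ (hk.continuousAt (hI.mem_nhds ht))
    · exact (hk.mono (hIc.uIcc_subset h₀ ht)).intervalIntegrable
    · exact hk.stronglyMeasurableAtFilter hI t ht
  set g : ℝ → ℝ := fun x => f x * Real.exp (-∫ u in t₀..x, k u) with hg
  have hgd (t) (ht : t ∈ I) : HasDerivAt g 0 t := by
    have h1 : HasDerivAt g (k t * f t * Real.exp (-∫ u in t₀..t, k u)
        + f t * (Real.exp (-∫ u in t₀..t, k u) * -k t)) t := (hf t ht).mul (hK t ht).neg.exp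
    exact h1.congr_deriv (by ring)
  intro t ht
  have h1 : g t = g t₀ := by
    refine hI.is_const_of_deriv_eq_zero (𝕜 := ℝ) (f := g) hIc.isPreconnected ?_ ?_ ht h₀
    · exact fun t ht => (hgd t ht).differentiableAt.differentiableWithinAt
    · exact fun t ht => (hgd t ht).deriv
  simp only [hg, hz, zero_mul] at h1
  exact (mul_eq_zero.mp h1).resolve_right (Real.exp_pos _).ne'

end BryantSalamon
end

noncomputable section
namespace BryantSalamon

open Matrix

/-! ## Orbits of points of the slice -/

/-- The point with fibre coordinates `a` over `(x₁, 0, 0, 0, x₅)`. -/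
def slicePt (x₁ x₅ : ℝ) (a : Fin 3 → ℝ) : Ambient := act (frameMat x₁ x₅) (basePt a)

theorem slicePt_fst (x₁ x₅ : ℝ) (a : Fin 3 → ℝ) : (slicePt x₁ x₅ a).1 = ![x₁, 0, 0, 0, x₅] := by
  ext i
  fin_cases i <;> simp [slicePt, act, basePt, frameMat]

theorem fibreInner_slicePt {x₁ x₅ : ℝ} (h : x₁ ^ 2 + x₅ ^ 2 = 1) (a : Fin 3 → ℝ) :
    fibreInner (slicePt x₁ x₅ a).2 (slicePt x₁ x₅ a).2 = a 0 ^ 2 + a 1 ^ 2 + a 2 ^ 2 := by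
  simp only [slicePt, act, (frameMat_isRot h).fibreInner_conj, basePt, fibreInner_asd]
  ring

theorem slicePt_injective {x₁ x₅ : ℝ} (h : x₁ ^ 2 + x₅ ^ 2 = 1) {a b : Fin 3 → ℝ}
    (hab : slicePt x₁ x₅ a = slicePt x₁ x₅ b) : a = b := by
  have h1 := congrArg (act (frameMat x₁ x₅).transpose) hab
  rw [slicePt, slicePt, (frameMat_isRot h).act_transpose_act,
    (frameMat_isRot h).act_transpose_act] at h1
  have h2 : asd a = asd b := congrArg Prod.snd h1
  ext i
  fin_cases i
  · exact congrFun (congrFun h2 1) 2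
  · exact congrFun (congrFun h2 1) 3
  · exact congrFun (congrFun h2 1) 4

/-- For `x₅ = sin α` the right side is `2 sin 3α`, which is injective for `|α| ≤ π/6`, that is,
`|x₅| ≤ 1/2`. -/
theorem det_toSym_slice (x₁ x₅ : ℝ) (h : x₁ ^ 2 + x₅ ^ 2 = 1) :
    3 * √3 * (toSym ![x₁, 0, 0, 0, x₅]).det = 2 * (3 * x₅ - 4 * x₅ ^ 3) := by
  have h3 : (√3 : ℝ) ^ 2 = 3 := Real.sq_sqrt (by norm_num)
  have h3' : (√3 : ℝ) ≠ 0 := by positivity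
  simp [toSym, det_fin_three]
  field_simp
  rw [h3]
  linear_combination 9 * x₅ * h + 3 * x₅ * x₁ ^ 2 * h3

/-- Every orbit meets the closed slice in at most one base point. -/
theorem IsRot.slice_eq {B : Matrix (Fin 3) (Fin 3) ℝ} (hB : IsRot B) {x₁ x₅ y₁ y₅ : ℝ}
    (hx : 0 < x₁) (hx5 : |x₅| < 1 / 2) (h : x₁ ^ 2 + x₅ ^ 2 = 1)
    (hy : 0 ≤ y₁) (hy5 : |y₅| ≤ 1 / 2) (h' : y₁ ^ 2 + y₅ ^ 2 = 1)
    (heq : symRep B *ᵥ ![x₁, 0, 0, 0, x₅] = ![y₁, 0, 0, 0, y₅]) : y₁ = x₁ ∧ y₅ = x₅ := by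
  have hdet : (toSym ![y₁, 0, 0, 0, y₅]).det = (toSym ![x₁, 0, 0, 0, x₅]).det := by
    rw [← heq, hB.toSym_symRep, det_mul, det_mul, det_transpose, hB.2, one_mul, mul_one]
  have h1 := det_toSym_slice x₁ x₅ h
  have h2 := det_toSym_slice y₁ y₅ h'
  rw [hdet, h1] at h2
  obtain ⟨ha, hb⟩ := abs_lt.mp hx5
  obtain ⟨hc, hd⟩ := abs_le.mp hy5
  have h5 : y₅ = x₅ := by
    have hfac : (y₅ - x₅) * (3 - 4 * (y₅ ^ 2 + y₅ * x₅ + x₅ ^ 2)) = 0 := by linarith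
    refine sub_eq_zero.mp ((mul_eq_zero.mp hfac).resolve_right ?_)
    -- The second factor is positive: `y₅² + y₅x₅ + x₅² < 3/4` because `|x₅| < 1/2` and `|y₅| ≤
    -- 1/2`.
    nlinarith [mul_nonneg (sub_nonneg.mpr hd) (sub_nonneg.mpr ha.le),
      mul_nonneg (sub_nonneg.mpr hd) (sub_nonneg.mpr hb.le),
      mul_nonneg (sub_nonneg.mpr hc) (sub_nonneg.mpr hb.le),
      mul_nonneg (sub_nonneg.mpr hc) (sub_nonneg.mpr ha.le),
      mul_pos (sub_pos.mpr ha) (sub_pos.mpr hb),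
      mul_nonneg (sub_nonneg.mpr hc) (sub_nonneg.mpr hd)]
  refine ⟨?_, h5⟩
  rw [h5] at h'
  have : (y₁ - x₁) * (y₁ + x₁) = 0 := by linarith
  exact sub_eq_zero.mp ((mul_eq_zero.mp this).resolve_right (by positivity))

/-- `B` commutes with a diagonal matrix whose entries are distinct on the open chamber. -/
theorem IsRot.eq_diagonal {B : Matrix (Fin 3) (Fin 3) ℝ} (hB : IsRot B) {x₁ x₅ : ℝ}
    (hx : 0 < x₁) (hx5 : |x₅| < 1 / 2) (h : x₁ ^ 2 + x₅ ^ 2 = 1)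
    (heq : symRep B *ᵥ ![x₁, 0, 0, 0, x₅] = ![x₁, 0, 0, 0, x₅]) :
    ∃ d : Fin 3 → ℝ, B = diagonal d ∧ ∀ i, d i ^ 2 = 1 := by
  have h3 : (√3 : ℝ) ^ 2 = 3 := Real.sq_sqrt (by norm_num)
  have h3' : (√3 : ℝ) ≠ 0 := by positivity
  have hq₁ := (sub_sqrt_three_mul_pos hx hx5 h).ne'
  have hq₃ := (add_sqrt_three_mul_pos hx hx5 h).ne'
  have hcomm : B * toSym ![x₁, 0, 0, 0, x₅] = toSym ![x₁, 0, 0, 0, x₅] * B := by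
    have h1 := hB.toSym_symRep ![x₁, 0, 0, 0, x₅]
    rw [heq] at h1
    nth_rw 2 [h1]
    rw [Matrix.mul_assoc, hB.1, Matrix.mul_one]
  have hD : toSym ![x₁, 0, 0, 0, x₅]
      = diagonal ![x₁ + x₅ / √3, -(2 * x₅ / √3), -x₁ + x₅ / √3] := by
    ext i j
    fin_cases i <;> fin_cases j <;> simp [toSym]
  rw [hD] at hcomm
  have hij (i j : Fin 3) : B i j * (![x₁ + x₅ / √3, -(2 * x₅ / √3), -x₁ + x₅ / √3] j
      - ![x₁ + x₅ / √3, -(2 * x₅ / √3), -x₁ + x₅ / √3] i) = 0 := by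
    have := congrFun (congrFun hcomm i) j
    rw [mul_diagonal, diagonal_mul] at this
    linarith
  have e01 : x₁ + x₅ / √3 - -(2 * x₅ / √3) = x₁ + √3 * x₅ := by
    field_simp
    linear_combination -x₅ * h3
  have e21 : -x₁ + x₅ / √3 - -(2 * x₅ / √3) = -(x₁ - √3 * x₅) := by
    field_simp
    linear_combination -x₅ * h3
  have d01 : x₁ + x₅ / √3 ≠ -(2 * x₅ / √3) := by
    rw [← sub_ne_zero, e01]; exact hq₃
  have d21 : -x₁ + x₅ / √3 ≠ -(2 * x₅ / √3) := by
    rw [← sub_ne_zero, e21]; exact neg_ne_zero.mpr hq₁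
  have d02 : x₁ ≠ -x₁ := fun h => by linarith
  have hz (i j : Fin 3) (hne : i ≠ j) : B i j = 0 := by
    refine (mul_eq_zero.mp (hij i j)).resolve_right (sub_ne_zero.mpr ?_)
    fin_cases i <;> fin_cases j <;> simp at hne ⊢ <;>
      first | exact d01 | exact d01.symm | exact d21 | exact d21.symm | exact d02 | exact d02.symm
  have hBd : B = diagonal fun i => B i i := by
    ext i j
    by_cases hne : i = j
    · rw [hne, diagonal_apply_eq]
    · rw [diagonal_apply_ne _ hne, hz i j hne]
  refine ⟨fun i => B i i, hBd, fun i => ?_⟩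
  have h1 := hB.1
  rw [hBd, diagonal_transpose, diagonal_mul_diagonal] at h1
  have := congrFun (congrFun h1 i) i
  rw [diagonal_apply_eq, one_apply_eq] at this
  rw [sq]
  exact this

/-- The stabiliser of a base point acts on the fibre coordinates by signs, the same signs at every
point of the slice. -/
theorem act_symRep_diagonal {d : Fin 3 → ℝ} (hd : ∀ i, d i ^ 2 = 1) (x₁ x₅ : ℝ)
    (a : Fin 3 → ℝ) : act (symRep (diagonal d)) (slicePt x₁ x₅ a) =
      slicePt x₁ x₅ ![d 0 * d 1 * a 0, d 1 * d 2 * a 1, d 0 * d 2 * a 2] := by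
  have h0 := hd 0
  have h1 := hd 1
  have h2 := hd 2
  have hcomm : symRep (diagonal d) * frameMat x₁ x₅ = frameMat x₁ x₅ * symRep (diagonal d) := by
    rw [symRep_diagonal d hd]
    ext i j
    rw [mul_diagonal, diagonal_mul]
    fin_cases i <;> fin_cases j <;> simp [frameMat]
  rw [slicePt, slicePt, ← act_mul, hcomm, act_mul]
  congr 1
  refine Prod.ext ?_ ?_
  · change symRep (diagonal d) *ᵥ Pi.single 0 1 = Pi.single 0 1
    rw [symRep_diagonal d hd]
    ext i
    rw [mulVec_diagonal]
    fin_cases i <;> simp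
  · change symRep (diagonal d) * asd a * (symRep (diagonal d)).transpose = asd _
    rw [symRep_diagonal d hd, diagonal_transpose]
    ext i j
    rw [mul_diagonal, diagonal_mul]
    fin_cases i <;> fin_cases j <;> simp [asd]
    all_goals first
      | ring1
      | linear_combination d 0 * d 1 * a 0 * h2
      | linear_combination -d 0 * d 1 * a 0 * h2
      | linear_combination d 1 * d 2 * a 1 * h0
      | linear_combination -d 1 * d 2 * a 1 * h0
      | linear_combination d 0 * d 2 * a 2 * h1

end BryantSalamon
end

noncomputable section
namespace BryantSalamon

open Matrix Filter Set

/-! ## Solutions of the differential equations -/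

/-- The logarithmic derivative of `λ + r²`. -/
def logDeriv (lam : ℝ) (a d : Fin 3 → ℝ) : ℝ :=
  2 * (a 0 * d 0 + a 1 * d 1 + a 2 * d 2) / (lam + (a 0 ^ 2 + a 1 ^ 2 + a 2 ^ 2))

/-- The angular velocity of the path `(x₁, x₅)`. -/
def angVel (x₁ x₅ : ℝ → ℝ) (t : ℝ) : ℝ := x₁ t * deriv x₅ t - x₅ t * deriv x₁ t

/-- A regular solution of the differential equations on the open interval `I`. -/
structure IsSolution (lam : ℝ) (I : Set ℝ) (x₁ x₅ : ℝ → ℝ) (a : ℝ → Fin 3 → ℝ) : Prop where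
  lam_pos : 0 < lam
  isOpen : IsOpen I
  ordConnected : I.OrdConnected
  smooth₁ : ContDiffOn ℝ (⊤ : ℕ∞) x₁ I
  smooth₅ : ContDiffOn ℝ (⊤ : ℕ∞) x₅ I
  smooth : ContDiffOn ℝ (⊤ : ℕ∞) a I
  pos : ∀ t ∈ I, 0 < x₁ t
  abs_lt : ∀ t ∈ I, |x₅ t| < 1 / 2
  sphere : ∀ t ∈ I, x₁ t ^ 2 + x₅ t ^ 2 = 1
  regular : ∀ t ∈ I, ¬ (deriv x₁ t = 0 ∧ deriv x₅ t = 0 ∧ deriv a t = 0)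
  eq : ∀ t ∈ I, SliceEq (x₁ t) (x₅ t) (angVel x₁ x₅ t) (logDeriv lam (a t) (deriv a t))
    (a t) (deriv a t)

section Solution

variable {lam : ℝ} {I : Set ℝ} {x₁ x₅ : ℝ → ℝ} {a : ℝ → Fin 3 → ℝ}

theorem hasDerivAt_of_smooth {F : Type*} [NormedAddCommGroup F] [NormedSpace ℝ F] {f : ℝ → F}
    (hI : IsOpen I) (hf : ContDiffOn ℝ (⊤ : ℕ∞) f I) {t : ℝ} (ht : t ∈ I) :
    HasDerivAt f (deriv f t) t :=
  (((hf t ht).contDiffAt (hI.mem_nhds ht)).differentiableAt (by simp)).hasDerivAt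

theorem sphere_deriv (hI : IsOpen I) {t : ℝ} (ht : t ∈ I)
    (h : ∀ t ∈ I, x₁ t ^ 2 + x₅ t ^ 2 = 1) {y₁ y₅ : ℝ} (h1 : HasDerivAt x₁ y₁ t)
    (h5 : HasDerivAt x₅ y₅ t) : x₁ t * y₁ + x₅ t * y₅ = 0 := by
  have h2 := (h1.fun_pow 2).fun_add (h5.fun_pow 2)
  have h3 : (fun t => x₁ t ^ 2 + x₅ t ^ 2) =ᶠ[𝓝 t] fun _ => 1 := by
    filter_upwards [hI.mem_nhds ht] with s hs using h s hs
  have h4 := h2.unique ((hasDerivAt_const t (1 : ℝ)).congr_of_eventuallyEq h3)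
  simp at h4
  linarith

theorem IsSolution.deriv_sphere (h : IsSolution lam I x₁ x₅ a) {t : ℝ} (ht : t ∈ I) :
    x₁ t * deriv x₁ t + x₅ t * deriv x₅ t = 0 :=
  sphere_deriv h.isOpen ht h.sphere (hasDerivAt_of_smooth h.isOpen h.smooth₁ ht)
    (hasDerivAt_of_smooth h.isOpen h.smooth₅ ht)

theorem IsSolution.deriv_x₁ (h : IsSolution lam I x₁ x₅ a) {t : ℝ} (ht : t ∈ I) :
    deriv x₁ t = -(x₅ t * angVel x₁ x₅ t) := by
  rw [angVel]
  linear_combination -deriv x₁ t * h.sphere t ht + x₁ t * h.deriv_sphere ht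

theorem IsSolution.deriv_x₅ (h : IsSolution lam I x₁ x₅ a) {t : ℝ} (ht : t ∈ I) :
    deriv x₅ t = x₁ t * angVel x₁ x₅ t := by
  rw [angVel]
  linear_combination -deriv x₅ t * h.sphere t ht + x₅ t * h.deriv_sphere ht

theorem IsSolution.regular' (h : IsSolution lam I x₁ x₅ a) {t : ℝ} (ht : t ∈ I) :
    ¬ (angVel x₁ x₅ t = 0 ∧ deriv a t = 0) := by
  rintro ⟨h1, h2⟩
  refine h.regular t ht ⟨?_, ?_, h2⟩
  · rw [h.deriv_x₁ ht, h1, mul_zero, neg_zero]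
  · rw [h.deriv_x₅ ht, h1, mul_zero]

theorem rho_pos (hlam : 0 < lam) (b : Fin 3 → ℝ) : 0 < lam + (b 0 ^ 2 + b 1 ^ 2 + b 2 ^ 2) := by
  positivity

theorem logDeriv_mul (hlam : 0 < lam) (b d : Fin 3 → ℝ) :
    logDeriv lam b d * (lam + (b 0 ^ 2 + b 1 ^ 2 + b 2 ^ 2))
      = 2 * (b 0 * d 0 + b 1 * d 1 + b 2 * d 2) := by
  rw [logDeriv, div_mul_cancel₀ _ (rho_pos hlam b).ne']

/-- A function of the orbit which is monotone along solutions. -/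
def height (lam x₅ : ℝ) (b : Fin 3 → ℝ) : ℝ :=
  (1 - 2 * x₅) ^ 2 * (lam + (b 0 ^ 2 + b 1 ^ 2 + b 2 ^ 2))

theorem IsSolution.exists_hasDerivAt_height (h : IsSolution lam I x₁ x₅ a) {t : ℝ} (ht : t ∈ I) :
    ∃ e ≠ 0, HasDerivAt (fun t => height lam (x₅ t) (a t)) e t := by
  have h5 := hasDerivAt_of_smooth h.isOpen h.smooth₅ ht
  have ha := hasDerivAt_pi.1 (hasDerivAt_of_smooth h.isOpen h.smooth ht)
  have hd := (((h5.const_mul 2).const_sub 1).fun_pow 2).fun_mul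
    (((((ha 0).fun_pow 2).fun_add ((ha 1).fun_pow 2)).fun_add ((ha 2).fun_pow 2)).const_add lam)
  refine ⟨_, ?_, hd⟩
  intro hz
  obtain ⟨-, hb⟩ := _root_.abs_lt.mp (h.abs_lt t ht)
  have hm : 0 < 1 - 2 * x₅ t := by linarith
  have hρ := rho_pos h.lam_pos (a t)
  have hL := logDeriv_mul h.lam_pos (a t) (deriv a t)
  -- This is the vanishing of the logarithmic derivative of `height`, cleared of its denominator.
  have hcrit : (1 - 2 * x₅ t) * logDeriv lam (a t) (deriv a t)
      = 4 * (x₁ t * angVel x₁ x₅ t) := by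
    rw [← h.deriv_x₅ ht]
    have : (1 - 2 * x₅ t) * (lam + (a t 0 ^ 2 + a t 1 ^ 2 + a t 2 ^ 2))
        * ((1 - 2 * x₅ t) * logDeriv lam (a t) (deriv a t) - 4 * deriv x₅ t) = 0 := by
      simp at hz
      linear_combination hz + (1 - 2 * x₅ t) ^ 2 * hL
    rcases mul_eq_zero.mp this with h' | h'
    · exact absurd h' (mul_pos hm hρ).ne'
    · linarith
  exact h.regular' ht ((h.eq t ht).eq_zero (h.pos t ht) (h.abs_lt t ht) (h.sphere t ht) h.lam_pos
    hL hcrit)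

/-- By Darboux a derivative without zeros has constant sign on an interval; `c = ±1` absorbs the
unknown sign. -/
theorem IsSolution.exists_strictMonoOn (h : IsSolution lam I x₁ x₅ a) :
    ∃ c : ℝ, StrictMonoOn (fun t => c * height lam (x₅ t) (a t)) I := by
  set H : ℝ → ℝ := fun t => height lam (x₅ t) (a t) with hH
  have hdiff (t) (ht : t ∈ I) : HasDerivAt H (deriv H t) t := by
    obtain ⟨e, -, he⟩ := h.exists_hasDerivAt_height ht
    exact he.differentiableAt.hasDerivAt
  have hne (t) (ht : t ∈ I) : deriv H t ≠ 0 := by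
    obtain ⟨e, hne, he⟩ := h.exists_hasDerivAt_height ht
    rw [he.deriv]
    exact hne
  have hconv : Convex ℝ I := h.ordConnected.convex
  have hcont : ContinuousOn H I := fun t ht => (hdiff t ht).continuousAt.continuousWithinAt
  rcases hasDerivWithinAt_forall_lt_or_forall_gt_of_forall_ne hconv
    (fun t ht => (hdiff t ht).hasDerivWithinAt) hne with hneg | hpos
  · refine ⟨-1, strictMonoOn_of_deriv_pos hconv (continuousOn_const.mul hcont) ?_⟩
    rw [h.isOpen.interior_eq]
    intro t ht
    rw [((hdiff t ht).const_mul (-1)).deriv]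
    linarith [hneg t ht]
  · refine ⟨1, strictMonoOn_of_deriv_pos hconv (continuousOn_const.mul hcont) ?_⟩
    rw [h.isOpen.interior_eq]
    intro t ht
    rw [((hdiff t ht).const_mul 1).deriv]
    linarith [hpos t ht]

theorem IsSolution.continuousOn_deriv {F : Type*} [NormedAddCommGroup F] [NormedSpace ℝ F]
    {f : ℝ → F} (h : IsSolution lam I x₁ x₅ a) (hf : ContDiffOn ℝ (⊤ : ℕ∞) f I) :
    ContinuousOn (deriv f) I :=
  hf.continuousOn_deriv_of_isOpen h.isOpen (by simp)

/-- Each fibre coordinate vanishes identically if it vanishes somewhere. -/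
theorem IsSolution.coord_eq_zero (h : IsSolution lam I x₁ x₅ a) {i : Fin 3} {t₀ : ℝ}
    (ht₀ : t₀ ∈ I) (hz : a t₀ i = 0) : ∀ t ∈ I, a t i = 0 := by
  have c₁ := h.smooth₁.continuousOn
  have c₅ := h.smooth₅.continuousOn
  have ca (i : Fin 3) : ContinuousOn (fun t => a t i) I :=
    (continuous_apply i).comp_continuousOn h.smooth.continuousOn
  have cd (i : Fin 3) : ContinuousOn (fun t => deriv a t i) I :=
    (continuous_apply i).comp_continuousOn (h.continuousOn_deriv h.smooth)
  have cθ : ContinuousOn (angVel x₁ x₅) I :=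
    (c₁.mul (h.continuousOn_deriv h.smooth₅)).sub (c₅.mul (h.continuousOn_deriv h.smooth₁))
  have cL : ContinuousOn (fun t => logDeriv lam (a t) (deriv a t)) I := by
    refine ContinuousOn.div ?_ ?_ fun t _ => (rho_pos h.lam_pos (a t)).ne'
    · have := ca 0; have := ca 1; have := ca 2; have := cd 0; have := cd 1; have := cd 2
      fun_prop
    · have := ca 0; have := ca 1; have := ca 2
      fun_prop
  -- With `logDeriv` frozen as a known continuous function, each equation reads `p ȧᵢ = k aᵢ` with
  -- `p` nowhere zero.
  have key (p k : ℝ → ℝ) (hp : ContinuousOn p I) (hk : ContinuousOn k I)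
      (hp0 : ∀ t ∈ I, p t ≠ 0) (he : ∀ t ∈ I, p t * deriv a t i = a t i * k t) :
      ∀ t ∈ I, a t i = 0 := by
    refine eq_zero_of_linear_ode h.isOpen h.ordConnected (k := fun t => k t / p t)
      (hk.div hp hp0) (fun t ht => ?_) ht₀ hz
    refine (hasDerivAt_pi.1 (hasDerivAt_of_smooth h.isOpen h.smooth ht) i).congr_deriv ?_
    have := hp0 t ht
    field_simp
    linarith [he t ht]
  fin_cases i
  · refine key _ _ ?_ ?_ ?_ fun t ht => (h.eq t ht).eq₁
    · fun_prop
    · fun_prop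
    · exact fun t ht => (mul_pos (mul_pos two_pos (h.pos t ht))
        (sub_sqrt_three_mul_pos (h.pos t ht) (h.abs_lt t ht) (h.sphere t ht))).ne'
  · refine key _ _ ?_ ?_ ?_ fun t ht => (h.eq t ht).eq₂
    · fun_prop
    · fun_prop
    · exact fun t ht => (mul_pos (mul_pos two_pos (h.pos t ht))
        (add_sqrt_three_mul_pos (h.pos t ht) (h.abs_lt t ht) (h.sphere t ht))).ne'
  · refine key _ _ ?_ ?_ ?_ fun t ht => (h.eq t ht).eq₃
    · fun_prop
    · fun_prop
    · intro t ht
      obtain ⟨hb, hc⟩ := _root_.abs_lt.mp (h.abs_lt t ht)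
      exact (mul_pos (by linarith) (by linarith)).ne'

/-- The path in the slice. -/
def path (x₁ x₅ : ℝ → ℝ) (a : ℝ → Fin 3 → ℝ) (t : ℝ) : Ambient := slicePt (x₁ t) (x₅ t) (a t)

/-- A rotation fixing one point of the path fixes all of them, and is diagonal. -/
theorem IsSolution.stabilizer (h : IsSolution lam I x₁ x₅ a) {B : Matrix (Fin 3) (Fin 3) ℝ}
    (hB : IsRot B) {t₀ : ℝ} (ht₀ : t₀ ∈ I)
    (hfix : act (symRep B) (path x₁ x₅ a t₀) = path x₁ x₅ a t₀) :
    (∃ d : Fin 3 → ℝ, B = diagonal d ∧ ∀ i, d i ^ 2 = 1) ∧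
      ∀ t ∈ I, act (symRep B) (path x₁ x₅ a t) = path x₁ x₅ a t := by
  have h1 : symRep B *ᵥ (path x₁ x₅ a t₀).1 = (path x₁ x₅ a t₀).1 := congrArg Prod.fst hfix
  rw [path, slicePt_fst] at h1
  obtain ⟨d, hBd, hd⟩ := hB.eq_diagonal (h.pos _ ht₀) (h.abs_lt _ ht₀) (h.sphere _ ht₀) h1
  refine ⟨⟨d, hBd, hd⟩, fun t ht => ?_⟩
  rw [hBd, path, act_symRep_diagonal hd] at hfix ⊢
  have h2 := slicePt_injective (h.sphere _ ht₀) hfix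
  congr 1
  -- A coordinate nonzero at `t₀` forces the sign `c` to be 1; a coordinate zero at `t₀` is zero
  -- throughout.
  have key (i : Fin 3) (c : ℝ) (hc : c * a t₀ i = a t₀ i) : c * a t i = a t i := by
    by_cases hz : a t₀ i = 0
    · rw [h.coord_eq_zero ht₀ hz t ht, mul_zero]
    · rw [(mul_eq_right₀ hz).mp hc, one_mul]
  ext i
  fin_cases i
  · exact key 0 _ (congrFun h2 0)
  · exact key 1 _ (congrFun h2 1)
  · exact key 2 _ (congrFun h2 2)

end Solution

end BryantSalamon
end

noncomputable section
namespace BryantSalamon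

open Matrix Filter Set

/-! ## The orbit parametrisation -/

section Chart

variable {lam : ℝ} {I : Set ℝ} {x₁ x₅ : ℝ → ℝ} {a : ℝ → Fin 3 → ℝ}

/-- The parametrisation of the union of the orbits near those of the rotation `g`. -/
def orbitMap (x₁ x₅ : ℝ → ℝ) (a : ℝ → Fin 3 → ℝ) (g : Matrix (Fin 3) (Fin 3) ℝ)
    (u : Fin 4 → ℝ) : Ambient :=
  act (symRep (g * cay (u 0) (u 1) (u 2))) (path x₁ x₅ a (u 3))

/-- The domain of `orbitMap`. -/
def orbitDomain (I : Set ℝ) : Set (Fin 4 → ℝ) :=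
  {u | |u 0| < 1 / 2 ∧ |u 1| < 1 / 2 ∧ |u 2| < 1 / 2 ∧ u 3 ∈ I}

theorem isOpen_orbitDomain (hI : IsOpen I) : IsOpen (orbitDomain I) := by
  have h (i : Fin 4) : IsOpen {u : Fin 4 → ℝ | |u i| < 1 / 2} :=
    isOpen_lt (continuous_abs.comp (continuous_apply i)) continuous_const
  exact (h 0).inter ((h 1).inter ((h 2).inter (hI.preimage (continuous_apply 3))))

/-! ### Smoothness -/

theorem contDiffOn_matrix {E : Type*} [NormedAddCommGroup E] [NormedSpace ℝ E] {m n : ℕ}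
    {A : E → Matrix (Fin m) (Fin n) ℝ} {s : Set E} :
    ContDiffOn ℝ (⊤ : ℕ∞) A s ↔ ∀ i j, ContDiffOn ℝ (⊤ : ℕ∞) (fun x => A x i j) s := by
  constructor
  · intro h i j
    exact contDiffOn_pi.1 (contDiffOn_pi.1 h i) j
  · intro h
    exact contDiffOn_pi.2 fun i => contDiffOn_pi.2 fun j => h i j

theorem contDiffOn_matrix_mul {E : Type*} [NormedAddCommGroup E] [NormedSpace ℝ E] {l m n : ℕ}
    {A : E → Matrix (Fin l) (Fin m) ℝ} {B : E → Matrix (Fin m) (Fin n) ℝ} {s : Set E}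
    (hA : ContDiffOn ℝ (⊤ : ℕ∞) A s) (hB : ContDiffOn ℝ (⊤ : ℕ∞) B s) :
    ContDiffOn ℝ (⊤ : ℕ∞) (fun x => A x * B x) s := by
  rw [contDiffOn_matrix] at *
  intro i j
  simp only [Matrix.mul_apply]
  exact ContDiffOn.sum fun k _ => (hA i k).mul (hB k j)

theorem contDiffOn_matrix_transpose {E : Type*} [NormedAddCommGroup E] [NormedSpace ℝ E]
    {m n : ℕ} {A : E → Matrix (Fin m) (Fin n) ℝ} {s : Set E} (hA : ContDiffOn ℝ (⊤ : ℕ∞) A s) :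
    ContDiffOn ℝ (⊤ : ℕ∞) (fun x => (A x).transpose) s := by
  rw [contDiffOn_matrix] at *
  exact fun i j => hA j i

theorem contDiffOn_symRep {E : Type*} [NormedAddCommGroup E] [NormedSpace ℝ E]
    {A : E → Matrix (Fin 3) (Fin 3) ℝ} {s : Set E} (hA : ContDiffOn ℝ (⊤ : ℕ∞) A s) :
    ContDiffOn ℝ (⊤ : ℕ∞) (fun x => symRep (A x)) s := by
  rw [contDiffOn_matrix]
  intro i j
  have h1 := contDiffOn_matrix_mul (contDiffOn_matrix_mul hA
    (contDiffOn_const (c := toSym (Pi.single j 1)))) (contDiffOn_matrix_transpose hA)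
  have h2 := (LinearMap.toContinuousLinearMap ofSymLin).contDiff.comp_contDiffOn h1
  exact contDiffOn_pi.1 h2 i

theorem contDiff_cay : ContDiff ℝ (⊤ : ℕ∞) fun u : Fin 4 → ℝ => cay (u 0) (u 1) (u 2) := by
  have h (u : Fin 4 → ℝ) : 1 + u 0 ^ 2 + u 1 ^ 2 + u 2 ^ 2 ≠ 0 := by positivity
  refine contDiff_pi.2 fun i => contDiff_pi.2 fun j => ?_
  fin_cases i <;> fin_cases j <;> simp [cay] <;> fun_prop (disch := exact h _)

theorem contDiffOn_path (hS : IsSolution lam I x₁ x₅ a) :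
    ContDiffOn ℝ (⊤ : ℕ∞) (path x₁ x₅ a) I := by
  have ha := contDiffOn_pi.1 hS.smooth
  have hF : ContDiffOn ℝ (⊤ : ℕ∞) (fun t => frameMat (x₁ t) (x₅ t)) I := by
    rw [contDiffOn_matrix]
    intro i j
    fin_cases i <;> fin_cases j <;> simp [frameMat] <;>
      first | exact hS.smooth₁ | exact hS.smooth₅ | exact hS.smooth₅.neg | exact contDiffOn_const
  have hA : ContDiffOn ℝ (⊤ : ℕ∞) (fun t => asd (a t)) I := by
    rw [contDiffOn_matrix]
    intro i j
    fin_cases i <;> fin_cases j <;> simp [asd] <;>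
      first | exact ha _ | exact (ha _).neg | exact contDiffOn_const
  refine ContDiffOn.prodMk ?_ ?_
  · refine contDiffOn_pi.2 fun i => ?_
    have := contDiffOn_matrix.1 hF i 0
    simp only [basePt, mulVec_single_one]
    exact this
  · exact contDiffOn_matrix_mul (contDiffOn_matrix_mul hF hA) (contDiffOn_matrix_transpose hF)

theorem contDiffOn_orbitMap (hS : IsSolution lam I x₁ x₅ a) (g : Matrix (Fin 3) (Fin 3) ℝ) :
    ContDiffOn ℝ (⊤ : ℕ∞) (orbitMap x₁ x₅ a g) (orbitDomain I) := by
  have hR := contDiffOn_symRep (contDiffOn_matrix_mul (contDiffOn_const (c := g))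
    (contDiff_cay.contDiffOn (s := orbitDomain I)))
  have hp : ContDiffOn ℝ (⊤ : ℕ∞) (fun u : Fin 4 → ℝ => path x₁ x₅ a (u 3)) (orbitDomain I) :=
    (contDiffOn_path hS).comp (contDiff_apply ℝ ℝ (3 : Fin 4)).contDiffOn fun u hu => hu.2.2.2
  refine ContDiffOn.prodMk ?_ ?_
  · refine contDiffOn_pi.2 fun i => ?_
    have h : ContDiffOn ℝ (⊤ : ℕ∞) (fun u : Fin 4 → ℝ => ∑ k,
        symRep (g * cay (u 0) (u 1) (u 2)) i k * (path x₁ x₅ a (u 3)).1 k) (orbitDomain I) :=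
      ContDiffOn.sum fun k _ => (contDiffOn_matrix.1 hR i k).mul (contDiffOn_pi.1 hp.fst k)
    exact h
  · exact contDiffOn_matrix_mul (contDiffOn_matrix_mul hR hp.snd) (contDiffOn_matrix_transpose hR)

/-! ### The derivative -/

theorem orbitMap_eq (g : Matrix (Fin 3) (Fin 3) ℝ) (u : Fin 4 → ℝ) :
    orbitMap x₁ x₅ a g u = act (symRep (g * cay (u 0) (u 1) (u 2)) *
      frameMat (x₁ (u 3)) (x₅ (u 3))) (basePt (a (u 3))) := by
  rw [orbitMap, path, slicePt, act_mul]

/-- The rotation of `ℝ⁵` taking `basePt` to a point of the orbit. -/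
def orbitRot (x₁ x₅ : ℝ → ℝ) (g : Matrix (Fin 3) (Fin 3) ℝ) (u : Fin 4 → ℝ) :
    Matrix (Fin 5) (Fin 5) ℝ :=
  symRep (g * cay (u 0) (u 1) (u 2)) * frameMat (x₁ (u 3)) (x₅ (u 3))

theorem orbitRot_isRot (hS : IsSolution lam I x₁ x₅ a) {g : Matrix (Fin 3) (Fin 3) ℝ}
    (hg : IsRot g) {u : Fin 4 → ℝ} (hu : u 3 ∈ I) : IsRot (orbitRot x₁ x₅ g u) :=
  (hg.mul (cay_isRot _ _ _)).symRep_isRot.mul (frameMat_isRot (hS.sphere _ hu))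

/-- `cay` is an immersion because it has the differentiable left inverse `cayInv`. -/
theorem hasDerivAt_cay_zero {p q r p' q' r' : ℝ}
    (h : HasDerivAt (fun ε : ℝ => cay (p + ε * p') (q + ε * q') (r + ε * r')) 0 0) :
    p' = 0 ∧ q' = 0 ∧ r' = 0 := by
  have he (i j : Fin 3) := hasDerivAt_matrix.1 h i j
  simp only [Matrix.zero_apply] at he
  have htr : HasDerivAt (fun ε : ℝ =>
      1 + (cay (p + ε * p') (q + ε * q') (r + ε * r')).trace) 0 0 := by
    have := (((he 0 0).add (he 1 1)).add (he 2 2)).const_add 1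
    simp only [add_zero] at this
    refine this.congr_of_eventuallyEq (Eventually.of_forall fun ε => ?_)
    simp [Matrix.trace, Fin.sum_univ_three]
  have hne : 1 + (cay (p + 0 * p') (q + 0 * q') (r + 0 * r')).trace ≠ 0 := by
    rw [one_add_trace_cay]
    positivity
  have key (i j : Fin 3) : HasDerivAt (fun ε : ℝ =>
      (cay (p + ε * p') (q + ε * q') (r + ε * r') i j
        - cay (p + ε * p') (q + ε * q') (r + ε * r') j i)
        / (1 + (cay (p + ε * p') (q + ε * q') (r + ε * r')).trace)) 0 0 := by
    have := ((he i j).fun_sub (he j i)).fun_div htr hne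
    simpa using this
  have hlin (c c' : ℝ) : HasDerivAt (fun ε : ℝ => c + ε * c') c' 0 := by
    simpa using ((hasDerivAt_id (0 : ℝ)).mul_const c').const_add c
  have hinv (ε : ℝ) := cayInv_cay (p + ε * p') (q + ε * q') (r + ε * r')
  refine ⟨?_, ?_, ?_⟩
  · refine ((key 2 1).congr_of_eventuallyEq (Eventually.of_forall fun ε => ?_)).unique
      (hlin p p') |>.symm
    exact (congrFun (hinv ε) 0).symm
  · refine ((key 0 2).congr_of_eventuallyEq (Eventually.of_forall fun ε => ?_)).unique
      (hlin q q') |>.symm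
    exact (congrFun (hinv ε) 1).symm
  · refine ((key 1 0).congr_of_eventuallyEq (Eventually.of_forall fun ε => ?_)).unique
      (hlin r r') |>.symm
    exact (congrFun (hinv ε) 2).symm

theorem fderiv_orbitMap (hS : IsSolution lam I x₁ x₅ a) {g : Matrix (Fin 3) (Fin 3) ℝ}
    (hg : IsRot g) {u : Fin 4 → ℝ} (hu : u ∈ orbitDomain I) (v : Fin 4 → ℝ) :
    ∃ w₁ w₂ w₃ : ℝ, (w₁ = 0 ∧ w₂ = 0 ∧ w₃ = 0 → v 0 = 0 ∧ v 1 = 0 ∧ v 2 = 0) ∧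
      fderiv ℝ (orbitMap x₁ x₅ a g) u v = act (orbitRot x₁ x₅ g u)
        (genVec (genMat (x₁ (u 3)) (x₅ (u 3)) w₁ w₂ w₃ (v 3 * angVel x₁ x₅ (u 3)))
          (a (u 3)) (v 3 • deriv a (u 3))) := by
  have hI : u 3 ∈ I := hu.2.2.2
  set A : ℝ → Matrix (Fin 3) (Fin 3) ℝ := fun ε =>
    cay (u 0 + ε * v 0) (u 1 + ε * v 1) (u 2 + ε * v 2) with hA
  have hline : HasDerivAt (fun ε : ℝ => u + ε • v) v 0 := by
    simpa using ((hasDerivAt_id (0 : ℝ)).smul_const v).const_add u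
  have hcd : DifferentiableAt ℝ A 0 := by
    have h1 : DifferentiableAt ℝ (fun u : Fin 4 → ℝ => cay (u 0) (u 1) (u 2)) (u + (0 : ℝ) • v) :=
      (contDiff_cay.differentiable (by simp)) _
    exact h1.comp (0 : ℝ) hline.differentiableAt
  obtain ⟨A', hA'⟩ : ∃ A', HasDerivAt A A' 0 := ⟨_, hcd.hasDerivAt⟩
  have hgA : HasDerivAt (fun ε => g * A ε) (g * A') 0 := by
    have := hasDerivAt_matrix_mul (hasDerivAt_const (0 : ℝ) g) hA'
    refine this.congr_deriv ?_
    exact (congrArg (· + g * A') (Matrix.zero_mul _)).trans (zero_add _)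
  obtain ⟨w₁, w₂, w₃, hw⟩ := exists_skew_of_hasDerivAt hgA
    fun ε => hg.mul (cay_isRot _ _ _)
  refine ⟨w₁, w₂, w₃, ?_, ?_⟩
  · rintro ⟨rfl, rfl, rfl⟩
    have hsk : skew 0 0 0 = 0 := by
      ext i j
      fin_cases i <;> fin_cases j <;> simp [skew]
    rw [hsk, Matrix.mul_zero] at hw
    have h0 : A' = 0 := by
      have := congrArg (fun X => g.transpose * X) hw
      simpa only [← Matrix.mul_assoc, hg.1, Matrix.one_mul, Matrix.mul_zero] using this
    rw [h0] at hA'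
    exact hasDerivAt_cay_zero hA'
  · rw [hw] at hgA
    have ht : HasDerivAt (fun ε : ℝ => u 3 + ε * v 3) (v 3) 0 := by
      simpa using ((hasDerivAt_id (0 : ℝ)).mul_const (v 3)).const_add (u 3)
    have hu3 : u 3 + 0 * v 3 = u 3 := by ring
    have d₁ : HasDerivAt (fun ε : ℝ => x₁ (u 3 + ε * v 3)) (v 3 * deriv x₁ (u 3)) 0 := by
      have := hasDerivAt_of_smooth hS.isOpen hS.smooth₁ hI
      rw [← hu3] at this
      have := this.scomp (0 : ℝ) ht
      rw [hu3] at this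
      exact this
    have d₅ : HasDerivAt (fun ε : ℝ => x₅ (u 3 + ε * v 3)) (v 3 * deriv x₅ (u 3)) 0 := by
      have := hasDerivAt_of_smooth hS.isOpen hS.smooth₅ hI
      rw [← hu3] at this
      have := this.scomp (0 : ℝ) ht
      rw [hu3] at this
      exact this
    have da : HasDerivAt (fun ε : ℝ => a (u 3 + ε * v 3)) (v 3 • deriv a (u 3)) 0 := by
      have := hasDerivAt_of_smooth hS.isOpen hS.smooth hI
      rw [← hu3] at this
      have := this.scomp (0 : ℝ) ht
      rw [hu3] at this
      exact this
    have hmain := hasDerivAt_orbit hgA d₁ d₅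
      (by rw [hu3]; exact hS.sphere _ hI)
      (by rw [hu3]; linear_combination v 3 * hS.deriv_sphere hI) da
    have hf : HasDerivAt (fun ε : ℝ => orbitMap x₁ x₅ a g (u + ε • v))
        (fderiv ℝ (orbitMap x₁ x₅ a g) u v) 0 := by
      have h1 : HasFDerivAt (orbitMap x₁ x₅ a g) (fderiv ℝ (orbitMap x₁ x₅ a g) u)
          (u + (0 : ℝ) • v) := by
        rw [zero_smul, add_zero]
        exact (((contDiffOn_orbitMap hS g u hu).contDiffAt
          ((isOpen_orbitDomain hS.isOpen).mem_nhds hu)).differentiableAt (by simp)).hasFDerivAt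
      exact h1.comp_hasDerivAt (0 : ℝ) hline
    have hcongr : (fun ε : ℝ => orbitMap x₁ x₅ a g (u + ε • v)) = fun ε =>
        act (symRep (g * A ε) * frameMat (x₁ (u 3 + ε * v 3)) (x₅ (u 3 + ε * v 3)))
          (basePt (a (u 3 + ε * v 3))) := by
      funext ε
      rw [orbitMap_eq]
      rfl
    rw [hcongr] at hf
    rw [hf.unique hmain]
    have hθ : x₁ (u 3) * (v 3 * deriv x₅ (u 3)) - x₅ (u 3) * (v 3 * deriv x₁ (u 3))
        = v 3 * angVel x₁ x₅ (u 3) := by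
      rw [angVel]
      ring
    simp only [hA, zero_mul, add_zero, hθ]
    rfl

/-- The horizontal components are the infinitesimal rotation scaled by the nonzero eigenvalue
differences, so the rotation part vanishes; regularity of the path then removes the last parameter.
-/
theorem injective_fderiv_orbitMap (hS : IsSolution lam I x₁ x₅ a) {g : Matrix (Fin 3) (Fin 3) ℝ}
    (hg : IsRot g) {u : Fin 4 → ℝ} (hu : u ∈ orbitDomain I) :
    Function.Injective (fderiv ℝ (orbitMap x₁ x₅ a g) u) := by
  rw [injective_iff_map_eq_zero]
  intro v hv
  have hI : u 3 ∈ I := hu.2.2.2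
  obtain ⟨w₁, w₂, w₃, hw, hd⟩ := fderiv_orbitMap hS hg hu v
  rw [hv] at hd
  have h1 := congrArg (act (orbitRot x₁ x₅ g u).transpose) hd
  rw [(orbitRot_isRot hS hg hI).act_transpose_act] at h1
  have h0 : act (orbitRot x₁ x₅ g u).transpose 0 = 0 := by
    simp [act]
  rw [h0] at h1
  have hfst := congrArg Prod.fst h1
  have hx := hS.pos _ hI
  have hq₁ := sub_sqrt_three_mul_pos hx (hS.abs_lt _ hI) (hS.sphere _ hI)
  have hq₃ := add_sqrt_three_mul_pos hx (hS.abs_lt _ hI) (hS.sphere _ hI)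
  have e1 := congrFun hfst 1
  have e2 := congrFun hfst 2
  have e3 := congrFun hfst 3
  have e4 := congrFun hfst 4
  simp [genVec, genMat] at e1 e2 e3 e4
  have z2 : w₂ = 0 := e1.resolve_left hx.ne'
  have z1 : w₁ = 0 := e2.resolve_left hq₁.ne'
  have z3 : w₃ = 0 := e3.resolve_left hq₃.ne'
  obtain ⟨v0, v1, v2⟩ := hw ⟨z1, z2, z3⟩
  have v3 : v 3 = 0 := by
    by_contra hne
    have hθ := e4.resolve_left hne
    refine hS.regular' hI ⟨hθ, ?_⟩
    have hZ : genMat (x₁ (u 3)) (x₅ (u 3)) w₁ w₂ w₃ (v 3 * angVel x₁ x₅ (u 3)) = 0 := by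
      rw [hθ, z1, z2, z3]
      ext i j
      fin_cases i <;> fin_cases j <;> simp [genMat]
    have hsnd := congrArg Prod.snd h1
    simp only [genVec, hZ, Matrix.zero_mul, transpose_zero, Matrix.mul_zero, zero_add] at hsnd
    have k0 := congrFun (congrFun hsnd 1) 2
    have k1 := congrFun (congrFun hsnd 1) 3
    have k2 := congrFun (congrFun hsnd 1) 4
    simp [asd, hne] at k0 k1 k2
    ext i
    fin_cases i
    · exact k0
    · exact k1
    · exact k2
  ext i
  fin_cases i
  · exact v0
  · exact v1
  · exact v2
  · exact v3

end Chart

end BryantSalamon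
end

noncomputable section
namespace BryantSalamon

open Matrix Filter Set

/-! ## The union of the orbits is a submanifold -/

theorem isCompact_isRot : IsCompact {A : Matrix (Fin 3) (Fin 3) ℝ | IsRot A} := by
  have : ProperSpace (Matrix (Fin 3) (Fin 3) ℝ) := FiniteDimensional.proper ℝ _
  refine Metric.isCompact_of_isClosed_isBounded ?_ ?_
  · have h1 : Continuous fun A : Matrix (Fin 3) (Fin 3) ℝ => A.transpose * A :=
      (continuous_id.matrix_transpose).matrix_mul continuous_id
    have h2 : Continuous fun A : Matrix (Fin 3) (Fin 3) ℝ => A.det := continuous_id.matrix_det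
    exact (isClosed_eq h1 continuous_const).inter (isClosed_eq h2 continuous_const)
  · refine (Metric.isBounded_closedBall (x := (0 : Matrix (Fin 3) (Fin 3) ℝ)) (r := 1)).subset ?_
    intro A hA
    rw [mem_closedBall_zero_iff, Matrix.norm_le_iff zero_le_one]
    intro i j
    refine entry_norm_bound_of_unitary (mem_unitaryGroup_iff'.mpr ?_) i j
    rw [star_eq_conjTranspose, conjTranspose_eq_transpose_of_trivial]
    exact hA.1

theorem continuous_act :
    Continuous fun x : Matrix (Fin 5) (Fin 5) ℝ × Ambient => act x.1 x.2 := by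
  refine Continuous.prodMk ?_ ?_
  · exact continuous_fst.matrix_mulVec continuous_snd.fst
  · exact (continuous_fst.matrix_mul continuous_snd.snd).matrix_mul continuous_fst.matrix_transpose

theorem continuous_fibreInner :
    Continuous fun p : Ambient => fibreInner p.2 p.2 := by
  unfold fibreInner
  fun_prop

theorem continuousAt_cayInv {A : Matrix (Fin 3) (Fin 3) ℝ} (hA : 1 + A.trace ≠ 0) (i : Fin 3) :
    ContinuousAt (fun X => cayInv X i) A := by
  have he (i j : Fin 3) : ContinuousAt (fun X : Matrix (Fin 3) (Fin 3) ℝ => X i j) A :=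
    (continuous_id.matrix_elem i j).continuousAt
  have htr : ContinuousAt (fun X : Matrix (Fin 3) (Fin 3) ℝ => 1 + X.trace) A :=
    (continuous_const.add continuous_id.matrix_trace).continuousAt
  fin_cases i
  · exact ((he 2 1).sub (he 1 2)).div htr hA
  · exact ((he 0 2).sub (he 2 0)).div htr hA
  · exact ((he 1 0).sub (he 0 1)).div htr hA

theorem act_symRep_mul (A : Matrix (Fin 3) (Fin 3) ℝ) {B : Matrix (Fin 3) (Fin 3) ℝ}
    (hB : IsRot B) (p : Ambient) :
    act (symRep (A * B)) p = act (symRep A) (act (symRep B) p) := by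
  rw [symRep_mul A hB, act_mul]

theorem act_symRep_transpose {A : Matrix (Fin 3) (Fin 3) ℝ} (hA : IsRot A) (p : Ambient) :
    act (symRep A.transpose) (act (symRep A) p) = p := by
  rw [← act_symRep_mul _ hA, hA.1, symRep_one, act_one]

theorem IsRot.diagonal_eq_one {d : Fin 3 → ℝ} (hB : IsRot (diagonal d)) (hd : ∀ i, d i ^ 2 = 1)
    (htr : -1 < (diagonal d).trace) : diagonal d = 1 := by
  have hdet := hB.2
  rw [det_diagonal, Fin.prod_univ_three] at hdet
  rw [trace_diagonal, Fin.sum_univ_three] at htr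
  have key : d 0 = 1 ∧ d 1 = 1 ∧ d 2 = 1 := by
    rcases eq_or_eq_neg_of_sq_eq_sq _ 1 ((hd 0).trans (one_pow 2).symm) with h0 | h0 <;>
      rcases eq_or_eq_neg_of_sq_eq_sq _ 1 ((hd 1).trans (one_pow 2).symm) with h1 | h1 <;>
      rcases eq_or_eq_neg_of_sq_eq_sq _ 1 ((hd 2).trans (one_pow 2).symm) with h2 | h2 <;>
      rw [h0, h1, h2] at hdet htr <;>
      first | exact ⟨h0, h1, h2⟩ | linarith
  have hd1 : d = fun _ => 1 := by
    ext i
    fin_cases i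
    exacts [key.1, key.2.1, key.2.2]
  rw [hd1, Matrix.diagonal_one]

/-- A strictly monotone function on an open set has a continuous inverse on its image, whether or
not it is itself continuous. -/
theorem tendsto_of_strictMonoOn {α : Type*} {s : Set ℝ} (hs : IsOpen s) {φ : ℝ → ℝ}
    (hφ : StrictMonoOn φ s) {l : Filter α} {τ : α → ℝ} (hτ : ∀ᶠ x in l, τ x ∈ s) {t : ℝ}
    (ht : t ∈ s) (hlim : Tendsto (fun x => φ (τ x)) l (𝓝 (φ t))) : Tendsto τ l (𝓝 t) := by
  rw [tendsto_order]
  constructor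
  · intro b hb
    have h1 : ∀ᶠ x in 𝓝[<] t, x ∈ s ∧ x ∈ Ioo b t :=
      Filter.inter_mem (mem_nhdsWithin_of_mem_nhds (hs.mem_nhds ht)) (Ioo_mem_nhdsLT hb)
    obtain ⟨c, hc, hbc, hct⟩ := h1.exists
    filter_upwards [hτ, hlim.eventually (lt_mem_nhds (hφ hc ht hct))] with x hx hcx
    exact hbc.trans ((hφ.lt_iff_lt hc hx).1 hcx)
  · intro b hb
    have h1 : ∀ᶠ x in 𝓝[>] t, x ∈ s ∧ x ∈ Ioo t b :=
      Filter.inter_mem (mem_nhdsWithin_of_mem_nhds (hs.mem_nhds ht)) (Ioo_mem_nhdsGT hb)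
    obtain ⟨c, hc, htc, hcb⟩ := h1.exists
    filter_upwards [hτ, hlim.eventually (gt_mem_nhds (hφ ht hc htc))] with x hx hcx
    exact ((hφ.lt_iff_lt hx hc).1 hcx).trans hcb

section Orbits

variable {lam : ℝ} {I : Set ℝ} {x₁ x₅ : ℝ → ℝ} {a : ℝ → Fin 3 → ℝ}

/-- The union of the orbits of the points of the path. -/
def orbitSet (I : Set ℝ) (x₁ x₅ : ℝ → ℝ) (a : ℝ → Fin 3 → ℝ) : Set Ambient :=
  {q | ∃ A, IsRot A ∧ ∃ t ∈ I, q = act (symRep A) (path x₁ x₅ a t)}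

theorem fibreInner_act_path (hS : IsSolution lam I x₁ x₅ a) {A : Matrix (Fin 3) (Fin 3) ℝ}
    (hA : IsRot A) {t : ℝ} (ht : t ∈ I) :
    fibreInner (act (symRep A) (path x₁ x₅ a t)).2 (act (symRep A) (path x₁ x₅ a t)).2
      = a t 0 ^ 2 + a t 1 ^ 2 + a t 2 ^ 2 := by
  rw [← fibreInner_slicePt (hS.sphere t ht) (a t)]
  exact hA.symRep_isRot.fibreInner_conj _ _

/-- If points of the path converge to a point of an orbit that meets the path, then they converge
to the point of the path on this orbit. -/
theorem IsSolution.tendsto_of_tendsto_path (hS : IsSolution lam I x₁ x₅ a) {α : Type*}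
    {l : Filter α} [l.NeBot] {τ : α → ℝ} (hτ : ∀ᶠ x in l, τ x ∈ I)
    {B : Matrix (Fin 3) (Fin 3) ℝ} (hB : IsRot B) {t : ℝ} (ht : t ∈ I)
    (hlim : Tendsto (fun x => path x₁ x₅ a (τ x)) l (𝓝 (act (symRep B) (path x₁ x₅ a t)))) :
    Tendsto τ l (𝓝 t) := by
  set y := act (symRep B) (path x₁ x₅ a t) with hy
  have hfst (i : Fin 5) : Tendsto (fun x => ![x₁ (τ x), 0, 0, 0, x₅ (τ x)] i) l (𝓝 (y.1 i)) := by
    have h1 := (((continuous_apply i).comp continuous_fst).tendsto y).comp hlim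
    refine h1.congr fun x => ?_
    simp only [Function.comp, path, slicePt_fst]
  have l0 : Tendsto (fun x => x₁ (τ x)) l (𝓝 (y.1 0)) := hfst 0
  have l4 : Tendsto (fun x => x₅ (τ x)) l (𝓝 (y.1 4)) := hfst 4
  have e1 : y.1 1 = 0 := tendsto_nhds_unique (hfst 1) tendsto_const_nhds
  have e2 : y.1 2 = 0 := tendsto_nhds_unique (hfst 2) tendsto_const_nhds
  have e3 : y.1 3 = 0 := tendsto_nhds_unique (hfst 3) tendsto_const_nhds
  -- Only weak inequalities survive in the limit, which is why `IsRot.slice_eq` admits the closed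
  -- chamber for one of the two points.
  have hy0 : 0 ≤ y.1 0 := ge_of_tendsto l0 (hτ.mono fun x hx => (hS.pos _ hx).le)
  have hy4 : |y.1 4| ≤ 1 / 2 := le_of_tendsto l4.abs (hτ.mono fun x hx => (hS.abs_lt _ hx).le)
  have hy1 : y.1 0 ^ 2 + y.1 4 ^ 2 = 1 :=
    tendsto_nhds_unique ((l0.pow 2).add (l4.pow 2))
      (tendsto_const_nhds.congr' (hτ.mono fun x hx => (hS.sphere _ hx).symm))
  have heq : symRep B *ᵥ ![x₁ t, 0, 0, 0, x₅ t] = ![y.1 0, 0, 0, 0, y.1 4] := by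
    rw [← slicePt_fst (x₁ t) (x₅ t) (a t)]
    change y.1 = _
    ext i
    fin_cases i
    exacts [rfl, e1, e2, e3, rfl]
  obtain ⟨-, h5⟩ := hB.slice_eq (hS.pos t ht) (hS.abs_lt t ht) (hS.sphere t ht) hy0 hy4 hy1 heq
  rw [h5] at l4
  have lr : Tendsto (fun x => a (τ x) 0 ^ 2 + a (τ x) 1 ^ 2 + a (τ x) 2 ^ 2) l
      (𝓝 (a t 0 ^ 2 + a t 1 ^ 2 + a t 2 ^ 2)) := by
    rw [← fibreInner_act_path hS hB ht]
    refine ((continuous_fibreInner.tendsto y).comp hlim).congr' (hτ.mono fun x hx => ?_)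
    exact fibreInner_slicePt (hS.sphere _ hx) _
  obtain ⟨c, hc⟩ := hS.exists_strictMonoOn
  refine tendsto_of_strictMonoOn hS.isOpen hc hτ ht ?_
  exact ((((l4.const_mul 2).const_sub 1).pow 2).mul (lr.const_add lam)).const_mul c

theorem injOn_orbitMap (hS : IsSolution lam I x₁ x₅ a) {g : Matrix (Fin 3) (Fin 3) ℝ}
    (hg : IsRot g) : InjOn (orbitMap x₁ x₅ a g) (orbitDomain I) := by
  intro u hu v hv huv
  have hcu := cay_isRot (u 0) (u 1) (u 2)
  have hcv := cay_isRot (v 0) (v 1) (v 2)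
  have hB := hcv.transpose.mul hcu
  set B := (cay (v 0) (v 1) (v 2)).transpose * cay (u 0) (u 1) (u 2) with hBdef
  have h1 : act (symRep B) (path x₁ x₅ a (u 3)) = path x₁ x₅ a (v 3) := by
    have h2 := congrArg (act (symRep (g * cay (v 0) (v 1) (v 2)).transpose)) huv
    rw [orbitMap, orbitMap, act_symRep_transpose (hg.mul hcv), ← act_symRep_mul _ (hg.mul hcu),
      transpose_mul, Matrix.mul_assoc, ← Matrix.mul_assoc g.transpose, hg.1, Matrix.one_mul] at h2
    exact h2
  have h3 : u 3 = v 3 := by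
    -- Applied to a constant map, the convergence statement says that an orbit meets the path for
    -- one parameter only.
    have := hS.tendsto_of_tendsto_path (l := (pure () : Filter Unit)) (τ := fun _ => v 3)
      (Eventually.of_forall fun _ => hv.2.2.2) hB hu.2.2.2
      (by rw [h1]; exact tendsto_const_nhds)
    exact (tendsto_nhds_unique this tendsto_const_nhds)
  rw [← h3] at h1
  obtain ⟨⟨d, hBd, hd⟩, -⟩ := hS.stabilizer hB hu.2.2.2 h1
  -- The bounds `1/2` in `orbitDomain` keep the quaternionic real part at least `1 - 3/4 > 0`; among
  -- the diagonal sign matrices of determinant 1 only the identity has trace above `-1`.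
  have htr : -1 < B.trace := by
    have h := trace_cay_transpose_mul (v 0) (v 1) (v 2) (u 0) (u 1) (u 2)
    have hpos : 0 < 1 + v 0 * u 0 + v 1 * u 1 + v 2 * u 2 := by
      have hb {p q : ℝ} (hp : |p| < 1 / 2) (hq : |q| < 1 / 2) : -(1 / 4) ≤ p * q := by
        have : |p * q| ≤ 1 / 2 * (1 / 2) := by
          rw [abs_mul]
          exact mul_le_mul hp.le hq.le (abs_nonneg _) (by norm_num)
        linarith [neg_abs_le (p * q)]
      linarith [hb hv.1 hu.1, hb hv.2.1 hu.2.1, hb hv.2.2.1 hu.2.2.1]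
    have : 0 < 1 + B.trace := by
      rw [hBdef, h]
      positivity
    linarith
  have hB1 : B = 1 := by
    rw [hBd] at hB htr ⊢
    exact hB.diagonal_eq_one hd htr
  have hcay : cay (u 0) (u 1) (u 2) = cay (v 0) (v 1) (v 2) := by
    rw [← Matrix.one_mul (cay (u 0) (u 1) (u 2)), ← hcv.mul_transpose, Matrix.mul_assoc, ← hBdef,
      hB1, Matrix.mul_one]
  have hinv := congrArg cayInv hcay
  rw [cayInv_cay, cayInv_cay] at hinv
  ext i
  fin_cases i
  exacts [congrFun hinv 0, congrFun hinv 1, congrFun hinv 2, h3]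

/-- Along an ultrafilter converging to a point within the set, compactness makes the chosen
rotations converge, and monotonicity of `height` makes the parameters `τ` converge. It remains to
write nearby points as `orbitMap` of parameters tending to `u`. -/
theorem nhdsWithin_orbitSet_le (hS : IsSolution lam I x₁ x₅ a) {g : Matrix (Fin 3) (Fin 3) ℝ}
    (hg : IsRot g) {u : Fin 4 → ℝ} (hu : u 3 ∈ I) :
    𝓝[orbitSet I x₁ x₅ a] (orbitMap x₁ x₅ a g u) ≤ map (orbitMap x₁ x₅ a g) (𝓝 u) := by
  rw [le_iff_ultrafilter]
  intro l hl
  have hlM : ∀ᶠ q in (l : Filter Ambient), q ∈ orbitSet I x₁ x₅ a := hl self_mem_nhdsWithin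
  have hlf : Tendsto id (l : Filter Ambient) (𝓝 (orbitMap x₁ x₅ a g u)) :=
    hl.trans nhdsWithin_le_nhds
  have hex (q : Ambient) (hq : q ∈ orbitSet I x₁ x₅ a) :
      ∃ (A : Matrix (Fin 3) (Fin 3) ℝ) (t : ℝ), IsRot A ∧ t ∈ I ∧
        q = act (symRep A) (path x₁ x₅ a t) := by
    obtain ⟨A, hA, t, ht, h⟩ := hq
    exact ⟨A, t, hA, ht, h⟩
  choose! G τ hG hτ hq using hex
  obtain ⟨k, hk, hGk⟩ := isCompact_isRot.ultrafilter_le_nhds (l.map G)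
    (le_principal_iff.mpr (hlM.mono hG))
  have hGk : Tendsto G l (𝓝 k) := hGk
  have hcu := cay_isRot (u 0) (u 1) (u 2)
  have hA := hg.mul hcu
  set A := g * cay (u 0) (u 1) (u 2) with hAdef
  have hk : IsRot k := hk
  have hB := hk.transpose.mul hA
  set B := k.transpose * A with hBdef
  have hpath : Tendsto (fun q => path x₁ x₅ a (τ q)) l
      (𝓝 (act (symRep B) (path x₁ x₅ a (u 3)))) := by
    have h1 : Tendsto (fun q => symRep (G q).transpose) l (𝓝 (symRep k.transpose)) :=
      ((continuous_symRep.comp continuous_id.matrix_transpose).tendsto k).comp hGk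
    have h2 := (continuous_act.tendsto _).comp (h1.prodMk_nhds hlf)
    rw [hBdef, act_symRep_mul _ hA]
    refine h2.congr' (hlM.mono fun q hqM => ?_)
    have := act_symRep_transpose (hG q hqM) (path x₁ x₅ a (τ q))
    rw [← hq q hqM] at this
    exact this
  have hτu : Tendsto τ l (𝓝 (u 3)) :=
    hS.tendsto_of_tendsto_path (hlM.mono hτ) hB hu hpath
  have hfix : act (symRep B) (path x₁ x₅ a (u 3)) = path x₁ x₅ a (u 3) :=
    tendsto_nhds_unique hpath
      ((((contDiffOn_path hS).continuousOn.continuousAt (hS.isOpen.mem_nhds hu)).tendsto).comp hτu)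
  obtain ⟨-, hfix'⟩ := hS.stabilizer hB hu hfix
  -- The limit `k` of the rotations may differ from `A` by the stabiliser element `B`. Since `B`
  -- fixes the whole path, `G q` may be replaced by `G q * B`, which tends to `A`.
  set X : Ambient → Matrix (Fin 3) (Fin 3) ℝ := fun q => g.transpose * (G q * B) with hXdef
  have hX : Tendsto X l (𝓝 (cay (u 0) (u 1) (u 2))) := by
    have hc : Continuous fun Y : Matrix (Fin 3) (Fin 3) ℝ => g.transpose * (Y * B) :=
      continuous_const.matrix_mul (continuous_id.matrix_mul continuous_const)
    have h1 := (hc.tendsto k).comp hGk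
    have h2 : g.transpose * (k * B) = cay (u 0) (u 1) (u 2) := by
      rw [hBdef, ← Matrix.mul_assoc k, hk.mul_transpose, Matrix.one_mul, hAdef,
        ← Matrix.mul_assoc, hg.1, Matrix.one_mul]
    rw [h2] at h1
    exact h1
  have htr : 0 < 1 + (cay (u 0) (u 1) (u 2)).trace := by
    rw [one_add_trace_cay]
    positivity
  have hXtr : ∀ᶠ q in (l : Filter Ambient), -1 < (X q).trace := by
    have h1 : Tendsto (fun q => (X q).trace) l (𝓝 (cay (u 0) (u 1) (u 2)).trace) :=
      (continuous_id.matrix_trace.tendsto _).comp hX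
    exact h1.eventually (lt_mem_nhds (by linarith))
  set σ : Ambient → Fin 4 → ℝ := fun q =>
    ![cayInv (X q) 0, cayInv (X q) 1, cayInv (X q) 2, τ q] with hσ
  have hσu : Tendsto σ l (𝓝 u) := by
    have hc (i : Fin 3) : Tendsto (fun q => cayInv (X q) i) l (𝓝 (![u 0, u 1, u 2] i)) := by
      have h1 := (continuousAt_cayInv htr.ne' i).tendsto.comp hX
      rw [cayInv_cay] at h1
      exact h1
    rw [tendsto_pi_nhds]
    intro i
    fin_cases i
    exacts [hc 0, hc 1, hc 2, hτu]
  have hfσ : ∀ᶠ q in (l : Filter Ambient), orbitMap x₁ x₅ a g (σ q) = q := by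
    filter_upwards [hlM, hXtr] with q hqM hqt
    have hXq : IsRot (X q) := hg.transpose.mul ((hG q hqM).mul hB)
    have h1 : orbitMap x₁ x₅ a g (σ q) = act (symRep (g * X q)) (path x₁ x₅ a (τ q)) := by
      conv_rhs => rw [hXq.eq_cay hqt]
      rfl
    have h2 : g * X q = G q * B := by
      rw [hXdef, ← Matrix.mul_assoc, hg.mul_transpose, Matrix.one_mul]
    rw [h1, h2, act_symRep_mul _ hB, hfix' _ (hτ q hqM), ← hq q hqM]
  intro s hs
  have h1 : ∀ᶠ q in (l : Filter Ambient), orbitMap x₁ x₅ a g (σ q) ∈ s := hσu hs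
  filter_upwards [h1, hfσ] with q hq1 hq2
  rw [← hq2]
  exact hq1

theorem isChart_orbitMap (hS : IsSolution lam I x₁ x₅ a) {g : Matrix (Fin 3) (Fin 3) ℝ}
    (hg : IsRot g) : IsChart (orbitSet I x₁ x₅ a) (orbitDomain I) (orbitMap x₁ x₅ a g) where
  isOpen := isOpen_orbitDomain hS.isOpen
  contDiffOn := contDiffOn_orbitMap hS g
  injective_fderiv _ hu := injective_fderiv_orbitMap hS hg hu
  injOn := injOn_orbitMap hS hg
  mapsTo u hu := ⟨_, hg.mul (cay_isRot _ _ _), u 3, hu.2.2.2, rfl⟩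
  nhdsWithin_le _ hu := nhdsWithin_orbitSet_le hS hg hu.2.2.2

theorem exists_orbitMap_eq {p : Ambient} (hp : p ∈ orbitSet I x₁ x₅ a) :
    ∃ g, IsRot g ∧ ∃ u ∈ orbitDomain I, orbitMap x₁ x₅ a g u = p := by
  obtain ⟨A, hA, t, ht, rfl⟩ := hp
  refine ⟨A, hA, ![0, 0, 0, t], ?_, ?_⟩
  · simp [orbitDomain, ht]
  · simp [orbitMap, cay_zero]

end Orbits

end BryantSalamon
end

noncomputable section
namespace BryantSalamon

open Matrix Filter Set

/-! ## The union of the orbits is coassociative -/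

section Coassociative

variable {lam : ℝ} {I : Set ℝ} {x₁ x₅ : ℝ → ℝ} {a : ℝ → Fin 3 → ℝ}

theorem sFun_basePt_ne_zero (hlam : 0 < lam) (b : Fin 3 → ℝ) : sFun lam (basePt b) ≠ 0 := by
  have h : rho lam (basePt b) = lam + (b 0 ^ 2 + b 1 ^ 2 + b 2 ^ 2) := by
    rw [rho, basePt, fibreInner_asd]
    ring
  rw [sFun, h]
  exact (Real.rpow_pos_of_pos (rho_pos hlam b) _).ne'

theorem sFun_basePt_pow_four (hlam : 0 < lam) (b : Fin 3 → ℝ) :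
    sFun lam (basePt b) ^ 4 = lam + (b 0 ^ 2 + b 1 ^ 2 + b 2 ^ 2) := by
  have h : rho lam (basePt b) = lam + (b 0 ^ 2 + b 1 ^ 2 + b 2 ^ 2) := by
    rw [rho, basePt, fibreInner_asd]
    ring
  rw [sFun, h, ← Real.rpow_natCast, ← Real.rpow_mul (rho_pos hlam b).le]
  norm_num

theorem IsSolution.calibrated (hS : IsSolution lam I x₁ x₅ a) {p : Ambient}
    (hp : p ∈ orbitSet I x₁ x₅ a) {v : Fin 4 → Ambient}
    (hv : ∀ i, v i ∈ tangentVectors (orbitSet I x₁ x₅ a) p)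
    (hort : ∀ i j, metric lam p (v i) (v j) = if i = j then 1 else 0) :
    |starPhi lam p v| = 1 := by
  obtain ⟨g, hg, u, hu, rfl⟩ := exists_orbitMap_eq hp
  have hI : u 3 ∈ I := hu.2.2.2
  have hex (i : Fin 4) : ∃ (U : Ambient) (c : Fin 4 → ℝ), v i = act (orbitRot x₁ x₅ g u) U ∧
      HasCoords (a (u 3)) U (c ᵥ* tangentCoords (x₁ (u 3)) (x₅ (u 3)) (angVel x₁ x₅ (u 3))
        (a (u 3)) (deriv a (u 3))) := by
    obtain ⟨w, hw⟩ := (isChart_orbitMap hS hg).exists_fderiv_eq hu (hv i)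
    obtain ⟨w₁, w₂, w₃, -, hd⟩ := fderiv_orbitMap hS hg hu w
    exact ⟨_, ![w₁, w₂, w₃, w 3], hw.symm.trans hd, hasCoords_genVec _ _ _ _ _ _ _ _ _⟩
  choose U C hU hC using hex
  have hR := orbitRot_isRot hS hg hI
  obtain rfl : v = fun i => act (orbitRot x₁ x₅ g u) (U i) := funext hU
  have hpt : orbitMap x₁ x₅ a g u = act (orbitRot x₁ x₅ g u) (basePt (a (u 3))) := orbitMap_eq g u
  rw [hpt] at hort ⊢
  rw [hR.starPhi_act]
  set N := tangentCoords (x₁ (u 3)) (x₅ (u 3)) (angVel x₁ x₅ (u 3)) (a (u 3)) (deriv a (u 3))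
  have hC' (i : Fin 4) : HasCoords (a (u 3)) (U i) ((Matrix.of C * N) i) := hC i
  rw [starPhi_eq_psi hC']
  refine abs_psi_eq_one ((hS.eq _ hI).psi_sq (hS.sphere _ hI)
    (sFun_basePt_ne_zero hS.lam_pos _) ?_) ?_
  · rw [sFun_basePt_pow_four hS.lam_pos]
    exact logDeriv_mul hS.lam_pos _ _
  · ext i j
    have h1 := hort i j
    rw [hR.metric_act, metric_eq_coordGram (hC' i) (hC' j), dotProduct_mulVec] at h1
    rw [Matrix.one_apply, ← h1]
    rfl

theorem IsSolution.isCoassociative (hS : IsSolution lam I x₁ x₅ a) :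
    IsCoassociative lam (orbitSet I x₁ x₅ a) := by
  refine ⟨?_, isEmbeddedSubmanifold_of_charts fun p hp => ?_, fun p hp v hv h =>
    hS.calibrated hp hv h⟩
  · rintro p ⟨A, hA, t, ht, rfl⟩
    rw [path, slicePt, ← act_mul]
    exact basePt_mem _ (hA.symRep_isRot.mul (frameMat_isRot (hS.sphere t ht)))
  · obtain ⟨g, hg, hu⟩ := exists_orbitMap_eq hp
    exact ⟨_, _, isChart_orbitMap hS hg, hu⟩

theorem irrLift_image_orbitSet (g : Matrix.specialOrthogonalGroup (Fin 3) ℝ) :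
    irrLift g '' orbitSet I x₁ x₅ a = orbitSet I x₁ x₅ a := by
  have hg := isRot_of_mem g
  ext q
  constructor
  · rintro ⟨_, ⟨A, hA, t, ht, rfl⟩, rfl⟩
    exact ⟨g.1 * A, hg.mul hA, t, ht, (act_symRep_mul _ hA _).symm⟩
  · rintro ⟨A, hA, t, ht, rfl⟩
    refine ⟨_, ⟨g.1.transpose * A, hg.transpose.mul hA, t, ht, rfl⟩, ?_⟩
    rw [irrLift_eq, ← act_symRep_mul _ (hg.transpose.mul hA), ← Matrix.mul_assoc,
      hg.mul_transpose, Matrix.one_mul]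

theorem IsSolution.sweep_eq_orbitSet (hS : IsSolution lam I x₁ x₅ a) :
    (sweep I fun t => ofCoords ![x₁ t, 0, 0, 0, x₅ t] (a t)) = orbitSet I x₁ x₅ a := by
  have hpath (t : ℝ) (ht : t ∈ I) :
      ofCoords ![x₁ t, 0, 0, 0, x₅ t] (a t) = path x₁ x₅ a t :=
    ofCoords_eq (hS.pos t ht) (hS.sphere t ht) _
  ext q
  constructor
  · rintro ⟨g, t, ht, rfl⟩
    refine ⟨g.1, isRot_of_mem g, t, ht, ?_⟩
    rw [irrLift_eq, ← hpath t ht]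
  · rintro ⟨A, hA, t, ht, rfl⟩
    refine ⟨hA.toGroup, t, ht, ?_⟩
    rw [irrLift_eq, ← hpath t ht]
    rfl

end Coassociative

end BryantSalamon
end

theorem mainTheorem6 (lam : ℝ) (hlam : 0 < lam) (I : Set ℝ) (hIopen : IsOpen I)
    (hIconn : I.OrdConnected) (x₁ x₅ a₁ a₂ a₃ : ℝ → ℝ)
    (hx₁ : ContDiffOn ℝ (⊤ : ℕ∞) x₁ I) (hx₅ : ContDiffOn ℝ (⊤ : ℕ∞) x₅ I)
    (ha₁ : ContDiffOn ℝ (⊤ : ℕ∞) a₁ I) (ha₂ : ContDiffOn ℝ (⊤ : ℕ∞) a₂ I) (ha₃ : ContDiffOn ℝ (⊤ : ℕ∞) a₃ I)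
    (hpos : ∀ t ∈ I, 0 < x₁ t) (hlt : ∀ t ∈ I, |x₅ t| < 1 / 2)
    (hsphere : ∀ t ∈ I, x₁ t ^ 2 + x₅ t ^ 2 = 1)
    (hreg : ∀ t ∈ I, ¬ (deriv x₁ t = 0 ∧ deriv x₅ t = 0 ∧
      deriv a₁ t = 0 ∧ deriv a₂ t = 0 ∧ deriv a₃ t = 0))
    (hode₁ : ∀ t ∈ I,
      4 * ((2 * √3 * x₁ t + 4 * x₅ t + 1) * deriv x₅ t
          + √3 * (2 * x₅ t - 1) * deriv x₁ t) * a₁ t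
        + 8 * x₁ t * (-x₁ t + √3 * x₅ t) * deriv a₁ t
        - (√3 * x₁ t + x₅ t + 1) * (1 - 2 * x₅ t) * a₁ t
          * deriv (fun u => Real.log (lam + (a₁ u ^ 2 + a₂ u ^ 2 + a₃ u ^ 2))) t = 0)
    (hode₂ : ∀ t ∈ I,
      4 * ((2 * √3 * x₁ t - 4 * x₅ t - 1) * deriv x₅ t
          + √3 * (2 * x₅ t - 1) * deriv x₁ t) * a₂ t
        + 8 * x₁ t * (x₁ t + √3 * x₅ t) * deriv a₂ t
        + (-√3 * x₁ t + x₅ t + 1) * (1 - 2 * x₅ t) * a₂ t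
          * deriv (fun u => Real.log (lam + (a₁ u ^ 2 + a₂ u ^ 2 + a₃ u ^ 2))) t = 0)
    (hode₃ : ∀ t ∈ I,
      4 * (-(x₅ t + 1) * deriv x₅ t + 3 * x₁ t * deriv x₁ t) * a₃ t
        + 2 * (x₁ t ^ 2 - 3 * x₅ t ^ 2) * deriv a₃ t
        + (1 + x₅ t) * (1 - 2 * x₅ t) * a₃ t
          * deriv (fun u => Real.log (lam + (a₁ u ^ 2 + a₂ u ^ 2 + a₃ u ^ 2))) t = 0)
    (M : Set BryantSalamon.Ambient)
    (hM : M = BryantSalamon.sweep I fun t =>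
      BryantSalamon.ofCoords ![x₁ t, 0, 0, 0, x₅ t] ![a₁ t, a₂ t, a₃ t]) :
    BryantSalamon.IsCoassociative lam M ∧
      ∀ g : Matrix.specialOrthogonalGroup (Fin 3) ℝ, BryantSalamon.irrLift g '' M = M := by
  have hd₁ {t : ℝ} (ht : t ∈ I) := BryantSalamon.hasDerivAt_of_smooth hIopen ha₁ ht
  have hd₂ {t : ℝ} (ht : t ∈ I) := BryantSalamon.hasDerivAt_of_smooth hIopen ha₂ ht
  have hd₃ {t : ℝ} (ht : t ∈ I) := BryantSalamon.hasDerivAt_of_smooth hIopen ha₃ ht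
  have hd {t : ℝ} (ht : t ∈ I) :
      deriv (fun t => ![a₁ t, a₂ t, a₃ t]) t = ![deriv a₁ t, deriv a₂ t, deriv a₃ t] := by
    refine (hasDerivAt_pi.2 fun i => ?_).deriv
    fin_cases i
    exacts [hd₁ ht, hd₂ ht, hd₃ ht]
  have hlog {t : ℝ} (ht : t ∈ I) :
      deriv (fun u => Real.log (lam + (a₁ u ^ 2 + a₂ u ^ 2 + a₃ u ^ 2))) t
        = BryantSalamon.logDeriv lam ![a₁ t, a₂ t, a₃ t]
          ![deriv a₁ t, deriv a₂ t, deriv a₃ t] := by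
    have h := (((((hd₁ ht).fun_pow 2).fun_add ((hd₂ ht).fun_pow 2)).fun_add
      ((hd₃ ht).fun_pow 2)).const_add lam).log (by positivity)
    rw [h.deriv, BryantSalamon.logDeriv]
    simp
    ring
  have hS : BryantSalamon.IsSolution lam I x₁ x₅ fun t => ![a₁ t, a₂ t, a₃ t] := by
    refine ⟨hlam, hIopen, hIconn, hx₁, hx₅, ?_, hpos, hlt, hsphere, fun t ht h => ?_,
      fun t ht => ?_⟩
    · refine contDiffOn_pi.2 fun i => ?_
      fin_cases i
      exacts [ha₁, ha₂, ha₃]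
    · obtain ⟨h1, h2, h3⟩ := h
      rw [hd ht] at h3
      exact hreg t ht ⟨h1, h2, congrFun h3 0, congrFun h3 1, congrFun h3 2⟩
    · have hy : x₁ t * deriv x₁ t + x₅ t * deriv x₅ t = 0 := by
        have h1 := BryantSalamon.hasDerivAt_of_smooth hIopen hx₁ ht
        have h5 := BryantSalamon.hasDerivAt_of_smooth hIopen hx₅ ht
        exact BryantSalamon.sphere_deriv hIopen ht hsphere h1 h5
      have h₁ := hode₁ t ht
      have h₂ := hode₂ t ht
      have h₃ := hode₃ t ht
      rw [hlog ht] at h₁ h₂ h₃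
      rw [hd ht]
      exact .of_ode (hsphere t ht) hy h₁ h₂ h₃
  rw [hM, hS.sweep_eq_orbitSet]
  exact ⟨hS.isCoassociative, BryantSalamon.irrLift_image_orbitSet⟩
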